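/- Let $k$ be a field and $0\ne q\in k$. A Hecke symmetry with parameter $q$ on a finite-dimensional vector space $V$ is a linear operator $R$ on $V\otimes V$ with $(R+\mathrm{id})(R-q\,\mathrm{id})=0$ and $R_1R_2R_1=R_2R_1R_2$ on $V^{\otimes 3}$, where $R_1=R\otimes\mathrm{id}_V$, $R_2=\mathrm{id}_V\otimes R$. For $n\ge 0$ let $\mathcal H_n$ be the Hecke algebra, i.e. the unital $k$-algebra with generators $T_1,\dots,T_{n-1}$ and relations $T_iT_{i+1}T_i=T_{i+1}T_iT_{i+1}$, $T_iT_j=T_jT_i$ for $|i-j|>1$, and $(T_i+1)(T_i-q)=0$. It acts on $\mathbb T_n(V)=V^{\otimes n}$, with $T_i$ acting as $R$ on the tensor factors $i,i+1$. Let $R$ and $R'$ be Hecke symmetries with the same parameter $q$ on finite-dimensional spaces $V$ and $V'$. Pair $V^*\otimes V^*$ with $V\otimes V$ by $\langle\xi\otimes\eta,v\otimes w\rangle=\xi(v)\eta(w)$, and let $R^*$ be the operator on $V^*\otimes V^*$ adjoint to $R$. Define $A(R',R)$ as the quotient of the tensor algebra of $V'^*\otimes V$ by the ideal generated by the image of $\mathrm{id}\otimes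 R-R'^*\otimes\mathrm{id}$, where this operator acts on $V'^*\otimes V'^*\otimes V\otimes V$, identified with $(V'^*\otimes V)^{\otimes 2}$ by interchanging the two middle factors. Define $A(R,R')$, $A(R)=A(R,R)$ and $A(R')=A(R',R')$ in the same way. For Hecke symmetries $R,R',R''$ on $V,V',V''$ there are algebra homomorphisms $$A(R',R'')\to A(R',R)\otimes A(R,R''),\qquad \xi\otimes w\mapsto\sum_i(\xi\otimes e_i)\otimes(e^i\otimes w),$$ where $(e_i)$ is a basis of $V$ and $(e^i)$ is the dual basis of $V^*$. These, together with the counits $\xi\otimes v\mapsto\xi(v)$, make $A(R)$ and $A(R')$ bialgebras (the FRT bialgebras), $A(R',R)$ an $(A(R'),A(R))$-bicomodule algebra and $A(R,R')$ an $(A(R),A(R'))$-bicomodule algebra. The bialgebra $A(R)$ is coquasitriangular, with universal form $r$ determined by $r(\xi\otimes v,\eta\otimes w)=\langle\xi\otimes\eta,R(w\otimes v)\rangle$. Thus the monoidal category ${}^{A(R)}\mathcal M$ of left $A(R)$-comodules is braided by $x\otimes y\mapsto\sum r(x_{(-1)},y_{(-1)})\,y_{(0)}\otimes x_{(0)}$,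 and the monoidal category $\mathcal M^{A(R)}$ of right $A(R)$-comodules is braided by $x\otimes y\mapsto\sum r(y_{(1)},x_{(1)})\,y_{(0)}\otimes x_{(0)}$. These braidings restrict to $R^*$ on $V^*\otimes V^*$ and to $R$ on $V\otimes V$, respectively. The categories of comodules over $A(R')$ are braided in the same way by means of $R'$. **Theorem 7.2.** Suppose that for each $n>1$ the indecomposable $\mathcal H_n$-modules isomorphic to direct summands of $\mathbb T_n(V')$ are the same as those isomorphic to direct summands of $\mathbb T_n(V)$. Then the cotensor product functors $$A(R',R)\,\square_{A(R)}\,?\;:\;{}^{A(R)}\mathcal M\to{}^{A(R')}\mathcal M\qquad\text{and}\qquad ?\,\square_{A(R)}\,A(R,R')\;:\;\mathcal M^{A(R)}\to\mathcal M^{A(R')}$$ are braided monoidal equivalences. Here the monoidal structure of the first functor is given by $c\mapsto 1\otimes c$ on the unit object $k$ and by the restriction of $(a\otimes x)\otimes(b\otimes y)\mapsto ab\otimes(x\otimes y)$, and that of the second by $c\mapsto c\otimes 1$ and by the restriction of $(x\otimes a)\otimes(y\otimes b)\mapsto(x\otimes y)\otimes ab$. -/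

import Mathlib

open CategoryTheory MonoidalCategory TensorProduct Coalgebra

universe u

noncomputable section

section Shortcuts

/-! Shortcut instances; they are used only to speed up the elaboration of the proofs below. -/

variable {R M N : Type u} [CommSemiring R] [AddCommMonoid M] [AddCommMonoid N] [Module R M]
  [Module R N]

instance addHomClass_linearMap : AddHomClass (M →ₗ[R] N) M N := inferInstance
instance addHomClass_linearEquiv : AddHomClass (M ≃ₗ[R] N) M N := inferInstance
instance zeroHomClass_linearMap : ZeroHomClass (M →ₗ[R] N) M N := inferInstance
instance zeroHomClass_linearEquiv : ZeroHomClass (M ≃ₗ[R] N) M N := inferInstance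
instance addMonoidHomClass_linearMap : AddMonoidHomClass (M →ₗ[R] N) M N := inferInstance
instance addMonoidHomClass_linearEquiv : AddMonoidHomClass (M ≃ₗ[R] N) M N := inferInstance
instance mulActionHomClass_linearMap : MulActionHomClass (M →ₗ[R] N) R M N := inferInstance
instance mulActionHomClass_linearEquiv : MulActionHomClass (M ≃ₗ[R] N) R M N := inferInstance

end Shortcuts


@[elab_as_elim] lemma tensor_ind {k : Type u} [Field k] {M N : Type u} [AddCommGroup M] [Module k M]
    [AddCommGroup N] [Module k N] {P : M ⊗[k] N → Prop} (x : M ⊗[k] N)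
    (tmul : ∀ x y, P (x ⊗ₜ y)) (add : ∀ a b, P a → P b → P (a + b)) : P x :=
  TensorProduct.induction_on x (TensorProduct.zero_tmul (R := k) M (0 : N) ▸ tmul 0 0) tmul add

/-- A left comodule over a `k`-coalgebra `C`. -/
structure LeftComod (k : Type u) [Field k] (C : Type u) [AddCommGroup C] [Module k C]
    [Coalgebra k C] where
  /-- the underlying vector space -/
  carrier : Type u
  [addCommGroup : AddCommGroup carrier]
  [module : Module k carrier]
  /-- the coaction -/
  coact : carrier →ₗ[k] C ⊗[k] carrier
  coassoc : (TensorProduct.assoc k C C carrier).toLinearMap ∘ₗ comul.rTensor carrier ∘ₗ coact =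
    coact.lTensor C ∘ₗ coact
  counit_coact : (TensorProduct.lid k carrier).toLinearMap ∘ₗ counit.rTensor carrier ∘ₗ coact =
    LinearMap.id

/-- A right comodule over a `k`-coalgebra `C`. -/
structure RightComod (k : Type u) [Field k] (C : Type u) [AddCommGroup C] [Module k C]
    [Coalgebra k C] where
  /-- the underlying vector space -/
  carrier : Type u
  [addCommGroup : AddCommGroup carrier]
  [module : Module k carrier]
  /-- the coaction -/
  coact : carrier →ₗ[k] carrier ⊗[k] C
  coassoc : (TensorProduct.assoc k carrier C C).toLinearMap ∘ₗ coact.rTensor C ∘ₗ coact =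
    comul.lTensor carrier ∘ₗ coact
  counit_coact : (TensorProduct.rid k carrier).toLinearMap ∘ₗ counit.lTensor carrier ∘ₗ coact =
    LinearMap.id

namespace LeftComod

variable {k : Type u} [Field k] {C : Type u} [AddCommGroup C] [Module k C] [Coalgebra k C]

attribute [instance] LeftComod.addCommGroup LeftComod.module

instance : CoeSort (LeftComod k C) (Type u) := ⟨LeftComod.carrier⟩

/-- Homomorphisms of left comodules. -/
@[ext] structure Hom (X Y : LeftComod k C) where
  /-- the underlying linear map -/
  lin : X →ₗ[k] Y
  comm : Y.coact ∘ₗ lin = lin.lTensor C ∘ₗ X.coact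

instance : Category.{u} (LeftComod k C) where
  Hom X Y := Hom X Y
  id X := ⟨LinearMap.id, by simp⟩
  comp f g := ⟨g.lin ∘ₗ f.lin, by
    rw [← LinearMap.comp_assoc, g.comm, LinearMap.comp_assoc, f.comm, ← LinearMap.comp_assoc,
      ← LinearMap.lTensor_comp]⟩

@[ext] lemma hom_ext {X Y : LeftComod k C} {f g : X ⟶ Y} (h : f.lin = g.lin) : f = g := Hom.ext h

@[simp] lemma id_lin (X : LeftComod k C) : Hom.lin (𝟙 X) = LinearMap.id := rfl
@[simp] lemma comp_lin {X Y Z : LeftComod k C} (f : X ⟶ Y) (g : Y ⟶ Z) :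
    (f ≫ g).lin = g.lin ∘ₗ f.lin := rfl

lemma coassoc_apply (X : LeftComod k C) (x : X) :
    TensorProduct.assoc k C C X (comul.rTensor X (X.coact x)) = X.coact.lTensor C (X.coact x) :=
  LinearMap.congr_fun X.coassoc x

lemma counit_apply (X : LeftComod k C) (x : X) :
    TensorProduct.lid k X (counit.rTensor X (X.coact x)) = x :=
  LinearMap.congr_fun X.counit_coact x

lemma comm_apply {X Y : LeftComod k C} (f : X ⟶ Y) (x : X) :
    Y.coact (f.lin x) = f.lin.lTensor C (X.coact x) :=
  LinearMap.congr_fun f.comm x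

/-- A bijective homomorphism of comodules, as an isomorphism in the category. -/
def isoMk {X Y : LeftComod k C} (e : X ≃ₗ[k] Y)
    (h : Y.coact ∘ₗ e.toLinearMap = e.toLinearMap.lTensor C ∘ₗ X.coact) : X ≅ Y where
  hom := ⟨e.toLinearMap, h⟩
  inv := ⟨e.symm.toLinearMap, by
    ext y
    obtain ⟨x, rfl⟩ := e.surjective y
    have := LinearMap.congr_fun h x
    simp only [LinearMap.comp_apply, LinearEquiv.coe_coe] at this ⊢
    rw [this, ← LinearMap.comp_apply, ← LinearMap.lTensor_comp]
    simp⟩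
  hom_inv_id := by ext; simp
  inv_hom_id := by ext; simp

@[simp] lemma isoMk_hom_lin {X Y : LeftComod k C} (e : X ≃ₗ[k] Y) (h) :
    Hom.lin (isoMk e h).hom = e.toLinearMap := rfl
@[simp] lemma isoMk_inv_lin {X Y : LeftComod k C} (e : X ≃ₗ[k] Y) (h) :
    Hom.lin (isoMk e h).inv = e.symm.toLinearMap := rfl

/-- The outer tensor product of comodules over two coalgebras. -/
abbrev outer {D : Type u} [AddCommGroup D] [Module k D] [Coalgebra k D]
    (X : LeftComod k C) (Y : LeftComod k D) : LeftComod k (C ⊗[k] D) where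
  carrier := X ⊗[k] Y
  coact := (tensorTensorTensorComm k C X D Y).toLinearMap ∘ₗ TensorProduct.map X.coact Y.coact
  coassoc := by
    set Q : (C ⊗[k] (C ⊗[k] X)) ⊗[k] (D ⊗[k] (D ⊗[k] Y)) →ₗ[k]
        (C ⊗[k] D) ⊗[k] ((C ⊗[k] D) ⊗[k] (X ⊗[k] Y)) :=
      (tensorTensorTensorComm k C X D Y).toLinearMap.lTensor _ ∘ₗ
        (tensorTensorTensorComm k C (C ⊗[k] X) D (D ⊗[k] Y)).toLinearMap with hQ
    have h1 : ∀ (s : C ⊗[k] X) (t : D ⊗[k] Y),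
        TensorProduct.assoc k (C ⊗[k] D) (C ⊗[k] D) (X ⊗[k] Y)
          (comul.rTensor (X ⊗[k] Y) (tensorTensorTensorComm k C X D Y (s ⊗ₜ t))) =
        Q (TensorProduct.assoc k C C X (comul.rTensor X s) ⊗ₜ
          TensorProduct.assoc k D D Y (comul.rTensor Y t)) := by
      intro s t
      induction s using tensor_ind with
      | add a b ha hb => simp only [TensorProduct.add_tmul, map_add, ha, hb]
      | tmul c x =>
        induction t using tensor_ind with
        | add a b ha hb => simp only [TensorProduct.tmul_add, map_add, ha, hb]
        | tmul d y =>
          simp only [tensorTensorTensorComm_tmul, LinearMap.rTensor_tmul,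
            TensorProduct.comul_tmul]
          generalize (comul c : C ⊗[k] C) = p
          generalize (comul d : D ⊗[k] D) = p'
          induction p using tensor_ind with
          | add a b ha hb => simp only [TensorProduct.add_tmul, map_add, ha, hb]
          | tmul c1 c2 =>
            induction p' using tensor_ind with
            | add a b ha hb => simp only [TensorProduct.add_tmul, TensorProduct.tmul_add, map_add, ha, hb]
            | tmul d1 d2 => simp [Q]
    have h2 : ∀ (s : C ⊗[k] X) (t : D ⊗[k] Y),
        ((tensorTensorTensorComm k C X D Y).toLinearMap ∘ₗ
          TensorProduct.map X.coact Y.coact).lTensor (C ⊗[k] D)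
            (tensorTensorTensorComm k C X D Y (s ⊗ₜ t)) =
        Q (X.coact.lTensor C s ⊗ₜ Y.coact.lTensor D t) := by
      intro s t
      induction s using tensor_ind with
      | add a b ha hb => simp only [TensorProduct.add_tmul, map_add, ha, hb]
      | tmul c x =>
        induction t using tensor_ind with
        | add a b ha hb => simp only [TensorProduct.tmul_add, map_add, ha, hb]
        | tmul d y => simp [Q]
    ext x y
    simp only [TensorProduct.AlgebraTensorModule.curry_apply, LinearMap.restrictScalars_self,
      TensorProduct.curry_apply, LinearMap.comp_apply, LinearEquiv.coe_coe, TensorProduct.map_tmul]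
    rw [h1, h2, coassoc_apply, coassoc_apply]
  counit_coact := by
    have h1 : ∀ (s : C ⊗[k] X) (t : D ⊗[k] Y),
        TensorProduct.lid k (X ⊗[k] Y)
          (counit.rTensor (X ⊗[k] Y) (tensorTensorTensorComm k C X D Y (s ⊗ₜ t))) =
        TensorProduct.lid k X (counit.rTensor X s) ⊗ₜ
          TensorProduct.lid k Y (counit.rTensor Y t) := by
      intro s t
      induction s using tensor_ind with
      | add a b ha hb => simp only [TensorProduct.add_tmul, map_add, ha, hb]
      | tmul c x =>
        induction t using tensor_ind with
        | add a b ha hb => simp only [TensorProduct.tmul_add, map_add, ha, hb]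
        | tmul d y =>
          simp only [tensorTensorTensorComm_tmul, LinearMap.rTensor_tmul, TensorProduct.counit_tmul,
            TensorProduct.lid_tmul, TensorProduct.smul_tmul_smul, smul_eq_mul, mul_comm]
    ext x y
    simp only [TensorProduct.AlgebraTensorModule.curry_apply, LinearMap.restrictScalars_self,
      TensorProduct.curry_apply, LinearMap.comp_apply, LinearEquiv.coe_coe, TensorProduct.map_tmul]
    rw [h1, counit_apply, counit_apply]
    rfl

/-- Restriction of the coaction along a homomorphism of coalgebras. -/
abbrev corestrict {D : Type u} [AddCommGroup D] [Module k D] [Coalgebra k D]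
    (φ : C →ₗc[k] D) (X : LeftComod k C) : LeftComod k D where
  carrier := X
  coact := φ.toLinearMap.rTensor X ∘ₗ X.coact
  coassoc := by
    have h1 : ∀ s : C ⊗[k] X, TensorProduct.assoc k D D X
        (comul.rTensor X (φ.toLinearMap.rTensor X s)) =
        TensorProduct.map φ.toLinearMap (φ.toLinearMap.rTensor X)
          (TensorProduct.assoc k C C X (comul.rTensor X s)) := by
      intro s
      induction s using tensor_ind with
      | add a b ha hb => simp only [map_add, ha, hb]
      | tmul c x =>
        have h := CoalgHomClass.map_comp_comul_apply φ c
        simp only [LinearMap.rTensor_tmul]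
        erw [← h]
        generalize (comul c : C ⊗[k] C) = p
        induction p using tensor_ind with
        | add a b ha hb => simp only [TensorProduct.add_tmul, map_add, ha, hb]
        | tmul c1 c2 => simp
    ext x
    simp only [LinearMap.comp_apply, LinearEquiv.coe_coe]
    rw [h1, coassoc_apply]
    generalize X.coact x = s
    induction s using tensor_ind with
    | add a b ha hb => simp only [map_add, ha, hb]
    | tmul c x => simp
  counit_coact := by
    ext x
    simp only [LinearMap.comp_apply, LinearEquiv.coe_coe]
    conv_rhs => rw [LinearMap.id_apply, ← X.counit_apply x]
    generalize X.coact x = s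
    induction s using tensor_ind with
    | add a b ha hb => simp only [map_add, ha, hb]
    | tmul c x => simp

end LeftComod

/-- Multiplication of a bialgebra, as a homomorphism of coalgebras. -/
def mulCoalgHom (k : Type u) [Field k] (A : Type u) [Ring A] [Bialgebra k A] :
    A ⊗[k] A →ₗc[k] A where
  __ := LinearMap.mul' k A
  counit_comp := by ext a b; simp [mul_comm]
  map_comp_comul := by
    ext a b
    simp only [TensorProduct.AlgebraTensorModule.curry_apply, LinearMap.restrictScalars_self,
      TensorProduct.curry_apply, LinearMap.comp_apply, TensorProduct.comul_tmul,
      LinearMap.mul'_apply, Bialgebra.comul_mul]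
    generalize (comul a : A ⊗[k] A) = p
    generalize (comul b : A ⊗[k] A) = q
    induction p using tensor_ind with
    | add a b ha hb => simp only [TensorProduct.add_tmul, add_mul, map_add, ha, hb]
    | tmul a1 a2 =>
      induction q using tensor_ind with
      | add a b ha hb => simp only [TensorProduct.tmul_add, mul_add, map_add, ha, hb]
      | tmul b1 b2 => simp

namespace LeftComod

section Monoidal

variable {k : Type u} [Field k] {A : Type u} [Ring A] [Bialgebra k A]

/-- The linear map `(a ⊗ x) ⊗ (b ⊗ y) ↦ ab ⊗ (x ⊗ y)`. -/
def mm {A : Type u} [Ring A] [Algebra k A]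
    (X Y : Type u) [AddCommGroup X] [Module k X] [AddCommGroup Y] [Module k Y] :
    (A ⊗[k] X) ⊗[k] (A ⊗[k] Y) →ₗ[k] A ⊗[k] (X ⊗[k] Y) :=
  (LinearMap.mul' k A).rTensor (X ⊗[k] Y) ∘ₗ (tensorTensorTensorComm k A X A Y).toLinearMap

section mm
variable {B : Type u} [Ring B] [Algebra k B] {X Y Z X' Y' : Type u}
  [AddCommGroup X] [Module k X] [AddCommGroup Y] [Module k Y] [AddCommGroup Z] [Module k Z]
  [AddCommGroup X'] [Module k X'] [AddCommGroup Y'] [Module k Y']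

@[simp] lemma mm_tmul (a b : B) (x : X) (y : Y) :
    mm X Y ((a ⊗ₜ[k] x) ⊗ₜ[k] (b ⊗ₜ[k] y)) = (a * b) ⊗ₜ[k] (x ⊗ₜ[k] y) := by
  simp [mm]

lemma mm_natural (f : X →ₗ[k] X') (g : Y →ₗ[k] Y') (s : B ⊗[k] X) (t : B ⊗[k] Y) :
    mm X' Y' (f.lTensor B s ⊗ₜ[k] g.lTensor B t) =
      (TensorProduct.map f g).lTensor B (mm X Y (s ⊗ₜ[k] t)) := by
  induction s using tensor_ind with
  | add a b ha hb => simp only [TensorProduct.add_tmul, map_add, ha, hb]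
  | tmul c x =>
    induction t using tensor_ind with
    | add a b ha hb => simp only [TensorProduct.tmul_add, map_add, ha, hb]
    | tmul d y => simp

lemma mm_assoc (s : B ⊗[k] X) (t : B ⊗[k] Y) (r : B ⊗[k] Z) :
    mm X (Y ⊗[k] Z) (s ⊗ₜ[k] mm Y Z (t ⊗ₜ[k] r)) =
      (TensorProduct.assoc k X Y Z).toLinearMap.lTensor B
        (mm (X ⊗[k] Y) Z (mm X Y (s ⊗ₜ[k] t) ⊗ₜ[k] r)) := by
  induction s using tensor_ind with
  | add a b ha hb => simp only [TensorProduct.add_tmul, map_add, ha, hb]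
  | tmul c x =>
    induction t using tensor_ind with
    | add a b ha hb =>
      simp only [TensorProduct.add_tmul, TensorProduct.tmul_add, map_add, ha, hb]
    | tmul d y =>
      induction r using tensor_ind with
      | add a b ha hb => simp only [TensorProduct.tmul_add, map_add, ha, hb]
      | tmul e z => simp [mul_assoc]

lemma mm_one_left (a : k) (t : B ⊗[k] X) :
    (TensorProduct.lid k X).toLinearMap.lTensor B (mm k X ((1 ⊗ₜ[k] a) ⊗ₜ[k] t)) = a • t := by
  induction t using tensor_ind with
  | add a b ha hb => simp only [TensorProduct.tmul_add, map_add, ha, hb, smul_add]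
  | tmul c x => simp

lemma mm_one_right (t : B ⊗[k] X) (a : k) :
    (TensorProduct.rid k X).toLinearMap.lTensor B (mm X k (t ⊗ₜ[k] (1 ⊗ₜ[k] a))) = a • t := by
  induction t using tensor_ind with
  | add a b ha hb => simp only [TensorProduct.add_tmul, map_add, ha, hb, smul_add]
  | tmul c x => simp

end mm

/-- Tensor product of comodules: `x ⊗ y ↦ x₍₋₁₎ y₍₋₁₎ ⊗ (x₍₀₎ ⊗ y₍₀₎)`. -/
abbrev tensor (X Y : LeftComod k A) : LeftComod k A where
  carrier := X ⊗[k] Y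
  coact := mm X Y ∘ₗ TensorProduct.map X.coact Y.coact
  coassoc := ((outer X Y).corestrict (mulCoalgHom k A)).coassoc
  counit_coact := ((outer X Y).corestrict (mulCoalgHom k A)).counit_coact

/-- The trivial comodule. -/
abbrev trivial : LeftComod k A where
  carrier := k
  coact := TensorProduct.mk k A k 1
  coassoc := by ext; simp [Algebra.TensorProduct.one_def]
  counit_coact := by ext; simp

/-- Tensor product of homomorphisms. -/
abbrev tensorMap {X Y X' Y' : LeftComod k A} (f : X ⟶ Y) (g : X' ⟶ Y') :
    tensor X X' ⟶ tensor Y Y' where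
  lin := TensorProduct.map f.lin g.lin
  comm := by
    refine TensorProduct.ext' fun x x' => ?_
    simp only [LinearMap.comp_apply, TensorProduct.map_tmul]
    rw [comm_apply, comm_apply, mm_natural]

instance : MonoidalCategoryStruct (LeftComod k A) where
  tensorObj := tensor
  tensorUnit := trivial
  tensorHom := tensorMap
  whiskerLeft X _ _ f := tensorMap (𝟙 X) f
  whiskerRight f Y := tensorMap f (𝟙 Y)
  associator X Y Z := isoMk (X := tensor (tensor X Y) Z) (Y := tensor X (tensor Y Z))
    (TensorProduct.assoc k X Y Z) <| TensorProduct.ext_threefold fun _ _ _ => mm_assoc _ _ _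
  leftUnitor X := isoMk (X := tensor trivial X) (Y := X) (TensorProduct.lid k X) <|
    TensorProduct.ext' fun (a : k) x => (X.coact.map_smul a x).trans (mm_one_left _ _).symm
  rightUnitor X := isoMk (X := tensor X trivial) (Y := X) (TensorProduct.rid k X) <|
    TensorProduct.ext' fun x (a : k) => (X.coact.map_smul a x).trans (mm_one_right _ _).symm

@[simp] lemma tensorHom_lin {X Y X' Y' : LeftComod k A} (f : X ⟶ Y) (g : X' ⟶ Y') :
    (f ⊗ₘ g).lin = TensorProduct.map f.lin g.lin := rfl
@[simp] lemma whiskerLeft_lin (X : LeftComod k A) {Y Y' : LeftComod k A} (g : Y ⟶ Y') :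
    (X ◁ g).lin = g.lin.lTensor X := rfl
@[simp] lemma whiskerRight_lin {X X' : LeftComod k A} (g : X ⟶ X') (Y : LeftComod k A) :
    (g ▷ Y).lin = g.lin.rTensor Y := rfl
@[simp] lemma associator_hom_lin (X Y Z : LeftComod k A) :
    (α_ X Y Z).hom.lin = (TensorProduct.assoc k X Y Z).toLinearMap := rfl
@[simp] lemma associator_inv_lin (X Y Z : LeftComod k A) :
    (α_ X Y Z).inv.lin = (TensorProduct.assoc k X Y Z).symm.toLinearMap := rfl
@[simp] lemma leftUnitor_hom_lin (X : LeftComod k A) :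
    (λ_ X).hom.lin = (TensorProduct.lid k X).toLinearMap := rfl
@[simp] lemma rightUnitor_hom_lin (X : LeftComod k A) :
    (ρ_ X).hom.lin = (TensorProduct.rid k X).toLinearMap := rfl

instance : MonoidalCategory (LeftComod k A) where
  tensorHom_def f g := by
    ext1; exact TensorProduct.ext' fun x y => rfl
  id_tensorHom_id X Y := by ext1; exact TensorProduct.ext' fun x y => rfl
  tensorHom_comp_tensorHom f g f' g' := by ext1; exact TensorProduct.ext' fun x y => rfl
  whiskerLeft_id X Y := by ext1; exact TensorProduct.ext' fun x y => rfl
  id_whiskerRight X Y := by ext1; exact TensorProduct.ext' fun x y => rfl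
  associator_naturality f g h := by
    ext1; exact TensorProduct.ext_threefold fun x y z => rfl
  leftUnitor_naturality f := by
    ext1; exact TensorProduct.ext' fun (a : k) x => (f.lin.map_smul a x).symm
  rightUnitor_naturality f := by
    ext1; exact TensorProduct.ext' fun x (a : k) => (f.lin.map_smul a x).symm
  pentagon W X Y Z := by
    ext1; exact TensorProduct.ext_fourfold fun w x y z => rfl
  triangle X Y := by
    ext1
    exact TensorProduct.ext_threefold fun x (a : k) y => TensorProduct.tmul_smul a x y

end Monoidal
end LeftComod

/-- A coquasitriangular structure on a bialgebra `A`: a convolution invertible bilinear form `r`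
with `r(a, bc) = r(a₍₁₎, b) r(a₍₂₎, c)`, `r(ab, c) = r(b, c₍₁₎) r(a, c₍₂₎)` and
`r(a₍₁₎, b₍₁₎) b₍₂₎ a₍₂₎ = a₍₁₎ b₍₁₎ r(a₍₂₎, b₍₂₎)`. The products below are convolution products. -/
class Coquasitriangular (k : Type u) [Field k] (A : Type u) [Ring A] [Bialgebra k A] where
  /-- the bilinear form -/
  r : A ⊗[k] A →ₗ[k] k
  /-- its convolution inverse -/
  rInv : A ⊗[k] A →ₗ[k] k
  r_mul_rInv : WithConv.toConv r * WithConv.toConv rInv = 1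
  rInv_mul_r : WithConv.toConv rInv * WithConv.toConv r = 1
  r_mul_right (b c : A) : WithConv.toConv (r ∘ₗ (TensorProduct.mk k A A).flip (b * c)) =
    WithConv.toConv (r ∘ₗ (TensorProduct.mk k A A).flip b) *
      WithConv.toConv (r ∘ₗ (TensorProduct.mk k A A).flip c)
  r_mul_left (a b : A) : WithConv.toConv (r ∘ₗ TensorProduct.mk k A A (a * b)) =
    WithConv.toConv (r ∘ₗ TensorProduct.mk k A A b) *
      WithConv.toConv (r ∘ₗ TensorProduct.mk k A A a)
  r_comm : WithConv.toConv (Algebra.linearMap k A ∘ₗ r) *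
      WithConv.toConv (LinearMap.mul' k A ∘ₗ (TensorProduct.comm k A A).toLinearMap) =
    WithConv.toConv (LinearMap.mul' k A) * WithConv.toConv (Algebra.linearMap k A ∘ₗ r)

namespace LeftComod

section Action
variable {k : Type u} [Field k] {C : Type u} [AddCommGroup C] [Module k C] [Coalgebra k C]

/-- The action `z ↦ f(z₍₋₁₎) z₍₀₎` of a linear form `f` on a comodule. -/
def act (Z : LeftComod k C) (f : C →ₗ[k] k) : Z →ₗ[k] Z :=
  (TensorProduct.lid k Z).toLinearMap ∘ₗ f.rTensor Z ∘ₗ Z.coact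

lemma act_apply (Z : LeftComod k C) (f : C →ₗ[k] k) (z : Z) :
    Z.act f z = TensorProduct.lid k Z (f.rTensor Z (Z.coact z)) := rfl

lemma conv_coact {B : Type u} [Ring B] [Algebra k B] (Z : LeftComod k C)
    (F G : C →ₗ[k] B) (z : Z) :
    (WithConv.toConv F * WithConv.toConv G).ofConv.rTensor Z (Z.coact z) =
      (LinearMap.mul' k B).rTensor Z ((TensorProduct.assoc k B B Z).symm
        (TensorProduct.map F (G.rTensor Z ∘ₗ Z.coact) (Z.coact z))) := by
  have h1 : ∀ s : C ⊗[k] Z, TensorProduct.map F (G.rTensor Z ∘ₗ Z.coact) s =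
      TensorProduct.map F (G.rTensor Z) (Z.coact.lTensor C s) := by
    intro s
    induction s using tensor_ind with
    | add a b ha hb => simp only [map_add, ha, hb]
    | tmul c x => simp
  rw [h1, ← Z.coassoc_apply]
  generalize Z.coact z = s
  induction s using tensor_ind with
  | add a b ha hb => simp only [map_add, ha, hb]
  | tmul c x =>
    simp only [LinearMap.rTensor_tmul]
    erw [LinearMap.convMul_apply]
    generalize (comul c : C ⊗[k] C) = p
    induction p using tensor_ind with
    | add a b ha hb => simp only [TensorProduct.add_tmul, map_add, ha, hb]
    | tmul c1 c2 => simp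

lemma act_act (Z : LeftComod k C) (f g : C →ₗ[k] k) (z : Z) :
    Z.act g (Z.act f z) = Z.act (WithConv.toConv f * WithConv.toConv g).ofConv z := by
  rw [act_apply Z (WithConv.toConv f * WithConv.toConv g).ofConv, conv_coact, act_apply Z f]
  generalize Z.coact z = s
  induction s using tensor_ind with
  | add a b ha hb => simp only [map_add, ha, hb]
  | tmul c x =>
    simp only [LinearMap.rTensor_tmul, TensorProduct.lid_tmul, map_smul, TensorProduct.map_tmul,
      LinearMap.comp_apply, act_apply]
    generalize Z.coact x = t
    induction t using tensor_ind with
    | add a b ha hb => simp only [TensorProduct.tmul_add, map_add, smul_add, ha, hb]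
    | tmul c x => simp [mul_smul]

lemma act_one (Z : LeftComod k C) (z : Z) :
    Z.act (1 : WithConv (C →ₗ[k] k)).ofConv z = z := Z.counit_apply z

end Action

section Braiding
variable {k : Type u} [Field k] {A : Type u} [Ring A] [Bialgebra k A]

lemma tensor_coact_eq_outer (X Y : LeftComod k A) (w : X ⊗[k] Y) :
    (tensor X Y).coact w = (LinearMap.mul' k A).rTensor _ ((outer X Y).coact w) := rfl

lemma tensor_coact_comm (X Y : LeftComod k A) (w : X ⊗[k] Y) :
    (tensor Y X).coact (TensorProduct.comm k X Y w) =
      (TensorProduct.comm k X Y).toLinearMap.lTensor A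
        ((LinearMap.mul' k A ∘ₗ (TensorProduct.comm k A A).toLinearMap).rTensor _
          ((outer X Y).coact w)) := by
  induction w using tensor_ind with
  | add a b ha hb => simp only [map_add, ha, hb]
  | tmul x y =>
    simp only [TensorProduct.comm_tmul, LinearMap.comp_apply, TensorProduct.map_tmul]
    generalize X.coact x = s
    generalize Y.coact y = t
    induction s using tensor_ind with
    | add a b ha hb =>
      simp only [TensorProduct.add_tmul, TensorProduct.tmul_add, map_add, ha, hb]
    | tmul c x =>
      induction t using tensor_ind with
      | add a b ha hb =>
        simp only [TensorProduct.add_tmul, TensorProduct.tmul_add, map_add, ha, hb]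
      | tmul d y => simp

variable [Coquasitriangular k A]

open Coquasitriangular

/-- The braiding `x ⊗ y ↦ r(x₍₋₁₎, y₍₋₁₎) y₍₀₎ ⊗ x₍₀₎`. -/
def braidLin (X Y : LeftComod k A) : X ⊗[k] Y →ₗ[k] Y ⊗[k] X :=
  (TensorProduct.comm k X Y).toLinearMap ∘ₗ (outer X Y).act (r (k := k) (A := A))

/-- Auxiliary linear map `(a ⊗ x) ⊗ (b ⊗ y) ↦ r(a, b) y ⊗ x`. -/
def braidAux (X Y : LeftComod k A) : (A ⊗[k] X) ⊗[k] (A ⊗[k] Y) →ₗ[k] Y ⊗[k] X :=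
  (TensorProduct.comm k X Y).toLinearMap ∘ₗ (TensorProduct.lid k (X ⊗[k] Y)).toLinearMap ∘ₗ
    r.rTensor (X ⊗[k] Y) ∘ₗ (tensorTensorTensorComm k A X A Y).toLinearMap

@[simp] lemma braidAux_tmul (X Y : LeftComod k A) (a b : A) (x : X) (y : Y) :
    braidAux X Y ((a ⊗ₜ x) ⊗ₜ (b ⊗ₜ y)) = r (k := k) (a ⊗ₜ[k] b) • (y ⊗ₜ[k] x) := by
  simp [braidAux]

lemma braidLin_tmul (X Y : LeftComod k A) (x : X) (y : Y) :
    braidLin X Y (x ⊗ₜ y) = braidAux X Y (X.coact x ⊗ₜ Y.coact y) := rfl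

lemma braidAux_right (X Y : LeftComod k A) (x : X) (b : A) (y : Y) :
    braidAux X Y (X.coact x ⊗ₜ (b ⊗ₜ y)) =
      y ⊗ₜ X.act (r (k := k) ∘ₗ (TensorProduct.mk k A A).flip b) x := by
  rw [act_apply]
  generalize X.coact x = s
  induction s using tensor_ind with
  | add a b ha hb => simp only [TensorProduct.add_tmul, map_add, ha, hb, TensorProduct.tmul_add]
  | tmul a x => simp

lemma braidAux_left (X Y : LeftComod k A) (a : A) (x : X) (y : Y) :
    braidAux X Y ((a ⊗ₜ x) ⊗ₜ Y.coact y) =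
      Y.act (r (k := k) ∘ₗ TensorProduct.mk k A A a) y ⊗ₜ x := by
  rw [act_apply]
  generalize Y.coact y = s
  induction s using tensor_ind with
  | add a b ha hb => simp only [TensorProduct.add_tmul, map_add, ha, hb, TensorProduct.tmul_add]
  | tmul a x => simp [TensorProduct.smul_tmul']

/-- The braiding as an invertible linear map. -/
def braidEquiv (X Y : LeftComod k A) : X ⊗[k] Y ≃ₗ[k] Y ⊗[k] X :=
  LinearEquiv.ofLinearMap (braidLin X Y)
    ((outer X Y).act rInv ∘ₗ (TensorProduct.comm k Y X).toLinearMap)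
    (by
      ext1; ext1 y; ext1 x
      change TensorProduct.comm k X Y ((outer X Y).act r ((outer X Y).act rInv (x ⊗ₜ y))) = _
      rw [act_act, rInv_mul_r, act_one]; rfl)
    (by
      refine LinearMap.ext fun w => ?_
      change (outer X Y).act rInv (TensorProduct.comm k Y X (TensorProduct.comm k X Y
        ((outer X Y).act r w))) = _
      rw [TensorProduct.comm_comm, act_act, r_mul_rInv, act_one]; rfl)

lemma braidLin_colinear (X Y : LeftComod k A) :
    (tensor Y X).coact ∘ₗ braidLin X Y =
      (braidLin X Y).lTensor A ∘ₗ (tensor X Y).coact := by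
  refine LinearMap.ext fun w => ?_
  have h := congrArg (fun F => F.ofConv.rTensor (X ⊗[k] Y) ((outer X Y).coact w))
    (r_comm (k := k) (A := A))
  simp only at h
  rw [conv_coact (outer X Y), conv_coact (outer X Y)] at h
  have e1 : ∀ s : (A ⊗[k] A) ⊗[k] (X ⊗[k] Y),
      (LinearMap.mul' k A).rTensor (X ⊗[k] Y) ((TensorProduct.assoc k A A (X ⊗[k] Y)).symm
        (TensorProduct.map (Algebra.linearMap k A ∘ₗ r)
          ((LinearMap.mul' k A ∘ₗ (TensorProduct.comm k A A).toLinearMap).rTensor (X ⊗[k] Y) ∘ₗ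
            (outer X Y).coact) s)) =
      (LinearMap.mul' k A ∘ₗ (TensorProduct.comm k A A).toLinearMap).rTensor (X ⊗[k] Y)
        ((outer X Y).coact (TensorProduct.lid k (X ⊗[k] Y) (r.rTensor (X ⊗[k] Y) s))) := by
    intro s
    induction s using tensor_ind with
    | add a b ha hb => simp only [map_add, ha, hb]
    | tmul p v =>
      simp only [TensorProduct.map_tmul, LinearMap.rTensor_tmul, TensorProduct.lid_tmul, map_smul]
      rw [LinearMap.comp_apply, LinearMap.comp_apply (LinearMap.rTensor _ _)]
      generalize (outer X Y).coact v = t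
      induction t using tensor_ind with
      | add a b ha hb => simp only [TensorProduct.tmul_add, map_add, smul_add, ha, hb]
      | tmul q u => simp [Algebra.algebraMap_eq_smul_one, TensorProduct.smul_tmul']
  have e2 : ∀ s : (A ⊗[k] A) ⊗[k] (X ⊗[k] Y),
      (LinearMap.mul' k A).rTensor (X ⊗[k] Y) ((TensorProduct.assoc k A A (X ⊗[k] Y)).symm
        (TensorProduct.map (LinearMap.mul' k A)
          ((Algebra.linearMap k A ∘ₗ r).rTensor (X ⊗[k] Y) ∘ₗ (outer X Y).coact) s)) =
      ((outer X Y).act r).lTensor A ((LinearMap.mul' k A).rTensor _ s) := by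
    intro s
    induction s using tensor_ind with
    | add a b ha hb => simp only [map_add, ha, hb]
    | tmul p v =>
      simp only [TensorProduct.map_tmul, LinearMap.rTensor_tmul, LinearMap.lTensor_tmul]
      rw [LinearMap.comp_apply, act_apply]
      generalize (outer X Y).coact v = t
      induction t using tensor_ind with
      | add a b ha hb => simp only [TensorProduct.tmul_add, map_add, ha, hb]
      | tmul q u => simp [Algebra.algebraMap_eq_smul_one, TensorProduct.smul_tmul']
  rw [e1, e2] at h
  change (tensor Y X).coact (TensorProduct.comm k X Y ((outer X Y).act r w)) =
    (braidLin X Y).lTensor A ((LinearMap.mul' k A).rTensor _ ((outer X Y).coact w))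
  refine (tensor_coact_comm X Y _).trans
    ((congrArg ((TensorProduct.comm k X Y).toLinearMap.lTensor A) h).trans ?_)
  rw [braidLin, LinearMap.lTensor_comp]
  rfl

instance : BraidedCategory (LeftComod k A) where
  braiding X Y := isoMk (X := tensor X Y) (Y := tensor Y X) (braidEquiv X Y)
    (braidLin_colinear X Y)
  braiding_naturality_right X Y Z f := by
    ext1
    refine TensorProduct.ext' fun x y => ?_
    change braidAux X Z (X.coact x ⊗ₜ Z.coact (f.lin y)) =
      f.lin.rTensor X (braidAux X Y (X.coact x ⊗ₜ Y.coact y))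
    rw [comm_apply]
    generalize Y.coact y = t
    induction t using tensor_ind with
    | add a b ha hb => simp only [TensorProduct.tmul_add, map_add, ha, hb]
    | tmul b y => simp [braidAux_right]
  braiding_naturality_left {X Y} f Z := by
    ext1
    refine TensorProduct.ext' fun x z => ?_
    change braidAux Y Z (Y.coact (f.lin x) ⊗ₜ Z.coact z) =
      f.lin.lTensor Z (braidAux X Z (X.coact x ⊗ₜ Z.coact z))
    rw [comm_apply]
    generalize X.coact x = t
    induction t using tensor_ind with
    | add a b ha hb => simp only [TensorProduct.add_tmul, map_add, ha, hb]
    | tmul b y => simp [braidAux_left]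
  hexagon_forward X Y Z := by
    ext1
    refine TensorProduct.ext_threefold fun x y z => ?_
    change TensorProduct.assoc k Y Z X
        (braidAux X (tensor Y Z) (X.coact x ⊗ₜ mm Y Z (Y.coact y ⊗ₜ Z.coact z))) =
      (braidLin X Z).lTensor Y (TensorProduct.assoc k Y X Z
        (braidAux X Y (X.coact x ⊗ₜ Y.coact y) ⊗ₜ z))
    generalize Y.coact y = t
    induction t using tensor_ind with
    | add a b ha hb => simp only [TensorProduct.add_tmul, TensorProduct.tmul_add, map_add, ha, hb]
    | tmul b y =>
      rw [braidAux_right, TensorProduct.assoc_tmul, LinearMap.lTensor_tmul, braidLin_tmul]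
      generalize Z.coact z = u
      induction u using tensor_ind with
      | add a b ha hb => simp only [TensorProduct.tmul_add, map_add, ha, hb]
      | tmul c z =>
        rw [mm_tmul]
        erw [braidAux_right X (tensor Y Z)]
        rw [braidAux_right, act_act, ← r_mul_right]
        rfl
  hexagon_reverse X Y Z := by
    ext1
    refine TensorProduct.ext (LinearMap.ext fun x => TensorProduct.ext' fun y z => ?_)
    change (TensorProduct.assoc k Z X Y).symm
        (braidAux (tensor X Y) Z (mm X Y (X.coact x ⊗ₜ Y.coact y) ⊗ₜ Z.coact z)) =
      (braidLin X Z).rTensor Y ((TensorProduct.assoc k X Z Y).symm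
        (x ⊗ₜ braidAux Y Z (Y.coact y ⊗ₜ Z.coact z)))
    generalize Y.coact y = t
    induction t using tensor_ind with
    | add a b ha hb => simp only [TensorProduct.add_tmul, TensorProduct.tmul_add, map_add, ha, hb]
    | tmul b y =>
      rw [braidAux_left, TensorProduct.assoc_symm_tmul, LinearMap.rTensor_tmul, braidLin_tmul]
      generalize X.coact x = u
      induction u using tensor_ind with
      | add a b ha hb => simp only [TensorProduct.add_tmul, map_add, ha, hb]
      | tmul c x =>
        rw [mm_tmul]
        erw [braidAux_left (tensor X Y) Z]
        rw [braidAux_left, act_act, ← r_mul_left]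
        rfl

end Braiding
end LeftComod

namespace RightComod

variable {k : Type u} [Field k] {C : Type u} [AddCommGroup C] [Module k C] [Coalgebra k C]

attribute [instance] RightComod.addCommGroup RightComod.module

instance : CoeSort (RightComod k C) (Type u) := ⟨RightComod.carrier⟩

/-- Homomorphisms of right comodules. -/
@[ext] structure Hom (X Y : RightComod k C) where
  /-- the underlying linear map -/
  lin : X →ₗ[k] Y
  comm : Y.coact ∘ₗ lin = lin.rTensor C ∘ₗ X.coact

instance : Category.{u} (RightComod k C) where
  Hom X Y := Hom X Y
  id X := ⟨LinearMap.id, by simp⟩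
  comp f g := ⟨g.lin ∘ₗ f.lin, by
    rw [← LinearMap.comp_assoc, g.comm, LinearMap.comp_assoc, f.comm, ← LinearMap.comp_assoc,
      ← LinearMap.rTensor_comp]⟩

@[ext] lemma hom_ext {X Y : RightComod k C} {f g : X ⟶ Y} (h : f.lin = g.lin) : f = g := Hom.ext h

@[simp] lemma id_lin (X : RightComod k C) : Hom.lin (𝟙 X) = LinearMap.id := rfl
@[simp] lemma comp_lin {X Y Z : RightComod k C} (f : X ⟶ Y) (g : Y ⟶ Z) :
    (f ≫ g).lin = g.lin ∘ₗ f.lin := rfl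

lemma coassoc_apply (X : RightComod k C) (x : X) :
    TensorProduct.assoc k X C C (X.coact.rTensor C (X.coact x)) = comul.lTensor X (X.coact x) :=
  LinearMap.congr_fun X.coassoc x

lemma counit_apply (X : RightComod k C) (x : X) :
    TensorProduct.rid k X (counit.lTensor X (X.coact x)) = x :=
  LinearMap.congr_fun X.counit_coact x

lemma comm_apply {X Y : RightComod k C} (f : X ⟶ Y) (x : X) :
    Y.coact (f.lin x) = f.lin.rTensor C (X.coact x) :=
  LinearMap.congr_fun f.comm x

/-- A bijective homomorphism of comodules, as an isomorphism in the category. -/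
def isoMk {X Y : RightComod k C} (e : X ≃ₗ[k] Y)
    (h : Y.coact ∘ₗ e.toLinearMap = e.toLinearMap.rTensor C ∘ₗ X.coact) : X ≅ Y where
  hom := ⟨e.toLinearMap, h⟩
  inv := ⟨e.symm.toLinearMap, by
    ext y
    obtain ⟨x, rfl⟩ := e.surjective y
    have := LinearMap.congr_fun h x
    simp only [LinearMap.comp_apply, LinearEquiv.coe_coe] at this ⊢
    rw [this, ← LinearMap.comp_apply, ← LinearMap.rTensor_comp]
    simp⟩
  hom_inv_id := by ext; simp
  inv_hom_id := by ext; simp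

@[simp] lemma isoMk_hom_lin {X Y : RightComod k C} (e : X ≃ₗ[k] Y) (h) :
    Hom.lin (isoMk e h).hom = e.toLinearMap := rfl
@[simp] lemma isoMk_inv_lin {X Y : RightComod k C} (e : X ≃ₗ[k] Y) (h) :
    Hom.lin (isoMk e h).inv = e.symm.toLinearMap := rfl

/-- The outer tensor product of comodules over two coalgebras. -/
abbrev outer {D : Type u} [AddCommGroup D] [Module k D] [Coalgebra k D]
    (X : RightComod k C) (Y : RightComod k D) : RightComod k (C ⊗[k] D) where
  carrier := X ⊗[k] Y
  coact := (tensorTensorTensorComm k X C Y D).toLinearMap ∘ₗ TensorProduct.map X.coact Y.coact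
  coassoc := by
    set Q : (X ⊗[k] (C ⊗[k] C)) ⊗[k] (Y ⊗[k] (D ⊗[k] D)) →ₗ[k]
        (X ⊗[k] Y) ⊗[k] ((C ⊗[k] D) ⊗[k] (C ⊗[k] D)) :=
      (tensorTensorTensorComm k C C D D).toLinearMap.lTensor _ ∘ₗ
        (tensorTensorTensorComm k X (C ⊗[k] C) Y (D ⊗[k] D)).toLinearMap with hQ
    have h1 : ∀ (s : X ⊗[k] C) (t : Y ⊗[k] D),
        comul.lTensor (X ⊗[k] Y) (tensorTensorTensorComm k X C Y D (s ⊗ₜ t)) =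
        Q (comul.lTensor X s ⊗ₜ comul.lTensor Y t) := by
      intro s t
      induction s using tensor_ind with
      | add a b ha hb => simp only [TensorProduct.add_tmul, map_add, ha, hb]
      | tmul x c =>
        induction t using tensor_ind with
        | add a b ha hb => simp only [TensorProduct.tmul_add, map_add, ha, hb]
        | tmul y d =>
          simp only [tensorTensorTensorComm_tmul, LinearMap.lTensor_tmul,
            TensorProduct.comul_tmul]
          generalize (comul c : C ⊗[k] C) = p
          generalize (comul d : D ⊗[k] D) = p'
          induction p using tensor_ind with
          | add a b ha hb => simp only [TensorProduct.add_tmul, TensorProduct.tmul_add, map_add, ha, hb]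
          | tmul c1 c2 =>
            induction p' using tensor_ind with
            | add a b ha hb => simp only [TensorProduct.tmul_add, map_add, ha, hb]
            | tmul d1 d2 => simp [Q]
    have h2 : ∀ (s : X ⊗[k] C) (t : Y ⊗[k] D),
        TensorProduct.assoc k (X ⊗[k] Y) (C ⊗[k] D) (C ⊗[k] D)
          (((tensorTensorTensorComm k X C Y D).toLinearMap ∘ₗ
          TensorProduct.map X.coact Y.coact).rTensor (C ⊗[k] D)
            (tensorTensorTensorComm k X C Y D (s ⊗ₜ t))) =
        Q (TensorProduct.assoc k X C C (X.coact.rTensor C s) ⊗ₜ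
          TensorProduct.assoc k Y D D (Y.coact.rTensor D t)) := by
      intro s t
      induction s using tensor_ind with
      | add a b ha hb => simp only [TensorProduct.add_tmul, map_add, ha, hb]
      | tmul x c =>
        induction t using tensor_ind with
        | add a b ha hb => simp only [TensorProduct.tmul_add, map_add, ha, hb]
        | tmul y d =>
          simp only [tensorTensorTensorComm_tmul, LinearMap.rTensor_tmul, LinearMap.comp_apply,
            TensorProduct.map_tmul]
          generalize X.coact x = p
          generalize Y.coact y = p'
          induction p using tensor_ind with
          | add a b ha hb => simp only [TensorProduct.add_tmul, map_add, ha, hb]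
          | tmul c1 c2 =>
            induction p' using tensor_ind with
            | add a b ha hb => simp only [TensorProduct.add_tmul, TensorProduct.tmul_add, map_add, ha, hb]
            | tmul d1 d2 => simp [Q]
    ext x y
    simp only [TensorProduct.AlgebraTensorModule.curry_apply, LinearMap.restrictScalars_self,
      TensorProduct.curry_apply, LinearMap.comp_apply, LinearEquiv.coe_coe, TensorProduct.map_tmul]
    rw [h1, h2, coassoc_apply, coassoc_apply]
  counit_coact := by
    have h1 : ∀ (s : X ⊗[k] C) (t : Y ⊗[k] D),
        TensorProduct.rid k (X ⊗[k] Y)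
          (counit.lTensor (X ⊗[k] Y) (tensorTensorTensorComm k X C Y D (s ⊗ₜ t))) =
        TensorProduct.rid k X (counit.lTensor X s) ⊗ₜ
          TensorProduct.rid k Y (counit.lTensor Y t) := by
      intro s t
      induction s using tensor_ind with
      | add a b ha hb => simp only [TensorProduct.add_tmul, map_add, ha, hb]
      | tmul x c =>
        induction t using tensor_ind with
        | add a b ha hb => simp only [TensorProduct.tmul_add, map_add, ha, hb]
        | tmul y d =>
          simp only [tensorTensorTensorComm_tmul, LinearMap.lTensor_tmul, TensorProduct.counit_tmul,
            TensorProduct.rid_tmul, TensorProduct.smul_tmul_smul, smul_eq_mul, mul_comm]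
    ext x y
    simp only [TensorProduct.AlgebraTensorModule.curry_apply, LinearMap.restrictScalars_self,
      TensorProduct.curry_apply, LinearMap.comp_apply, LinearEquiv.coe_coe, TensorProduct.map_tmul]
    rw [h1, counit_apply, counit_apply]
    rfl

/-- Restriction of the coaction along a homomorphism of coalgebras. -/
abbrev corestrict {D : Type u} [AddCommGroup D] [Module k D] [Coalgebra k D]
    (φ : C →ₗc[k] D) (X : RightComod k C) : RightComod k D where
  carrier := X
  coact := φ.toLinearMap.lTensor X ∘ₗ X.coact
  coassoc := by
    have h1 : ∀ s : X ⊗[k] C,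
        comul.lTensor X (φ.toLinearMap.lTensor X s) =
        (TensorProduct.map φ.toLinearMap φ.toLinearMap).lTensor X (comul.lTensor X s) := by
      intro s
      induction s using tensor_ind with
      | add a b ha hb => simp only [map_add, ha, hb]
      | tmul x c =>
        have h := CoalgHomClass.map_comp_comul_apply φ c
        simp only [LinearMap.lTensor_tmul]
        erw [← h]
        rfl
    ext x
    simp only [LinearMap.comp_apply, LinearEquiv.coe_coe]
    rw [h1, ← coassoc_apply]
    generalize X.coact x = s
    induction s using tensor_ind with
    | add a b ha hb => simp only [map_add, ha, hb]
    | tmul x c =>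
      simp only [LinearMap.rTensor_tmul, LinearMap.lTensor_tmul, LinearMap.comp_apply]
      generalize X.coact x = p
      induction p using tensor_ind with
      | add a b ha hb => simp only [TensorProduct.add_tmul, map_add, ha, hb]
      | tmul c1 c2 => simp
  counit_coact := by
    ext x
    simp only [LinearMap.comp_apply, LinearEquiv.coe_coe]
    conv_rhs => rw [LinearMap.id_apply, ← X.counit_apply x]
    generalize X.coact x = s
    induction s using tensor_ind with
    | add a b ha hb => simp only [map_add, ha, hb]
    | tmul x c => simp

section Monoidal

variable {A : Type u} [Ring A] [Bialgebra k A]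

/-- The linear map `(x ⊗ a) ⊗ (y ⊗ b) ↦ (x ⊗ y) ⊗ ab`. -/
def mm {A : Type u} [Ring A] [Algebra k A]
    (X Y : Type u) [AddCommGroup X] [Module k X] [AddCommGroup Y] [Module k Y] :
    (X ⊗[k] A) ⊗[k] (Y ⊗[k] A) →ₗ[k] (X ⊗[k] Y) ⊗[k] A :=
  (LinearMap.mul' k A).lTensor (X ⊗[k] Y) ∘ₗ (tensorTensorTensorComm k X A Y A).toLinearMap

section mm
variable {B : Type u} [Ring B] [Algebra k B] {X Y Z X' Y' : Type u}
  [AddCommGroup X] [Module k X] [AddCommGroup Y] [Module k Y] [AddCommGroup Z] [Module k Z]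
  [AddCommGroup X'] [Module k X'] [AddCommGroup Y'] [Module k Y']

@[simp] lemma mm_tmul (a b : B) (x : X) (y : Y) :
    mm X Y ((x ⊗ₜ[k] a) ⊗ₜ[k] (y ⊗ₜ[k] b)) = (x ⊗ₜ[k] y) ⊗ₜ[k] (a * b) := by
  simp [mm]

lemma mm_natural (f : X →ₗ[k] X') (g : Y →ₗ[k] Y') (s : X ⊗[k] B) (t : Y ⊗[k] B) :
    mm X' Y' (f.rTensor B s ⊗ₜ[k] g.rTensor B t) =
      (TensorProduct.map f g).rTensor B (mm X Y (s ⊗ₜ[k] t)) := by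
  induction s using tensor_ind with
  | add a b ha hb => simp only [TensorProduct.add_tmul, map_add, ha, hb]
  | tmul x c =>
    induction t using tensor_ind with
    | add a b ha hb => simp only [TensorProduct.tmul_add, map_add, ha, hb]
    | tmul y d => simp

lemma mm_assoc (s : X ⊗[k] B) (t : Y ⊗[k] B) (r : Z ⊗[k] B) :
    mm X (Y ⊗[k] Z) (s ⊗ₜ[k] mm Y Z (t ⊗ₜ[k] r)) =
      (TensorProduct.assoc k X Y Z).toLinearMap.rTensor B
        (mm (X ⊗[k] Y) Z (mm X Y (s ⊗ₜ[k] t) ⊗ₜ[k] r)) := by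
  induction s using tensor_ind with
  | add a b ha hb => simp only [TensorProduct.add_tmul, map_add, ha, hb]
  | tmul x c =>
    induction t using tensor_ind with
    | add a b ha hb =>
      simp only [TensorProduct.add_tmul, TensorProduct.tmul_add, map_add, ha, hb]
    | tmul y d =>
      induction r using tensor_ind with
      | add a b ha hb => simp only [TensorProduct.tmul_add, map_add, ha, hb]
      | tmul z e => simp [mul_assoc]

lemma mm_one_left (a : k) (t : X ⊗[k] B) :
    (TensorProduct.lid k X).toLinearMap.rTensor B (mm k X ((a ⊗ₜ[k] 1) ⊗ₜ[k] t)) = a • t := by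
  induction t using tensor_ind with
  | add a b ha hb => simp only [TensorProduct.tmul_add, map_add, ha, hb, smul_add]
  | tmul x c => simp [TensorProduct.smul_tmul']

lemma mm_one_right (t : X ⊗[k] B) (a : k) :
    (TensorProduct.rid k X).toLinearMap.rTensor B (mm X k (t ⊗ₜ[k] (a ⊗ₜ[k] 1))) = a • t := by
  induction t using tensor_ind with
  | add a b ha hb => simp only [TensorProduct.add_tmul, map_add, ha, hb, smul_add]
  | tmul x c => simp [TensorProduct.smul_tmul']

end mm

/-- Tensor product of comodules: `x ⊗ y ↦ (x₍₀₎ ⊗ y₍₀₎) ⊗ x₍₁₎ y₍₁₎`. -/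
abbrev tensor (X Y : RightComod k A) : RightComod k A where
  carrier := X ⊗[k] Y
  coact := mm X Y ∘ₗ TensorProduct.map X.coact Y.coact
  coassoc := ((outer X Y).corestrict (mulCoalgHom k A)).coassoc
  counit_coact := ((outer X Y).corestrict (mulCoalgHom k A)).counit_coact

/-- The trivial comodule. -/
abbrev trivial : RightComod k A where
  carrier := k
  coact := (TensorProduct.mk k k A).flip 1
  coassoc := by ext; simp [Algebra.TensorProduct.one_def]
  counit_coact := by ext; simp

/-- Tensor product of homomorphisms. -/
abbrev tensorMap {X Y X' Y' : RightComod k A} (f : X ⟶ Y) (g : X' ⟶ Y') :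
    tensor X X' ⟶ tensor Y Y' where
  lin := TensorProduct.map f.lin g.lin
  comm := by
    refine TensorProduct.ext' fun x x' => ?_
    simp only [LinearMap.comp_apply, TensorProduct.map_tmul]
    rw [comm_apply, comm_apply, mm_natural]

instance : MonoidalCategoryStruct (RightComod k A) where
  tensorObj := tensor
  tensorUnit := trivial
  tensorHom := tensorMap
  whiskerLeft X _ _ f := tensorMap (𝟙 X) f
  whiskerRight f Y := tensorMap f (𝟙 Y)
  associator X Y Z := isoMk (X := tensor (tensor X Y) Z) (Y := tensor X (tensor Y Z))
    (TensorProduct.assoc k X Y Z) <| TensorProduct.ext_threefold fun _ _ _ => mm_assoc _ _ _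
  leftUnitor X := isoMk (X := tensor trivial X) (Y := X) (TensorProduct.lid k X) <|
    TensorProduct.ext' fun (a : k) x => (X.coact.map_smul a x).trans (mm_one_left _ _).symm
  rightUnitor X := isoMk (X := tensor X trivial) (Y := X) (TensorProduct.rid k X) <|
    TensorProduct.ext' fun x (a : k) => (X.coact.map_smul a x).trans (mm_one_right _ _).symm

@[simp] lemma tensorHom_lin {X Y X' Y' : RightComod k A} (f : X ⟶ Y) (g : X' ⟶ Y') :
    (f ⊗ₘ g).lin = TensorProduct.map f.lin g.lin := rfl
@[simp] lemma whiskerLeft_lin (X : RightComod k A) {Y Y' : RightComod k A} (g : Y ⟶ Y') :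
    (X ◁ g).lin = g.lin.lTensor X := rfl
@[simp] lemma whiskerRight_lin {X X' : RightComod k A} (g : X ⟶ X') (Y : RightComod k A) :
    (g ▷ Y).lin = g.lin.rTensor Y := rfl
@[simp] lemma associator_hom_lin (X Y Z : RightComod k A) :
    (α_ X Y Z).hom.lin = (TensorProduct.assoc k X Y Z).toLinearMap := rfl
@[simp] lemma associator_inv_lin (X Y Z : RightComod k A) :
    (α_ X Y Z).inv.lin = (TensorProduct.assoc k X Y Z).symm.toLinearMap := rfl
@[simp] lemma leftUnitor_hom_lin (X : RightComod k A) :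
    (λ_ X).hom.lin = (TensorProduct.lid k X).toLinearMap := rfl
@[simp] lemma rightUnitor_hom_lin (X : RightComod k A) :
    (ρ_ X).hom.lin = (TensorProduct.rid k X).toLinearMap := rfl

instance : MonoidalCategory (RightComod k A) where
  tensorHom_def f g := by
    ext1; exact TensorProduct.ext' fun x y => rfl
  id_tensorHom_id X Y := by ext1; exact TensorProduct.ext' fun x y => rfl
  tensorHom_comp_tensorHom f g f' g' := by ext1; exact TensorProduct.ext' fun x y => rfl
  whiskerLeft_id X Y := by ext1; exact TensorProduct.ext' fun x y => rfl
  id_whiskerRight X Y := by ext1; exact TensorProduct.ext' fun x y => rfl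
  associator_naturality f g h := by
    ext1; exact TensorProduct.ext_threefold fun x y z => rfl
  leftUnitor_naturality f := by
    ext1; exact TensorProduct.ext' fun (a : k) x => (f.lin.map_smul a x).symm
  rightUnitor_naturality f := by
    ext1; exact TensorProduct.ext' fun x (a : k) => (f.lin.map_smul a x).symm
  pentagon W X Y Z := by
    ext1; exact TensorProduct.ext_fourfold fun w x y z => rfl
  triangle X Y := by
    ext1
    exact TensorProduct.ext_threefold fun x (a : k) y => TensorProduct.tmul_smul a x y

end Monoidal

section Action
variable {k : Type u} [Field k] {C : Type u} [AddCommGroup C] [Module k C] [Coalgebra k C]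

/-- The action `z ↦ z₍₀₎ f(z₍₁₎)` of a linear form `f` on a comodule. -/
def act (Z : RightComod k C) (f : C →ₗ[k] k) : Z →ₗ[k] Z :=
  (TensorProduct.rid k Z).toLinearMap ∘ₗ f.lTensor Z ∘ₗ Z.coact

lemma act_apply (Z : RightComod k C) (f : C →ₗ[k] k) (z : Z) :
    Z.act f z = TensorProduct.rid k Z (f.lTensor Z (Z.coact z)) := rfl

lemma conv_coact {B : Type u} [Ring B] [Algebra k B] (Z : RightComod k C)
    (F G : C →ₗ[k] B) (z : Z) :
    (WithConv.toConv F * WithConv.toConv G).ofConv.lTensor Z (Z.coact z) =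
      (LinearMap.mul' k B).lTensor Z (TensorProduct.assoc k Z B B
        (TensorProduct.map (F.lTensor Z ∘ₗ Z.coact) G (Z.coact z))) := by
  have h1 : ∀ s : Z ⊗[k] C, TensorProduct.assoc k Z B B
        (TensorProduct.map (F.lTensor Z ∘ₗ Z.coact) G s) =
      (TensorProduct.map F G).lTensor Z (TensorProduct.assoc k Z C C (Z.coact.rTensor C s)) := by
    intro s
    induction s using tensor_ind with
    | add a b ha hb => simp only [map_add, ha, hb]
    | tmul x c =>
      simp only [TensorProduct.map_tmul, LinearMap.rTensor_tmul, LinearMap.comp_apply]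
      generalize Z.coact x = p
      induction p using tensor_ind with
      | add a b ha hb => simp only [TensorProduct.add_tmul, map_add, ha, hb]
      | tmul c1 c2 => simp
  rw [h1, Z.coassoc_apply]
  generalize Z.coact z = s
  induction s using tensor_ind with
  | add a b ha hb => simp only [map_add, ha, hb]
  | tmul x c =>
    simp only [LinearMap.lTensor_tmul]
    rfl

lemma act_act (Z : RightComod k C) (f g : C →ₗ[k] k) (z : Z) :
    Z.act g (Z.act f z) = Z.act (WithConv.toConv g * WithConv.toConv f).ofConv z := by
  rw [act_apply Z (WithConv.toConv g * WithConv.toConv f).ofConv, conv_coact, act_apply Z f]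
  generalize Z.coact z = s
  induction s using tensor_ind with
  | add a b ha hb => simp only [map_add, ha, hb]
  | tmul x c =>
    simp only [LinearMap.lTensor_tmul, TensorProduct.rid_tmul, map_smul, TensorProduct.map_tmul,
      LinearMap.comp_apply, act_apply]
    generalize Z.coact x = t
    induction t using tensor_ind with
    | add a b ha hb => simp only [TensorProduct.add_tmul, map_add, smul_add, ha, hb]
    | tmul x c' => simp [smul_smul, mul_comm]

lemma act_one (Z : RightComod k C) (z : Z) :
    Z.act (1 : WithConv (C →ₗ[k] k)).ofConv z = z := Z.counit_apply z

end Action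

section Braiding
variable {k : Type u} [Field k] {A : Type u} [Ring A] [Bialgebra k A]

lemma tensor_coact_eq_outer (X Y : RightComod k A) (w : X ⊗[k] Y) :
    (tensor X Y).coact w = (LinearMap.mul' k A).lTensor _ ((outer X Y).coact w) := rfl

lemma tensor_coact_comm (X Y : RightComod k A) (w : X ⊗[k] Y) :
    (tensor Y X).coact (TensorProduct.comm k X Y w) =
      (TensorProduct.comm k X Y).toLinearMap.rTensor A
        ((LinearMap.mul' k A ∘ₗ (TensorProduct.comm k A A).toLinearMap).lTensor _
          ((outer X Y).coact w)) := by
  induction w using tensor_ind with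
  | add a b ha hb => simp only [map_add, ha, hb]
  | tmul x y =>
    simp only [TensorProduct.comm_tmul, LinearMap.comp_apply, TensorProduct.map_tmul]
    generalize X.coact x = s
    generalize Y.coact y = t
    induction s using tensor_ind with
    | add a b ha hb =>
      simp only [TensorProduct.add_tmul, TensorProduct.tmul_add, map_add, ha, hb]
    | tmul x c =>
      induction t using tensor_ind with
      | add a b ha hb =>
        simp only [TensorProduct.add_tmul, TensorProduct.tmul_add, map_add, ha, hb]
      | tmul y d => simp

lemma conv_comp_comm {B : Type u} [Ring B] [Algebra k B] (F G : A ⊗[k] A →ₗ[k] B) :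
    WithConv.toConv (F ∘ₗ (TensorProduct.comm k A A).toLinearMap) *
      WithConv.toConv (G ∘ₗ (TensorProduct.comm k A A).toLinearMap) =
    WithConv.toConv ((WithConv.toConv F * WithConv.toConv G).ofConv ∘ₗ
      (TensorProduct.comm k A A).toLinearMap) := by
  refine WithConv.ofConv_injective (TensorProduct.ext' fun a b => ?_)
  change LinearMap.mul' k B (TensorProduct.map (F ∘ₗ (TensorProduct.comm k A A).toLinearMap)
      (G ∘ₗ (TensorProduct.comm k A A).toLinearMap) (comul (a ⊗ₜ[k] b))) =
    LinearMap.mul' k B (TensorProduct.map F G (comul (b ⊗ₜ[k] a)))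
  rw [TensorProduct.comul_tmul, TensorProduct.comul_tmul]
  generalize (comul a : A ⊗[k] A) = p
  generalize (comul b : A ⊗[k] A) = q
  induction p using tensor_ind with
  | add a b ha hb => simp only [TensorProduct.add_tmul, TensorProduct.tmul_add, map_add, ha, hb]
  | tmul a1 a2 =>
    induction q using tensor_ind with
    | add a b ha hb => simp only [TensorProduct.add_tmul, TensorProduct.tmul_add, map_add, ha, hb]
    | tmul b1 b2 => simp

lemma conv_one_comm :
    (1 : WithConv (A ⊗[k] A →ₗ[k] k)).ofConv ∘ₗ (TensorProduct.comm k A A).toLinearMap =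
      (1 : WithConv (A ⊗[k] A →ₗ[k] k)).ofConv := by
  refine TensorProduct.ext' fun a b => ?_
  change counit (R := k) (b ⊗ₜ[k] a) = counit (R := k) (a ⊗ₜ[k] b)
  simp [mul_comm]

variable [Coquasitriangular k A]

open Coquasitriangular

/-- The bilinear form `(a, b) ↦ r(b, a)`. -/
def rFlip (k : Type u) [Field k] (A : Type u) [Ring A] [Bialgebra k A] [Coquasitriangular k A] :
    A ⊗[k] A →ₗ[k] k :=
  r ∘ₗ (TensorProduct.comm k A A).toLinearMap

/-- The bilinear form `(a, b) ↦ rInv(b, a)`. -/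
def rInvFlip (k : Type u) [Field k] (A : Type u) [Ring A] [Bialgebra k A]
    [Coquasitriangular k A] : A ⊗[k] A →ₗ[k] k :=
  rInv ∘ₗ (TensorProduct.comm k A A).toLinearMap

lemma rFlip_mul_rInvFlip :
    WithConv.toConv (rFlip k A) * WithConv.toConv (rInvFlip k A) = 1 := by
  rw [rFlip, rInvFlip, conv_comp_comm, r_mul_rInv, conv_one_comm]

lemma rInvFlip_mul_rFlip :
    WithConv.toConv (rInvFlip k A) * WithConv.toConv (rFlip k A) = 1 := by
  rw [rFlip, rInvFlip, conv_comp_comm, rInv_mul_r, conv_one_comm]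

lemma rFlip_comm :
    WithConv.toConv (LinearMap.mul' k A ∘ₗ (TensorProduct.comm k A A).toLinearMap) *
      WithConv.toConv (Algebra.linearMap k A ∘ₗ rFlip k A) =
    WithConv.toConv (Algebra.linearMap k A ∘ₗ rFlip k A) *
      WithConv.toConv (LinearMap.mul' k A) := by
  have h := congrArg (fun F => WithConv.toConv (F.ofConv ∘ₗ
    (TensorProduct.comm k A A).toLinearMap)) (r_comm (k := k) (A := A))
  simp only [← conv_comp_comm] at h
  rw [rFlip, ← LinearMap.comp_assoc, ← h, LinearMap.comp_assoc]
  congr 2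
  exact TensorProduct.ext' fun a b => rfl

/-- The braiding `x ⊗ y ↦ r(y₍₁₎, x₍₁₎) y₍₀₎ ⊗ x₍₀₎`. -/
def braidLin (X Y : RightComod k A) : X ⊗[k] Y →ₗ[k] Y ⊗[k] X :=
  (TensorProduct.comm k X Y).toLinearMap ∘ₗ (outer X Y).act (rFlip k A)

/-- Auxiliary linear map `(x ⊗ a) ⊗ (y ⊗ b) ↦ r(b, a) y ⊗ x`. -/
def braidAux (X Y : RightComod k A) : (X ⊗[k] A) ⊗[k] (Y ⊗[k] A) →ₗ[k] Y ⊗[k] X :=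
  (TensorProduct.comm k X Y).toLinearMap ∘ₗ (TensorProduct.rid k (X ⊗[k] Y)).toLinearMap ∘ₗ
    (rFlip k A).lTensor (X ⊗[k] Y) ∘ₗ (tensorTensorTensorComm k X A Y A).toLinearMap

@[simp] lemma braidAux_tmul (X Y : RightComod k A) (a b : A) (x : X) (y : Y) :
    braidAux X Y ((x ⊗ₜ a) ⊗ₜ (y ⊗ₜ b)) = r (k := k) (b ⊗ₜ[k] a) • (y ⊗ₜ[k] x) := by
  simp [braidAux, rFlip]

lemma braidLin_tmul (X Y : RightComod k A) (x : X) (y : Y) :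
    braidLin X Y (x ⊗ₜ y) = braidAux X Y (X.coact x ⊗ₜ Y.coact y) := rfl

lemma braidAux_right (X Y : RightComod k A) (x : X) (b : A) (y : Y) :
    braidAux X Y (X.coact x ⊗ₜ (y ⊗ₜ b)) =
      y ⊗ₜ X.act (r (k := k) ∘ₗ TensorProduct.mk k A A b) x := by
  rw [act_apply]
  generalize X.coact x = s
  induction s using tensor_ind with
  | add a b ha hb => simp only [TensorProduct.add_tmul, map_add, ha, hb, TensorProduct.tmul_add]
  | tmul x a => simp

lemma braidAux_left (X Y : RightComod k A) (a : A) (x : X) (y : Y) :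
    braidAux X Y ((x ⊗ₜ a) ⊗ₜ Y.coact y) =
      Y.act (r (k := k) ∘ₗ (TensorProduct.mk k A A).flip a) y ⊗ₜ x := by
  rw [act_apply]
  generalize Y.coact y = s
  induction s using tensor_ind with
  | add a b ha hb => simp only [TensorProduct.add_tmul, map_add, ha, hb, TensorProduct.tmul_add]
  | tmul y b => simp [TensorProduct.smul_tmul']

/-- The braiding as an invertible linear map. -/
def braidEquiv (X Y : RightComod k A) : X ⊗[k] Y ≃ₗ[k] Y ⊗[k] X :=
  LinearEquiv.ofLinearMap (braidLin X Y)
    ((outer X Y).act (rInvFlip k A) ∘ₗ (TensorProduct.comm k Y X).toLinearMap)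
    (by
      ext1; ext1 y; ext1 x
      change TensorProduct.comm k X Y ((outer X Y).act (rFlip k A)
        ((outer X Y).act (rInvFlip k A) (x ⊗ₜ y))) = _
      rw [act_act, rFlip_mul_rInvFlip, act_one]; rfl)
    (by
      refine LinearMap.ext fun w => ?_
      change (outer X Y).act (rInvFlip k A) (TensorProduct.comm k Y X (TensorProduct.comm k X Y
        ((outer X Y).act (rFlip k A) w))) = _
      rw [TensorProduct.comm_comm, act_act, rInvFlip_mul_rFlip, act_one]; rfl)

lemma braidLin_colinear (X Y : RightComod k A) :
    (tensor Y X).coact ∘ₗ braidLin X Y =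
      (braidLin X Y).rTensor A ∘ₗ (tensor X Y).coact := by
  refine LinearMap.ext fun w => ?_
  have h := congrArg (fun F => F.ofConv.lTensor (X ⊗[k] Y) ((outer X Y).coact w))
    (rFlip_comm (k := k) (A := A))
  simp only at h
  rw [conv_coact (outer X Y), conv_coact (outer X Y)] at h
  have e1 : ∀ s : (X ⊗[k] Y) ⊗[k] (A ⊗[k] A),
      (LinearMap.mul' k A).lTensor (X ⊗[k] Y) (TensorProduct.assoc k (X ⊗[k] Y) A A
        (TensorProduct.map ((LinearMap.mul' k A ∘ₗ
          (TensorProduct.comm k A A).toLinearMap).lTensor (X ⊗[k] Y) ∘ₗ (outer X Y).coact)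
          (Algebra.linearMap k A ∘ₗ rFlip k A) s)) =
      (LinearMap.mul' k A ∘ₗ (TensorProduct.comm k A A).toLinearMap).lTensor (X ⊗[k] Y)
        ((outer X Y).coact (TensorProduct.rid k (X ⊗[k] Y)
          ((rFlip k A).lTensor (X ⊗[k] Y) s))) := by
    intro s
    induction s using tensor_ind with
    | add a b ha hb => simp only [map_add, ha, hb]
    | tmul v p =>
      simp only [TensorProduct.map_tmul, LinearMap.lTensor_tmul, TensorProduct.rid_tmul, map_smul]
      rw [LinearMap.comp_apply]
      generalize (outer X Y).coact v = t
      induction t using tensor_ind with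
      | add a b ha hb => simp only [TensorProduct.add_tmul, map_add, smul_add, ha, hb]
      | tmul u q => simp [Algebra.algebraMap_eq_smul_one]
  have e2 : ∀ s : (X ⊗[k] Y) ⊗[k] (A ⊗[k] A),
      (LinearMap.mul' k A).lTensor (X ⊗[k] Y) (TensorProduct.assoc k (X ⊗[k] Y) A A
        (TensorProduct.map
          ((Algebra.linearMap k A ∘ₗ rFlip k A).lTensor (X ⊗[k] Y) ∘ₗ (outer X Y).coact)
          (LinearMap.mul' k A) s)) =
      ((outer X Y).act (rFlip k A)).rTensor A ((LinearMap.mul' k A).lTensor _ s) := by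
    intro s
    induction s using tensor_ind with
    | add a b ha hb => simp only [map_add, ha, hb]
    | tmul v p =>
      simp only [TensorProduct.map_tmul, LinearMap.rTensor_tmul, LinearMap.lTensor_tmul]
      rw [LinearMap.comp_apply, act_apply]
      generalize (outer X Y).coact v = t
      induction t using tensor_ind with
      | add a b ha hb => simp only [TensorProduct.add_tmul, map_add, ha, hb]
      | tmul u q => simp [Algebra.algebraMap_eq_smul_one, TensorProduct.smul_tmul']
  rw [e1, e2] at h
  change (tensor Y X).coact (TensorProduct.comm k X Y ((outer X Y).act (rFlip k A) w)) =
    (braidLin X Y).rTensor A ((LinearMap.mul' k A).lTensor _ ((outer X Y).coact w))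
  refine (tensor_coact_comm X Y _).trans
    ((congrArg ((TensorProduct.comm k X Y).toLinearMap.rTensor A) h).trans ?_)
  rw [braidLin, LinearMap.rTensor_comp]
  rfl

instance : BraidedCategory (RightComod k A) where
  braiding X Y := isoMk (X := tensor X Y) (Y := tensor Y X) (braidEquiv X Y)
    (braidLin_colinear X Y)
  braiding_naturality_right X Y Z f := by
    ext1
    refine TensorProduct.ext' fun x y => ?_
    change braidAux X Z (X.coact x ⊗ₜ Z.coact (f.lin y)) =
      f.lin.rTensor X (braidAux X Y (X.coact x ⊗ₜ Y.coact y))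
    rw [comm_apply]
    generalize Y.coact y = t
    induction t using tensor_ind with
    | add a b ha hb => simp only [TensorProduct.tmul_add, map_add, ha, hb]
    | tmul y b => simp [braidAux_right]
  braiding_naturality_left {X Y} f Z := by
    ext1
    refine TensorProduct.ext' fun x z => ?_
    change braidAux Y Z (Y.coact (f.lin x) ⊗ₜ Z.coact z) =
      f.lin.lTensor Z (braidAux X Z (X.coact x ⊗ₜ Z.coact z))
    rw [comm_apply]
    generalize X.coact x = t
    induction t using tensor_ind with
    | add a b ha hb => simp only [TensorProduct.add_tmul, map_add, ha, hb]
    | tmul y b => simp [braidAux_left]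
  hexagon_forward X Y Z := by
    ext1
    refine TensorProduct.ext_threefold fun x y z => ?_
    change TensorProduct.assoc k Y Z X
        (braidAux X (tensor Y Z) (X.coact x ⊗ₜ mm Y Z (Y.coact y ⊗ₜ Z.coact z))) =
      (braidLin X Z).lTensor Y (TensorProduct.assoc k Y X Z
        (braidAux X Y (X.coact x ⊗ₜ Y.coact y) ⊗ₜ z))
    generalize Y.coact y = t
    induction t using tensor_ind with
    | add a b ha hb => simp only [TensorProduct.add_tmul, TensorProduct.tmul_add, map_add, ha, hb]
    | tmul y b =>
      rw [braidAux_right, TensorProduct.assoc_tmul, LinearMap.lTensor_tmul, braidLin_tmul]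
      generalize Z.coact z = u
      induction u using tensor_ind with
      | add a b ha hb => simp only [TensorProduct.tmul_add, map_add, ha, hb]
      | tmul z c =>
        rw [mm_tmul]
        erw [braidAux_right X (tensor Y Z)]
        rw [braidAux_right, act_act, ← r_mul_left]
        rfl
  hexagon_reverse X Y Z := by
    ext1
    refine TensorProduct.ext (LinearMap.ext fun x => TensorProduct.ext' fun y z => ?_)
    change (TensorProduct.assoc k Z X Y).symm
        (braidAux (tensor X Y) Z (mm X Y (X.coact x ⊗ₜ Y.coact y) ⊗ₜ Z.coact z)) =
      (braidLin X Z).rTensor Y ((TensorProduct.assoc k X Z Y).symm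
        (x ⊗ₜ braidAux Y Z (Y.coact y ⊗ₜ Z.coact z)))
    generalize Y.coact y = t
    induction t using tensor_ind with
    | add a b ha hb => simp only [TensorProduct.add_tmul, TensorProduct.tmul_add, map_add, ha, hb]
    | tmul y b =>
      rw [braidAux_left, TensorProduct.assoc_symm_tmul, LinearMap.rTensor_tmul, braidLin_tmul]
      generalize X.coact x = u
      induction u using tensor_ind with
      | add a b ha hb => simp only [TensorProduct.add_tmul, map_add, ha, hb]
      | tmul x c =>
        rw [mm_tmul]
        erw [braidAux_left (tensor X Y) Z]
        rw [braidAux_left, act_act, ← r_mul_right]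
        rfl

end Braiding
end RightComod

/-- The cotensor product `X □_C Y`: the kernel of `ρ ⊗ id - id ⊗ λ : X ⊗ Y → X ⊗ C ⊗ Y`. -/
def cotensor {k : Type u} [Field k] {C : Type u} [AddCommGroup C] [Module k C] [Coalgebra k C]
    (X : RightComod k C) (Y : LeftComod k C) : Submodule k (X ⊗[k] Y) :=
  LinearMap.ker ((TensorProduct.assoc k X C Y).toLinearMap ∘ₗ X.coact.rTensor Y -
    Y.coact.lTensor X)

/-- A `D`-`C`-bicomodule. -/
structure Bicomod (k : Type u) [Field k] (D C : Type u) [AddCommGroup D] [Module k D]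
    [Coalgebra k D] [AddCommGroup C] [Module k C] [Coalgebra k C] where
  /-- the underlying vector space -/
  carrier : Type u
  [addCommGroup : AddCommGroup carrier]
  [module : Module k carrier]
  /-- the left coaction -/
  lcoact : carrier →ₗ[k] D ⊗[k] carrier
  /-- the right coaction -/
  rcoact : carrier →ₗ[k] carrier ⊗[k] C
  lcoassoc : (TensorProduct.assoc k D D carrier).toLinearMap ∘ₗ comul.rTensor carrier ∘ₗ lcoact =
    lcoact.lTensor D ∘ₗ lcoact
  counit_lcoact : (TensorProduct.lid k carrier).toLinearMap ∘ₗ counit.rTensor carrier ∘ₗ lcoact =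
    LinearMap.id
  rcoassoc : (TensorProduct.assoc k carrier C C).toLinearMap ∘ₗ rcoact.rTensor C ∘ₗ rcoact =
    comul.lTensor carrier ∘ₗ rcoact
  counit_rcoact : (TensorProduct.rid k carrier).toLinearMap ∘ₗ counit.lTensor carrier ∘ₗ rcoact =
    LinearMap.id
  bicoassoc : (TensorProduct.assoc k D carrier C).toLinearMap ∘ₗ lcoact.rTensor C ∘ₗ rcoact =
    rcoact.lTensor D ∘ₗ lcoact

attribute [instance] Bicomod.addCommGroup Bicomod.module

section Sub

variable {k : Type u} [Field k] {C : Type u} [AddCommGroup C] [Module k C] [Coalgebra k C]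

lemma lTensor_subtype_injective (D : Type u) [AddCommGroup D] [Module k D]
    {M : Type u} [AddCommGroup M] [Module k M] (K : Submodule k M) :
    Function.Injective (K.subtype.lTensor D) :=
  Module.Flat.lTensor_preserves_injective_linearMap _ K.injective_subtype

lemma rTensor_subtype_injective (D : Type u) [AddCommGroup D] [Module k D]
    {M : Type u} [AddCommGroup M] [Module k M] (K : Submodule k M) :
    Function.Injective (K.subtype.rTensor D) :=
  Module.Flat.rTensor_preserves_injective_linearMap _ K.injective_subtype

/-- Lift of a map `K → D ⊗ M` with values in (the image of) `D ⊗ K`. -/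
def lliftSub {D M N : Type u} [AddCommGroup D] [Module k D] [AddCommGroup M] [Module k M]
    [AddCommGroup N] [Module k N] (K : Submodule k M) (f : N →ₗ[k] D ⊗[k] M)
    (h : ∀ x, f x ∈ LinearMap.range (K.subtype.lTensor D)) : N →ₗ[k] D ⊗[k] K :=
  (LinearEquiv.ofInjective _ (lTensor_subtype_injective D K)).symm.toLinearMap ∘ₗ
    f.codRestrict _ h

lemma lliftSub_spec {D M N : Type u} [AddCommGroup D] [Module k D] [AddCommGroup M] [Module k M]
    [AddCommGroup N] [Module k N] (K : Submodule k M) (f : N →ₗ[k] D ⊗[k] M)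
    (h : ∀ x, f x ∈ LinearMap.range (K.subtype.lTensor D)) (x : N) :
    K.subtype.lTensor D (lliftSub K f h x) = f x :=
  congrArg Subtype.val ((LinearEquiv.ofInjective _ (lTensor_subtype_injective D K)).apply_symm_apply
    (f.codRestrict _ h x))

/-- Lift of a map `K → M ⊗ D` with values in (the image of) `K ⊗ D`. -/
def rliftSub {D M N : Type u} [AddCommGroup D] [Module k D] [AddCommGroup M] [Module k M]
    [AddCommGroup N] [Module k N] (K : Submodule k M) (f : N →ₗ[k] M ⊗[k] D)
    (h : ∀ x, f x ∈ LinearMap.range (K.subtype.rTensor D)) : N →ₗ[k] K ⊗[k] D :=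
  (LinearEquiv.ofInjective _ (rTensor_subtype_injective D K)).symm.toLinearMap ∘ₗ
    f.codRestrict _ h

lemma rliftSub_spec {D M N : Type u} [AddCommGroup D] [Module k D] [AddCommGroup M] [Module k M]
    [AddCommGroup N] [Module k N] (K : Submodule k M) (f : N →ₗ[k] M ⊗[k] D)
    (h : ∀ x, f x ∈ LinearMap.range (K.subtype.rTensor D)) (x : N) :
    K.subtype.rTensor D (rliftSub K f h x) = f x :=
  congrArg Subtype.val ((LinearEquiv.ofInjective _ (rTensor_subtype_injective D K)).apply_symm_apply
    (f.codRestrict _ h x))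

/-- A subspace of a left comodule that is stable under the coaction is a comodule. -/
abbrev LeftComod.sub (M : LeftComod k C) (K : Submodule k M)
    (h : ∀ x : K, M.coact x ∈ LinearMap.range (K.subtype.lTensor C)) : LeftComod k C where
  carrier := K
  coact := lliftSub K (M.coact ∘ₗ K.subtype) h
  coassoc := by
    have hs := lliftSub_spec K (M.coact ∘ₗ K.subtype) h
    set c := lliftSub K (M.coact ∘ₗ K.subtype) h
    refine LinearMap.ext fun x => ?_
    apply Module.Flat.lTensor_preserves_injective_linearMap (M := C) _
      (lTensor_subtype_injective C K)
    have e1 : ∀ t : C ⊗[k] K, (K.subtype.lTensor C).lTensor C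
        (TensorProduct.assoc k C C K (comul.rTensor K t)) =
        TensorProduct.assoc k C C M (comul.rTensor M (K.subtype.lTensor C t)) := by
      intro t
      induction t using tensor_ind with
      | add a b ha hb => simp only [map_add, ha, hb]
      | tmul a y =>
        simp only [LinearMap.rTensor_tmul, LinearMap.lTensor_tmul]
        generalize (comul a : C ⊗[k] C) = p
        induction p using tensor_ind with
        | add a b ha hb => simp only [TensorProduct.add_tmul, map_add, ha, hb]
        | tmul a b => simp
    have e2 : ∀ t : C ⊗[k] K, (K.subtype.lTensor C).lTensor C (c.lTensor C t) =
        M.coact.lTensor C (K.subtype.lTensor C t) := by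
      intro t
      induction t using tensor_ind with
      | add a b ha hb => simp only [map_add, ha, hb]
      | tmul a y => simp [hs]
    simp only [LinearMap.comp_apply, LinearEquiv.coe_coe]
    rw [e1, e2, hs]
    exact M.coassoc_apply _
  counit_coact := by
    have hs := lliftSub_spec K (M.coact ∘ₗ K.subtype) h
    set c := lliftSub K (M.coact ∘ₗ K.subtype) h
    refine LinearMap.ext fun x => ?_
    apply K.injective_subtype
    have e1 : ∀ t : C ⊗[k] K, K.subtype (TensorProduct.lid k K (counit.rTensor K t)) =
        TensorProduct.lid k M (counit.rTensor M (K.subtype.lTensor C t)) := by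
      intro t
      induction t using tensor_ind with
      | add a b ha hb => simp only [map_add, ha, hb]
      | tmul a y => simp
    simp only [LinearMap.comp_apply, LinearEquiv.coe_coe]
    rw [e1, hs]
    exact M.counit_apply _

/-- A subspace of a right comodule that is stable under the coaction is a comodule. -/
abbrev RightComod.sub (M : RightComod k C) (K : Submodule k M)
    (h : ∀ x : K, M.coact x ∈ LinearMap.range (K.subtype.rTensor C)) : RightComod k C where
  carrier := K
  coact := rliftSub K (M.coact ∘ₗ K.subtype) h
  coassoc := by
    have hs := rliftSub_spec K (M.coact ∘ₗ K.subtype) h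
    set c := rliftSub K (M.coact ∘ₗ K.subtype) h
    refine LinearMap.ext fun x => ?_
    apply Module.Flat.rTensor_preserves_injective_linearMap (M := C ⊗[k] C) _ K.injective_subtype
    have e1 : ∀ t : K ⊗[k] C, K.subtype.rTensor (C ⊗[k] C) (comul.lTensor K t) =
        comul.lTensor M (K.subtype.rTensor C t) := by
      intro t
      induction t using tensor_ind with
      | add a b ha hb => simp only [map_add, ha, hb]
      | tmul y a => simp
    have e2 : ∀ t : K ⊗[k] C, K.subtype.rTensor (C ⊗[k] C)
        (TensorProduct.assoc k K C C (c.rTensor C t)) =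
        TensorProduct.assoc k M C C (M.coact.rTensor C (K.subtype.rTensor C t)) := by
      intro t
      induction t using tensor_ind with
      | add a b ha hb => simp only [map_add, ha, hb]
      | tmul y a =>
        simp only [LinearMap.rTensor_tmul]
        have e := hs y
        rw [LinearMap.comp_apply] at e
        rw [← e]
        generalize c y = p
        induction p using tensor_ind with
        | add a b ha hb => simp only [TensorProduct.add_tmul, map_add, ha, hb]
        | tmul a b => simp
    simp only [LinearMap.comp_apply, LinearEquiv.coe_coe]
    rw [e1, e2, hs]
    exact M.coassoc_apply _
  counit_coact := by
    have hs := rliftSub_spec K (M.coact ∘ₗ K.subtype) h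
    set c := rliftSub K (M.coact ∘ₗ K.subtype) h
    refine LinearMap.ext fun x => ?_
    apply K.injective_subtype
    have e1 : ∀ t : K ⊗[k] C, K.subtype (TensorProduct.rid k K (counit.lTensor K t)) =
        TensorProduct.rid k M (counit.lTensor M (K.subtype.rTensor C t)) := by
      intro t
      induction t using tensor_ind with
      | add a b ha hb => simp only [map_add, ha, hb]
      | tmul y a => simp
    simp only [LinearMap.comp_apply, LinearEquiv.coe_coe]
    rw [e1, hs]
    exact M.counit_apply _

lemma LeftComod.sub_coact (M : LeftComod k C) (K : Submodule k M) (h) (x : K) :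
    K.subtype.lTensor C ((M.sub K h).coact x) = M.coact x := lliftSub_spec _ _ _ _

lemma RightComod.sub_coact (M : RightComod k C) (K : Submodule k M) (h) (x : K) :
    K.subtype.rTensor C ((M.sub K h).coact x) = M.coact x := rliftSub_spec _ _ _ _

/-- Restriction of a homomorphism of comodules to subcomodules. -/
abbrev LeftComod.subHom {M N : LeftComod k C} (f : M ⟶ N) (K : Submodule k M) (L : Submodule k N)
    (hK) (hL) (h : ∀ z ∈ K, f.lin z ∈ L) : M.sub K hK ⟶ N.sub L hL where
  lin := f.lin.restrict h
  comm := by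
    refine LinearMap.ext fun z => lTensor_subtype_injective C L ?_
    rw [LinearMap.comp_apply, LinearMap.comp_apply, LeftComod.sub_coact]
    have e : ∀ t : C ⊗[k] K, L.subtype.lTensor C ((f.lin.restrict h).lTensor C t) =
        f.lin.lTensor C (K.subtype.lTensor C t) := by
      intro t
      induction t using tensor_ind with
      | add a b ha hb => simp only [map_add, ha, hb]
      | tmul a y => simp
    rw [e, LeftComod.sub_coact]
    exact LeftComod.comm_apply f _

/-- Restriction of a homomorphism of comodules to subcomodules. -/
abbrev RightComod.subHom {M N : RightComod k C} (f : M ⟶ N) (K : Submodule k M)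
    (L : Submodule k N) (hK) (hL) (h : ∀ z ∈ K, f.lin z ∈ L) : M.sub K hK ⟶ N.sub L hL where
  lin := f.lin.restrict h
  comm := by
    refine LinearMap.ext fun z => rTensor_subtype_injective C L ?_
    rw [LinearMap.comp_apply, LinearMap.comp_apply, RightComod.sub_coact]
    have e : ∀ t : K ⊗[k] C, L.subtype.rTensor C ((f.lin.restrict h).rTensor C t) =
        f.lin.rTensor C (K.subtype.rTensor C t) := by
      intro t
      induction t using tensor_ind with
      | add a b ha hb => simp only [map_add, ha, hb]
      | tmul a y => simp
    rw [e, RightComod.sub_coact]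
    exact RightComod.comm_apply f _

end Sub

namespace Bicomod

variable {k : Type u} [Field k] {C D : Type u} [AddCommGroup C] [Module k C] [Coalgebra k C]
  [AddCommGroup D] [Module k D] [Coalgebra k D]

/-- The underlying left comodule. -/
abbrev left (P : Bicomod k D C) : LeftComod k D := ⟨P.carrier, P.lcoact, P.lcoassoc, P.counit_lcoact⟩

/-- The underlying right comodule. -/
abbrev right (P : Bicomod k D C) : RightComod k C :=
  ⟨P.carrier, P.rcoact, P.rcoassoc, P.counit_rcoact⟩

/-- The left `D`-comodule `P ⊗ W` for a vector space `W`. -/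
abbrev leftTensor (P : Bicomod k D C) (W : Type u) [AddCommGroup W] [Module k W] :
    LeftComod k D where
  carrier := P.carrier ⊗[k] W
  coact := (TensorProduct.assoc k D P.carrier W).toLinearMap ∘ₗ P.lcoact.rTensor W
  coassoc := by
    refine TensorProduct.ext' fun p w => ?_
    have h := P.left.coassoc_apply p
    simp only [LinearMap.comp_apply, LinearMap.rTensor_tmul, LinearEquiv.coe_coe]
    have e1 : ∀ t : D ⊗[k] P.carrier, TensorProduct.assoc k D D (P.carrier ⊗[k] W)
        (comul.rTensor (P.carrier ⊗[k] W) (TensorProduct.assoc k D P.carrier W (t ⊗ₜ w))) =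
        (TensorProduct.assoc k D P.carrier W).toLinearMap.lTensor D
          (TensorProduct.assoc k D (D ⊗[k] P.carrier) W
            (TensorProduct.assoc k D D P.carrier (comul.rTensor P.carrier t) ⊗ₜ w)) := by
      intro t
      induction t using tensor_ind with
      | add a b ha hb => simp only [TensorProduct.add_tmul, map_add, ha, hb]
      | tmul a y =>
        simp only [LinearMap.rTensor_tmul, TensorProduct.assoc_tmul]
        generalize (comul a : D ⊗[k] D) = p
        induction p using tensor_ind with
        | add a b ha hb => simp only [TensorProduct.add_tmul, map_add, ha, hb]
        | tmul a b => simp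
    rw [e1]
    refine (congrArg (fun v => (TensorProduct.assoc k D P.carrier W).toLinearMap.lTensor D
      (TensorProduct.assoc k D (D ⊗[k] P.carrier) W (v ⊗ₜ w))) h).trans ?_
    generalize P.lcoact p = t
    induction t using tensor_ind with
    | add a b ha hb => simp only [TensorProduct.add_tmul, map_add, ha, hb]
    | tmul a y => simp
  counit_coact := by
    refine TensorProduct.ext' fun p w => ?_
    have h := P.left.counit_apply p
    simp only [LinearMap.comp_apply, LinearMap.rTensor_tmul, LinearEquiv.coe_coe,
      LinearMap.id_apply]
    refine Eq.trans ?_ (congrArg (fun v => v ⊗ₜ[k] w) h)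
    generalize P.lcoact p = t
    induction t using tensor_ind with
    | add a b ha hb => simp only [TensorProduct.add_tmul, map_add, ha, hb]
    | tmul a y => simp [TensorProduct.smul_tmul']

/-- The right `C`-comodule `W ⊗ P` for a vector space `W`. -/
abbrev rightTensor (P : Bicomod k D C) (W : Type u) [AddCommGroup W] [Module k W] :
    RightComod k C where
  carrier := W ⊗[k] P.carrier
  coact := (TensorProduct.assoc k W P.carrier C).symm.toLinearMap ∘ₗ P.rcoact.lTensor W
  coassoc := by
    refine TensorProduct.ext' fun w p => ?_
    have h := P.right.coassoc_apply p
    simp only [LinearMap.comp_apply, LinearMap.lTensor_tmul, LinearEquiv.coe_coe]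
    have e1 : ∀ t : P.carrier ⊗[k] C, comul.lTensor (W ⊗[k] P.carrier)
        ((TensorProduct.assoc k W P.carrier C).symm (w ⊗ₜ t)) =
        (TensorProduct.assoc k W P.carrier (C ⊗[k] C)).symm (w ⊗ₜ comul.lTensor P.carrier t) := by
      intro t
      induction t using tensor_ind with
      | add a b ha hb => simp only [TensorProduct.tmul_add, map_add, ha, hb]
      | tmul y a => simp
    rw [e1]
    refine Eq.trans ?_ (congrArg (fun v => (TensorProduct.assoc k W P.carrier (C ⊗[k] C)).symm
      (w ⊗ₜ v)) h)
    generalize P.rcoact p = t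
    induction t using tensor_ind with
    | add a b ha hb => simp only [TensorProduct.tmul_add, map_add, ha, hb]
    | tmul y a =>
      simp only [TensorProduct.assoc_symm_tmul, LinearMap.rTensor_tmul, LinearMap.comp_apply,
        LinearMap.lTensor_tmul, LinearEquiv.coe_coe]
      generalize P.rcoact y = q
      induction q using tensor_ind with
      | add a b ha hb => simp only [TensorProduct.add_tmul, TensorProduct.tmul_add, map_add, ha, hb]
      | tmul a b => simp
  counit_coact := by
    refine TensorProduct.ext' fun w p => ?_
    have h := P.right.counit_apply p
    simp only [LinearMap.comp_apply, LinearMap.lTensor_tmul, LinearEquiv.coe_coe,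
      LinearMap.id_apply]
    refine Eq.trans ?_ (congrArg (fun v => w ⊗ₜ[k] v) h)
    generalize P.rcoact p = t
    induction t using tensor_ind with
    | add a b ha hb => simp only [TensorProduct.tmul_add, map_add, ha, hb]
    | tmul a y => simp

/-- Functoriality of `P ⊗ W` in the vector space `W`. -/
abbrev leftTensorMap (P : Bicomod k D C) {W W' : Type u} [AddCommGroup W] [Module k W]
    [AddCommGroup W'] [Module k W'] (f : W →ₗ[k] W') : P.leftTensor W ⟶ P.leftTensor W' where
  lin := f.lTensor P.carrier
  comm := by
    refine TensorProduct.ext' fun p x => ?_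
    simp only [LinearMap.lTensor_tmul, LinearMap.comp_apply, LinearMap.rTensor_tmul,
      LinearEquiv.coe_coe]
    generalize P.lcoact p = q
    induction q using tensor_ind with
    | add a b ha hb => simp only [TensorProduct.add_tmul, map_add, ha, hb]
    | tmul a b => simp

/-- Functoriality of `W ⊗ P` in the vector space `W`. -/
abbrev rightTensorMap (P : Bicomod k D C) {W W' : Type u} [AddCommGroup W] [Module k W]
    [AddCommGroup W'] [Module k W'] (f : W →ₗ[k] W') : P.rightTensor W ⟶ P.rightTensor W' where
  lin := f.rTensor P.carrier
  comm := by
    refine TensorProduct.ext' fun x p => ?_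
    simp only [LinearMap.lTensor_tmul, LinearMap.comp_apply, LinearMap.rTensor_tmul,
      LinearEquiv.coe_coe]
    generalize P.rcoact p = q
    induction q using tensor_ind with
    | add a b ha hb => simp only [TensorProduct.tmul_add, map_add, ha, hb]
    | tmul a b => simp

lemma left_stable (P : Bicomod k D C) (X : LeftComod k C) (z : cotensor P.right X) :
    (P.leftTensor X).coact z ∈ LinearMap.range ((cotensor P.right X).subtype.lTensor D) := by
  set g := (TensorProduct.assoc k P.carrier C X).toLinearMap ∘ₗ P.rcoact.rTensor X -
    X.coact.lTensor P.carrier with hg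
  have hex : Function.Exact (cotensor P.right X).subtype g :=
    LinearMap.exact_subtype_ker_map g
  have hex' := Module.Flat.lTensor_exact D hex
  refine (hex' _).1 ?_
  -- apply `λ ⊗ id` to the equation that defines the cotensor product
  have key : g.lTensor D ∘ₗ (P.leftTensor X).coact =
      (P.leftTensor (C ⊗[k] X)).coact ∘ₗ g := by
    rw [hg, LinearMap.lTensor_sub, LinearMap.sub_comp, LinearMap.comp_sub]
    congr 1
    · refine TensorProduct.ext' fun p x => ?_
      have h := LinearMap.congr_fun P.bicoassoc p
      simp only [LinearMap.comp_apply, LinearMap.rTensor_tmul, LinearEquiv.coe_coe] at h ⊢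
      have e1 : ∀ t : D ⊗[k] P.carrier,
          ((TensorProduct.assoc k P.carrier C X).toLinearMap ∘ₗ P.rcoact.rTensor X).lTensor D
            (TensorProduct.assoc k D P.carrier X (t ⊗ₜ x)) =
          (TensorProduct.assoc k P.carrier C X).toLinearMap.lTensor D
            (TensorProduct.assoc k D (P.carrier ⊗[k] C) X (P.rcoact.lTensor D t ⊗ₜ x)) := by
        intro t
        induction t using tensor_ind with
        | add a b ha hb => simp only [TensorProduct.add_tmul, map_add, ha, hb]
        | tmul a y => simp
      rw [e1, ← h]
      generalize P.rcoact p = t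
      induction t using tensor_ind with
      | add a b ha hb => simp only [TensorProduct.add_tmul, map_add, ha, hb]
      | tmul y c =>
        simp only [LinearMap.rTensor_tmul, TensorProduct.assoc_tmul]
        generalize P.lcoact y = q
        induction q using tensor_ind with
        | add a b ha hb => simp only [TensorProduct.add_tmul, map_add, ha, hb]
        | tmul a b => simp
    · refine TensorProduct.ext' fun p x => ?_
      simp only [LinearMap.comp_apply, LinearMap.rTensor_tmul, LinearEquiv.coe_coe,
        LinearMap.lTensor_tmul]
      generalize P.lcoact p = q
      induction q using tensor_ind with
      | add a b ha hb => simp only [TensorProduct.add_tmul, map_add, ha, hb]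
      | tmul a b => simp
  have hz : g z = 0 := z.2
  rw [← LinearMap.comp_apply, key, LinearMap.comp_apply, hz, map_zero]

lemma right_stable (P : Bicomod k D C) (X : RightComod k D) (z : cotensor X P.left) :
    (P.rightTensor X).coact z ∈ LinearMap.range ((cotensor X P.left).subtype.rTensor C) := by
  set g := (TensorProduct.assoc k X D P.carrier).toLinearMap ∘ₗ X.coact.rTensor P.carrier -
    P.lcoact.lTensor X with hg
  have hex : Function.Exact (cotensor X P.left).subtype g :=
    LinearMap.exact_subtype_ker_map g
  have hex' := Module.Flat.rTensor_exact C hex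
  refine (hex' _).1 ?_
  set F : X ⊗[k] (D ⊗[k] P.carrier) →ₗ[k] (X ⊗[k] (D ⊗[k] P.carrier)) ⊗[k] C :=
    (TensorProduct.assoc k X D P.carrier).toLinearMap.rTensor C ∘ₗ
      (TensorProduct.assoc k (X ⊗[k] D) P.carrier C).symm.toLinearMap ∘ₗ
        P.rcoact.lTensor (X ⊗[k] D) ∘ₗ
          (TensorProduct.assoc k X D P.carrier).symm.toLinearMap with hF
  have key : g.rTensor C ∘ₗ (P.rightTensor X).coact = F ∘ₗ g := by
    rw [hg, LinearMap.rTensor_sub, LinearMap.sub_comp, LinearMap.comp_sub, hF]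
    congr 1
    · refine TensorProduct.ext' fun x p => ?_
      simp only [LinearMap.comp_apply, LinearMap.rTensor_tmul, LinearEquiv.coe_coe,
        LinearMap.lTensor_tmul, LinearEquiv.symm_apply_apply]
      generalize P.rcoact p = q
      induction q using tensor_ind with
      | add a b ha hb => simp only [TensorProduct.tmul_add, map_add, ha, hb]
      | tmul a b => simp
    · refine TensorProduct.ext' fun x p => ?_
      have h := LinearMap.congr_fun P.bicoassoc p
      simp only [LinearMap.comp_apply, LinearMap.lTensor_tmul, LinearEquiv.coe_coe] at h ⊢
      have e1 : ∀ t : P.carrier ⊗[k] C,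
          (P.lcoact.lTensor X).rTensor C
            ((TensorProduct.assoc k X P.carrier C).symm (x ⊗ₜ t)) =
          (TensorProduct.assoc k X (D ⊗[k] P.carrier) C).symm
            (x ⊗ₜ P.lcoact.rTensor C t) := by
        intro t
        induction t using tensor_ind with
        | add a b ha hb => simp only [TensorProduct.tmul_add, map_add, ha, hb]
        | tmul y a => simp
      rw [e1, ← (TensorProduct.assoc k D P.carrier C).symm_apply_apply
        (P.lcoact.rTensor C (P.rcoact p)), h]
      generalize P.lcoact p = t
      induction t using tensor_ind with
      | add a b ha hb => simp only [TensorProduct.tmul_add, map_add, ha, hb]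
      | tmul c y =>
        simp only [LinearMap.lTensor_tmul, TensorProduct.assoc_symm_tmul]
        generalize P.rcoact y = q
        induction q using tensor_ind with
        | add a b ha hb => simp only [TensorProduct.tmul_add, map_add, ha, hb]
        | tmul a b => simp
  have hz : g z = 0 := z.2
  rw [← LinearMap.comp_apply, key, LinearMap.comp_apply, hz, map_zero]

lemma left_map_mem (P : Bicomod k D C) {X Y : LeftComod k C} (f : X ⟶ Y) :
    ∀ z ∈ cotensor P.right X, f.lin.lTensor P.carrier z ∈ cotensor P.right Y := by
  intro z hz
  have e : ((TensorProduct.assoc k P.carrier C Y).toLinearMap ∘ₗ P.rcoact.rTensor Y -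
      Y.coact.lTensor P.carrier) ∘ₗ f.lin.lTensor P.carrier =
      (f.lin.lTensor C).lTensor P.carrier ∘ₗ
        ((TensorProduct.assoc k P.carrier C X).toLinearMap ∘ₗ P.rcoact.rTensor X -
          X.coact.lTensor P.carrier) := by
    rw [LinearMap.sub_comp, LinearMap.comp_sub]
    congr 1
    · refine TensorProduct.ext' fun p x => ?_
      simp only [LinearMap.comp_apply, LinearMap.rTensor_tmul, LinearEquiv.coe_coe,
        LinearMap.lTensor_tmul]
      generalize P.rcoact p = q
      induction q using tensor_ind with
      | add a b ha hb => simp only [TensorProduct.add_tmul, map_add, ha, hb]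
      | tmul a b => simp
    · rw [← LinearMap.lTensor_comp, ← LinearMap.lTensor_comp, f.comm]
  have h0 := LinearMap.congr_fun e z
  have hz' : ((TensorProduct.assoc k P.carrier C X).toLinearMap ∘ₗ P.rcoact.rTensor X -
      X.coact.lTensor P.carrier) z = 0 := hz
  rw [LinearMap.comp_apply, LinearMap.comp_apply, hz', map_zero] at h0
  exact h0

lemma right_map_mem (P : Bicomod k D C) {X Y : RightComod k D} (f : X ⟶ Y) :
    ∀ z ∈ cotensor X P.left, f.lin.rTensor P.carrier z ∈ cotensor Y P.left := by
  intro z hz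
  have e : ((TensorProduct.assoc k Y D P.carrier).toLinearMap ∘ₗ Y.coact.rTensor P.carrier -
      P.lcoact.lTensor Y) ∘ₗ f.lin.rTensor P.carrier =
      f.lin.rTensor (D ⊗[k] P.carrier) ∘ₗ
        ((TensorProduct.assoc k X D P.carrier).toLinearMap ∘ₗ X.coact.rTensor P.carrier -
          P.lcoact.lTensor X) := by
    rw [LinearMap.sub_comp, LinearMap.comp_sub]
    congr 1
    · refine TensorProduct.ext' fun x p => ?_
      simp only [LinearMap.comp_apply, LinearMap.rTensor_tmul, LinearEquiv.coe_coe,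
        RightComod.comm_apply]
      generalize X.coact x = q
      induction q using tensor_ind with
      | add a b ha hb => simp only [TensorProduct.add_tmul, map_add, ha, hb]
      | tmul a b => simp
    · refine TensorProduct.ext' fun x p => ?_
      simp
  have h0 := LinearMap.congr_fun e z
  have hz' : ((TensorProduct.assoc k X D P.carrier).toLinearMap ∘ₗ X.coact.rTensor P.carrier -
      P.lcoact.lTensor X) z = 0 := hz
  rw [LinearMap.comp_apply, LinearMap.comp_apply, hz', map_zero] at h0
  exact h0

/-- The left comodule `P □_C X`; its coaction is the restriction of `λ_P ⊗ id`. -/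
abbrev cotensorObj (P : Bicomod k D C) (X : LeftComod k C) : LeftComod k D :=
  (P.leftTensor X).sub (cotensor P.right X) (P.left_stable X)

/-- The right comodule `X □_D P`; its coaction is the restriction of `id ⊗ ρ_P`. -/
abbrev cotensorObjRight (P : Bicomod k D C) (X : RightComod k D) : RightComod k C :=
  (P.rightTensor X).sub (cotensor X P.left) (P.right_stable X)

/-- The functor `P □_C ?` from left `C`-comodules to left `D`-comodules. -/
def cotensorFunctor (P : Bicomod k D C) : LeftComod k C ⥤ LeftComod k D where
  obj X := P.cotensorObj X
  map f := LeftComod.subHom (P.leftTensorMap f.lin) _ _ _ _ (P.left_map_mem f)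
  map_id X := by
    ext1
    refine LinearMap.ext fun z => Subtype.ext ?_
    exact LinearMap.congr_fun (LinearMap.lTensor_id P.carrier X) (z : P.carrier ⊗[k] X)
  map_comp {X Y Z} f g := by
    ext1
    refine LinearMap.ext fun z => Subtype.ext ?_
    exact LinearMap.congr_fun (LinearMap.lTensor_comp P.carrier g.lin f.lin)
      (z : P.carrier ⊗[k] X)

/-- The functor `? □_D P` from right `D`-comodules to right `C`-comodules. -/
def cotensorFunctorRight (P : Bicomod k D C) : RightComod k D ⥤ RightComod k C where
  obj X := P.cotensorObjRight X
  map f := RightComod.subHom (P.rightTensorMap f.lin) _ _ _ _ (P.right_map_mem f)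
  map_id X := by
    ext1
    refine LinearMap.ext fun z => Subtype.ext ?_
    exact LinearMap.congr_fun (LinearMap.rTensor_id P.carrier X) (z : X ⊗[k] P.carrier)
  map_comp {X Y Z} f g := by
    ext1
    refine LinearMap.ext fun z => Subtype.ext ?_
    exact LinearMap.congr_fun (LinearMap.rTensor_comp P.carrier g.lin f.lin)
      (z : X ⊗[k] P.carrier)

end Bicomod

/-- The operator `S ⊗ id` on `V ⊗ V ⊗ V`. -/
def leg12 {k : Type u} [Field k] {V : Type u} [AddCommGroup V] [Module k V]
    (S : V ⊗[k] V →ₗ[k] V ⊗[k] V) : V ⊗[k] (V ⊗[k] V) →ₗ[k] V ⊗[k] (V ⊗[k] V) :=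
  (TensorProduct.assoc k V V V).toLinearMap ∘ₗ S.rTensor V ∘ₗ
    (TensorProduct.assoc k V V V).symm.toLinearMap

/-- The operator `id ⊗ S` on `V ⊗ V ⊗ V`. -/
def leg23 {k : Type u} [Field k] {V : Type u} [AddCommGroup V] [Module k V]
    (S : V ⊗[k] V →ₗ[k] V ⊗[k] V) : V ⊗[k] (V ⊗[k] V) →ₗ[k] V ⊗[k] (V ⊗[k] V) :=
  S.lTensor V

/-- A Hecke symmetry on `V` with parameter `q ≠ 0`. -/
structure HeckeSymmetry (k : Type u) [Field k] (q : k) (V : Type u) [AddCommGroup V]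
    [Module k V] where
  /-- the operator `R` -/
  op : V ⊗[k] V →ₗ[k] V ⊗[k] V
  q_ne_zero : q ≠ 0
  hecke : (op + LinearMap.id) ∘ₗ (op - q • LinearMap.id) = 0
  braid : leg12 op ∘ₗ leg23 op ∘ₗ leg12 op = leg23 op ∘ₗ leg12 op ∘ₗ leg23 op

/-- The operator on `V^* ⊗ V^*` adjoint to `S : V ⊗ V → V ⊗ V`, with respect to the pairing
`⟨ξ ⊗ η, v ⊗ w⟩ = ξ(v) η(w)`. -/
def adjointOp {k : Type u} [Field k] {V : Type u} [AddCommGroup V] [Module k V]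
    [Module.Finite k V] (S : V ⊗[k] V →ₗ[k] V ⊗[k] V) :
    Module.Dual k V ⊗[k] Module.Dual k V →ₗ[k] Module.Dual k V ⊗[k] Module.Dual k V :=
  (dualDistribEquiv k V V).symm.toLinearMap ∘ₗ S.dualMap ∘ₗ (dualDistribEquiv k V V).toLinearMap

section Basics

variable {k : Type u} [Field k] {V : Type u} [AddCommGroup V] [Module k V] [Module.Finite k V]

lemma dualDistrib_adjointOp (S : V ⊗[k] V →ₗ[k] V ⊗[k] V)
    (β : Module.Dual k V ⊗[k] Module.Dual k V) (u : V ⊗[k] V) :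
    dualDistrib k V V (adjointOp S β) u = dualDistrib k V V β (S u) := by
  have h : dualDistribEquiv k V V (adjointOp S β) = S.dualMap (dualDistribEquiv k V V β) :=
    (dualDistribEquiv k V V).apply_symm_apply _
  exact LinearMap.congr_fun h u

lemma dualDistrib_ext {β γ : Module.Dual k V ⊗[k] Module.Dual k V}
    (h : ∀ v w, dualDistrib k V V β (v ⊗ₜ w) = dualDistrib k V V γ (v ⊗ₜ w)) : β = γ :=
  (dualDistribEquiv k V V).injective (TensorProduct.ext' h)

lemma sum_dual_expand (β : Module.Dual k V ⊗[k] Module.Dual k V) :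
    ∑ i, ∑ j, dualDistrib k V V β (Module.finBasis k V i ⊗ₜ Module.finBasis k V j) •
      ((Module.finBasis k V).coord i ⊗ₜ[k] (Module.finBasis k V).coord j) = β := by
  induction β using tensor_ind with
  | add a b ha hb =>
    simp only [map_add, LinearMap.add_apply, add_smul, Finset.sum_add_distrib, ha, hb]
  | tmul ξ η =>
    conv_rhs => rw [← (Module.finBasis k V).sum_dual_apply_smul_coord ξ,
      ← (Module.finBasis k V).sum_dual_apply_smul_coord η]
    simp only [TensorProduct.sum_tmul, TensorProduct.tmul_sum, dualDistrib_apply,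
      TensorProduct.smul_tmul_smul]
    exact Finset.sum_comm

lemma sum_expand (u : V ⊗[k] V) :
    ∑ i, ∑ j, dualDistrib k V V ((Module.finBasis k V).coord i ⊗ₜ[k]
      (Module.finBasis k V).coord j) u •
        (Module.finBasis k V i ⊗ₜ[k] Module.finBasis k V j) = u := by
  induction u using tensor_ind with
  | add a b ha hb =>
    simp only [map_add, add_smul, Finset.sum_add_distrib, ha, hb]
  | tmul ξ η =>
    conv_rhs => rw [← (Module.finBasis k V).sum_repr ξ, ← (Module.finBasis k V).sum_repr η]
    simp only [TensorProduct.sum_tmul, TensorProduct.tmul_sum, dualDistrib_apply,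
      TensorProduct.smul_tmul_smul, Module.Basis.coord_apply]
    exact Finset.sum_comm

/-- The canonical element of `V ⊗ V ⊗ V^* ⊗ V^*` intertwines `S` and its adjoint. -/
lemma canonical_adjointOp (S : V ⊗[k] V →ₗ[k] V ⊗[k] V) :
    ∑ i, ∑ j, (Module.finBasis k V i ⊗ₜ[k] Module.finBasis k V j) ⊗ₜ[k]
      adjointOp S ((Module.finBasis k V).coord i ⊗ₜ[k] (Module.finBasis k V).coord j) =
    ∑ i, ∑ j, S (Module.finBasis k V i ⊗ₜ[k] Module.finBasis k V j) ⊗ₜ[k]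
      ((Module.finBasis k V).coord i ⊗ₜ[k] (Module.finBasis k V).coord j) := by
  set b := Module.finBasis k V
  have h1 : ∀ i j, adjointOp S (b.coord i ⊗ₜ[k] b.coord j) = ∑ m, ∑ n,
      dualDistrib k V V (b.coord i ⊗ₜ b.coord j) (S (b m ⊗ₜ b n)) •
        (b.coord m ⊗ₜ[k] b.coord n) := by
    intro i j
    simp only [← dualDistrib_adjointOp]
    exact (sum_dual_expand _).symm
  have h2 : ∀ m n, S (b m ⊗ₜ[k] b n) = ∑ i, ∑ j,
      dualDistrib k V V (b.coord i ⊗ₜ b.coord j) (S (b m ⊗ₜ b n)) • (b i ⊗ₜ[k] b j) :=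
    fun m n => (sum_expand _).symm
  simp only [h1]
  conv_rhs => enter [2, i, 2, j]; rw [h2]
  simp only [TensorProduct.tmul_sum, TensorProduct.sum_tmul, TensorProduct.tmul_smul,
    ← TensorProduct.smul_tmul']
  have e : ∀ {M : Type u} [AddCommGroup M] (g : Fin (Module.finrank k V) →
      Fin (Module.finrank k V) → Fin (Module.finrank k V) → Fin (Module.finrank k V) → M),
      ∑ i, ∑ j, ∑ m, ∑ n, g i j m n = ∑ m, ∑ n, ∑ i, ∑ j, g i j m n := by
    intro M _ g
    have e2 : ∀ g : Fin (Module.finrank k V) → Fin (Module.finrank k V) →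
        Fin (Module.finrank k V) → M, ∑ i, ∑ m, ∑ n, g i m n = ∑ m, ∑ n, ∑ i, g i m n := by
      intro g
      rw [Finset.sum_comm]
      exact Finset.sum_congr rfl fun _ _ => Finset.sum_comm
    exact (Finset.sum_congr rfl fun i _ => e2 (g i)).trans (e2 fun i m n => ∑ j, g i j m n)
  exact e _

end Basics

section QuantumHom

variable {k : Type u} [Field k] {q : k}
  {V₀ V V' V'' : Type u} [AddCommGroup V₀] [Module k V₀] [Module.Finite k V₀]
  [AddCommGroup V] [Module k V] [Module.Finite k V]
  [AddCommGroup V'] [Module k V'] [Module.Finite k V']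
  [AddCommGroup V''] [Module k V''] [Module.Finite k V'']

/-- For a linear map `f : V'^* ⊗ V → B` into an algebra, the linear map
`(ξ ⊗ η) ⊗ (v ⊗ w) ↦ f(ξ ⊗ v) f(η ⊗ w)`. -/
def quad {B : Type u} [Ring B] [Algebra k B] (f : Module.Dual k V' ⊗[k] V →ₗ[k] B) :
    (Module.Dual k V' ⊗[k] Module.Dual k V') ⊗[k] (V ⊗[k] V) →ₗ[k] B :=
  LinearMap.mul' k B ∘ₗ TensorProduct.map f f ∘ₗ
    (tensorTensorTensorComm k (Module.Dual k V') (Module.Dual k V') V V).toLinearMap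

@[simp] lemma quad_tmul {B : Type u} [Ring B] [Algebra k B]
    (f : Module.Dual k V' ⊗[k] V →ₗ[k] B) (ξ η : Module.Dual k V') (v w : V) :
    quad f ((ξ ⊗ₜ η) ⊗ₜ (v ⊗ₜ w)) = f (ξ ⊗ₜ v) * f (η ⊗ₜ w) := by
  simp [quad]

lemma map_quad {B B' : Type u} [Ring B] [Algebra k B] [Ring B'] [Algebra k B']
    (f : Module.Dual k V' ⊗[k] V →ₗ[k] B) (φ : B →ₐ[k] B')
    (x : (Module.Dual k V' ⊗[k] Module.Dual k V') ⊗[k] (V ⊗[k] V)) :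
    φ (quad f x) = quad (φ.toLinearMap ∘ₗ f) x := by
  have : φ.toLinearMap ∘ₗ quad f = quad (φ.toLinearMap ∘ₗ f) := by
    ext; simp
  exact LinearMap.congr_fun this x

/-- The defining relations of `A(R', R)`: the elements `β ⊗ R w - R'^* β ⊗ w`, which span
`Im (id ⊗ R - R'^* ⊗ id)` in `V'^* ⊗ V'^* ⊗ V ⊗ V`, are set equal to zero in `T(V'^* ⊗ V)`. -/
inductive QHom.Rel (R' : HeckeSymmetry k q V') (R : HeckeSymmetry k q V) :
    TensorAlgebra k (Module.Dual k V' ⊗[k] V) → TensorAlgebra k (Module.Dual k V' ⊗[k] V) → Prop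
  | mk (β : Module.Dual k V' ⊗[k] Module.Dual k V') (w : V ⊗[k] V) :
    QHom.Rel R' R (quad (TensorAlgebra.ι k) (β ⊗ₜ R.op w))
      (quad (TensorAlgebra.ι k) (adjointOp R'.op β ⊗ₜ w))

/-- The algebra `A(R', R)`, a factor algebra of the tensor algebra of `V'^* ⊗ V`. -/
def QHom (R' : HeckeSymmetry k q V') (R : HeckeSymmetry k q V) : Type u :=
  RingQuot (QHom.Rel R' R)

namespace QHom

instance (R' : HeckeSymmetry k q V') (R : HeckeSymmetry k q V) : Ring (QHom R' R) :=
  inferInstanceAs (Ring (RingQuot (QHom.Rel R' R)))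

instance (R' : HeckeSymmetry k q V') (R : HeckeSymmetry k q V) : Algebra k (QHom R' R) :=
  inferInstanceAs (Algebra k (RingQuot (QHom.Rel R' R)))

/-- The canonical map `V'^* ⊗ V → A(R', R)`. -/
def gen (R' : HeckeSymmetry k q V') (R : HeckeSymmetry k q V) :
    Module.Dual k V' ⊗[k] V →ₗ[k] QHom R' R :=
  (RingQuot.mkAlgHom k (QHom.Rel R' R)).toLinearMap ∘ₗ TensorAlgebra.ι k

lemma quad_gen_rel (R' : HeckeSymmetry k q V') (R : HeckeSymmetry k q V)
    (β : Module.Dual k V' ⊗[k] Module.Dual k V') (w : V ⊗[k] V) :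
    quad (gen R' R) (β ⊗ₜ R.op w) = quad (gen R' R) (adjointOp R'.op β ⊗ₜ w) := by
  have h := RingQuot.mkAlgHom_rel k (QHom.Rel.mk (R' := R') (R := R) β w)
  exact (map_quad _ _ _).symm.trans (h.trans (map_quad _ _ _))

/-- The universal property of `A(R', R)`. -/
def lift (R' : HeckeSymmetry k q V') (R : HeckeSymmetry k q V) {B : Type u} [Ring B] [Algebra k B]
    (f : Module.Dual k V' ⊗[k] V →ₗ[k] B)
    (h : ∀ β w, quad f (β ⊗ₜ R.op w) = quad f (adjointOp R'.op β ⊗ₜ w)) : QHom R' R →ₐ[k] B :=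
  RingQuot.liftAlgHom k ⟨TensorAlgebra.lift k f, by
    rintro _ _ ⟨β, w⟩
    rw [map_quad, map_quad]
    have e : (TensorAlgebra.lift k f).toLinearMap ∘ₗ TensorAlgebra.ι k = f :=
      TensorAlgebra.ι_comp_lift f
    rw [e, h]⟩

@[simp] lemma lift_gen (R' : HeckeSymmetry k q V') (R : HeckeSymmetry k q V) {B : Type u} [Ring B]
    [Algebra k B] (f : Module.Dual k V' ⊗[k] V →ₗ[k] B) (h) (x : Module.Dual k V' ⊗[k] V) :
    lift R' R f h (gen R' R x) = f x := by
  change RingQuot.liftAlgHom k _ (RingQuot.mkAlgHom k (QHom.Rel R' R) (TensorAlgebra.ι k x)) = _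
  rw [RingQuot.liftAlgHom_mkAlgHom_apply, TensorAlgebra.lift_ι_apply]

lemma algHom_ext {R' : HeckeSymmetry k q V'} {R : HeckeSymmetry k q V} {B : Type u} [Ring B]
    [Algebra k B] {f g : QHom R' R →ₐ[k] B}
    (h : ∀ ξ v, f (gen R' R (ξ ⊗ₜ v)) = g (gen R' R (ξ ⊗ₜ v))) : f = g := by
  refine RingQuot.ringQuot_ext' _ _ _ (TensorAlgebra.hom_ext (TensorProduct.ext' h))

lemma induction {R' : HeckeSymmetry k q V'} {R : HeckeSymmetry k q V} {P : QHom R' R → Prop}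
    (h0 : ∀ c : k, P (algebraMap k _ c)) (h1 : ∀ ξ v, P (gen R' R (ξ ⊗ₜ v)))
    (hmul : ∀ a b, P a → P b → P (a * b)) (hadd : ∀ a b, P a → P b → P (a + b))
    (a : QHom R' R) : P a := by
  obtain ⟨x, rfl⟩ := RingQuot.mkAlgHom_surjective k (QHom.Rel R' R) a
  induction x using TensorAlgebra.induction with
  | algebraMap c => rw [AlgHom.commutes]; exact h0 c
  | ι x =>
    induction x with
    | zero =>
      have e : RingQuot.mkAlgHom k (QHom.Rel R' R) (TensorAlgebra.ι k 0) =
          algebraMap k (QHom R' R) 0 := by rw [map_zero, map_zero, map_zero]; rfl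
      exact e ▸ h0 0
    | tmul ξ v => exact h1 ξ v
    | add x y hx hy => rw [map_add, map_add]; exact hadd _ _ hx hy
  | mul x y hx hy => rw [map_mul]; exact hmul _ _ hx hy
  | add x y hx hy => rw [map_add]; exact hadd _ _ hx hy

/-- The map `ξ ⊗ w ↦ ∑ᵢ (ξ ⊗ eᵢ) ⊗ (eⁱ ⊗ w)` for dual bases `eᵢ`, `eⁱ` of `V` and `V^*`. -/
def comulGen (R' : HeckeSymmetry k q V') (R : HeckeSymmetry k q V) (R'' : HeckeSymmetry k q V'') :
    Module.Dual k V' ⊗[k] V'' →ₗ[k] QHom R' R ⊗[k] QHom R R'' :=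
  ∑ i, TensorProduct.map
    (gen R' R ∘ₗ (TensorProduct.mk k _ _).flip (Module.finBasis k V i))
    (gen R R'' ∘ₗ TensorProduct.mk k _ _ ((Module.finBasis k V).coord i))

lemma comulGen_tmul (R' : HeckeSymmetry k q V') (R : HeckeSymmetry k q V)
    (R'' : HeckeSymmetry k q V'') (ξ : Module.Dual k V') (w : V'') :
    comulGen R' R R'' (ξ ⊗ₜ w) = ∑ i, gen R' R (ξ ⊗ₜ Module.finBasis k V i) ⊗ₜ[k]
      gen R R'' ((Module.finBasis k V).coord i ⊗ₜ w) := by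
  simp [comulGen, LinearMap.sum_apply]

lemma quad_comulGen (R' : HeckeSymmetry k q V') (R : HeckeSymmetry k q V)
    (R'' : HeckeSymmetry k q V'') (β : Module.Dual k V' ⊗[k] Module.Dual k V')
    (u : V'' ⊗[k] V'') :
    quad (comulGen R' R R'') (β ⊗ₜ u) = ∑ i, ∑ j,
      quad (gen R' R) (β ⊗ₜ (Module.finBasis k V i ⊗ₜ Module.finBasis k V j)) ⊗ₜ[k]
        quad (gen R R'')
          (((Module.finBasis k V).coord i ⊗ₜ (Module.finBasis k V).coord j) ⊗ₜ u) := by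
  induction β using tensor_ind with
  | add a b ha hb =>
    simp only [TensorProduct.add_tmul, map_add, ha, hb, Finset.sum_add_distrib]
  | tmul ξ η =>
    induction u using tensor_ind with
    | add a b ha hb =>
      simp only [TensorProduct.tmul_add, map_add, ha, hb, Finset.sum_add_distrib]
    | tmul v w =>
      simp only [quad_tmul, comulGen_tmul, Finset.sum_mul_sum,
        Algebra.TensorProduct.tmul_mul_tmul]

/-- The algebra homomorphism `Δ : A(R', R'') → A(R', R) ⊗ A(R, R'')`. -/
def comulHom (R' : HeckeSymmetry k q V') (R : HeckeSymmetry k q V) (R'' : HeckeSymmetry k q V'') :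
    QHom R' R'' →ₐ[k] QHom R' R ⊗[k] QHom R R'' :=
  lift R' R'' (comulGen R' R R'') fun β w => by
    rw [quad_comulGen, quad_comulGen]
    have h := congrArg (TensorProduct.map
      (quad (gen R' R) ∘ₗ TensorProduct.mk k _ _ β)
      (quad (gen R R'') ∘ₗ (TensorProduct.mk k _ _).flip w)) (canonical_adjointOp R.op)
    simp only [map_sum, TensorProduct.map_tmul, LinearMap.comp_apply, TensorProduct.mk_apply,
      LinearMap.flip_apply] at h
    refine Eq.trans ?_ (h.trans ?_)
    · exact Finset.sum_congr rfl fun i _ => Finset.sum_congr rfl fun j _ =>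
        congrArg _ (quad_gen_rel R R'' _ w)
    · exact Finset.sum_congr rfl fun i _ => Finset.sum_congr rfl fun j _ =>
        congrArg (· ⊗ₜ[k] _) (quad_gen_rel R' R β _)

lemma comulHom_gen (R' : HeckeSymmetry k q V') (R : HeckeSymmetry k q V)
    (R'' : HeckeSymmetry k q V'') (ξ : Module.Dual k V') (w : V'') :
    comulHom R' R R'' (gen R' R'' (ξ ⊗ₜ w)) =
      ∑ i, gen R' R (ξ ⊗ₜ Module.finBasis k V i) ⊗ₜ[k]
        gen R R'' ((Module.finBasis k V).coord i ⊗ₜ w) := by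
  rw [comulHom, lift_gen, comulGen_tmul]

/-- The counit of `A(R)`, given by `ξ ⊗ v ↦ ξ(v)`. -/
def counitHom (R : HeckeSymmetry k q V) : QHom R R →ₐ[k] k :=
  lift R R (contractLeft k V) fun β w => by
    have e : ∀ (β : Module.Dual k V ⊗[k] Module.Dual k V) (u : V ⊗[k] V),
        quad (contractLeft k V) (β ⊗ₜ u) = dualDistrib k V V β u := by
      intro β u
      induction β using tensor_ind with
      | add a b ha hb =>
        simp only [TensorProduct.add_tmul, map_add, ha, hb, LinearMap.add_apply]
      | tmul ξ η =>
        induction u using tensor_ind with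
        | add a b ha hb => simp only [TensorProduct.tmul_add, map_add, ha, hb]
        | tmul v w => simp
    rw [e, e, dualDistrib_adjointOp]

@[simp] lemma counitHom_gen (R : HeckeSymmetry k q V) (ξ : Module.Dual k V) (v : V) :
    counitHom R (gen R R (ξ ⊗ₜ v)) = ξ v := by
  simp [counitHom]

lemma comulHom_coassoc (R₀ : HeckeSymmetry k q V₀) (R' : HeckeSymmetry k q V')
    (R : HeckeSymmetry k q V) (R'' : HeckeSymmetry k q V'') :
    (Algebra.TensorProduct.assoc k k k (QHom R₀ R') (QHom R' R) (QHom R R'')).toAlgHom.comp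
      ((Algebra.TensorProduct.map (comulHom R₀ R' R) (AlgHom.id k (QHom R R''))).comp
        (comulHom R₀ R R'')) =
    (Algebra.TensorProduct.map (AlgHom.id k (QHom R₀ R')) (comulHom R' R R'')).comp
      (comulHom R₀ R' R'') := by
  refine algHom_ext fun ξ v => ?_
  simp [comulHom_gen, TensorProduct.sum_tmul, TensorProduct.tmul_sum]
  rw [Finset.sum_comm]

lemma counitHom_left (R' : HeckeSymmetry k q V') (R : HeckeSymmetry k q V) :
    (Algebra.TensorProduct.map (counitHom R') (AlgHom.id k (QHom R' R))).comp
      (comulHom R' R' R) = (Algebra.TensorProduct.lid k (QHom R' R)).symm.toAlgHom := by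
  refine algHom_ext fun ξ v => ?_
  have h : ∑ i, ξ (Module.finBasis k V' i) • (Module.finBasis k V').coord i = ξ :=
    (Module.finBasis k V').sum_dual_apply_smul_coord ξ
  apply (Algebra.TensorProduct.lid k (QHom R' R)).injective
  simp only [AlgHom.comp_apply, comulHom_gen, map_sum, Algebra.TensorProduct.map_tmul,
    counitHom_gen, AlgHom.id_apply, Algebra.TensorProduct.lid_tmul]
  refine (Finset.sum_congr rfl fun i _ => ?_).trans ((map_sum ((gen R' R) ∘ₗ
    (TensorProduct.mk k _ _).flip v) _ _).symm.trans ((congrArg _ h).trans ?_))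
  · simp
  · simp

lemma counitHom_right (R' : HeckeSymmetry k q V') (R : HeckeSymmetry k q V) :
    (Algebra.TensorProduct.map (AlgHom.id k (QHom R' R)) (counitHom R)).comp
      (comulHom R' R R) = (Algebra.TensorProduct.rid k k (QHom R' R)).symm.toAlgHom := by
  refine algHom_ext fun ξ v => ?_
  have h : ∑ i, (Module.finBasis k V).repr v i • Module.finBasis k V i = v :=
    (Module.finBasis k V).sum_repr v
  apply (Algebra.TensorProduct.rid k k (QHom R' R)).injective
  simp only [AlgHom.comp_apply, comulHom_gen, map_sum, Algebra.TensorProduct.map_tmul,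
    counitHom_gen, AlgHom.id_apply, Algebra.TensorProduct.rid_tmul]
  refine (Finset.sum_congr rfl fun i _ => ?_).trans ((map_sum ((gen R' R) ∘ₗ
    TensorProduct.mk k _ _ ξ) _ _).symm.trans ((congrArg _ h).trans ?_))
  · simp
  · simp

end QHom

/-- The FRT bialgebra `A(R) = A(R, R)`. -/
abbrev FRT (R : HeckeSymmetry k q V) : Type u := QHom R R

instance (R : HeckeSymmetry k q V) : Bialgebra k (FRT R) :=
  Bialgebra.ofAlgHom (QHom.comulHom R R R) (QHom.counitHom R) (QHom.comulHom_coassoc R R R R)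
    (QHom.counitHom_left R R) (QHom.counitHom_right R R)

/-- `A(R', R)` as an `A(R')`-`A(R)`-bicomodule. -/
def QHom.bicomod (R' : HeckeSymmetry k q V') (R : HeckeSymmetry k q V) :
    Bicomod k (FRT R') (FRT R) where
  carrier := QHom R' R
  lcoact := (QHom.comulHom R' R' R).toLinearMap
  rcoact := (QHom.comulHom R' R R).toLinearMap
  lcoassoc := congrArg AlgHom.toLinearMap (QHom.comulHom_coassoc R' R' R' R)
  counit_lcoact := by
    have h := QHom.counitHom_left R' R
    refine LinearMap.ext fun a => ?_
    have := congrArg (Algebra.TensorProduct.lid k (QHom R' R)) (AlgHom.congr_fun h a)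
    exact this.trans ((Algebra.TensorProduct.lid k (QHom R' R)).apply_symm_apply a)
  rcoassoc := congrArg AlgHom.toLinearMap (QHom.comulHom_coassoc R' R R R)
  counit_rcoact := by
    have h := QHom.counitHom_right R' R
    refine LinearMap.ext fun a => ?_
    have := congrArg (Algebra.TensorProduct.rid k k (QHom R' R)) (AlgHom.congr_fun h a)
    exact this.trans ((Algebra.TensorProduct.rid k k (QHom R' R)).apply_symm_apply a)
  bicoassoc := congrArg AlgHom.toLinearMap (QHom.comulHom_coassoc R' R' R R)

end QuantumHom

/-- The two compatibility conditions with a Hecke symmetry under which an operator `S` on `V ⊗ V`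
gives rise to a bilinear form on `A(R)`. They hold for `S = R` and for `S = R⁻¹`. -/
structure HeckeSymmetry.Compat {k : Type u} [Field k] {q : k} {V : Type u} [AddCommGroup V]
    [Module k V] (R : HeckeSymmetry k q V) (S : V ⊗[k] V →ₗ[k] V ⊗[k] V) : Prop where
  left : leg23 S ∘ₗ leg12 S ∘ₗ leg23 R.op = leg12 R.op ∘ₗ leg23 S ∘ₗ leg12 S
  right : leg12 S ∘ₗ leg23 S ∘ₗ leg12 R.op = leg23 R.op ∘ₗ leg12 S ∘ₗ leg23 S

namespace FRT

variable {k : Type u} [Field k] {q : k} {V : Type u} [AddCommGroup V] [Module k V]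
  [Module.Finite k V]

/-- The linear form on `V ⊗ V ⊗ V` given by `β ∈ V^* ⊗ V^*` on the first two factors and
`η ∈ V^*` on the third one. -/
def pair12 (β : Module.Dual k V ⊗[k] Module.Dual k V) (η : Module.Dual k V) :
    V ⊗[k] (V ⊗[k] V) →ₗ[k] k :=
  (TensorProduct.lid k k).toLinearMap ∘ₗ TensorProduct.map (dualDistrib k V V β) η ∘ₗ
    (TensorProduct.assoc k V V V).symm.toLinearMap

/-- The linear form on `V ⊗ V ⊗ V` given by `ξ ∈ V^*` on the first factor and
`γ ∈ V^* ⊗ V^*` on the last two factors. -/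
def pair23 (ξ : Module.Dual k V) (γ : Module.Dual k V ⊗[k] Module.Dual k V) :
    V ⊗[k] (V ⊗[k] V) →ₗ[k] k :=
  (TensorProduct.lid k k).toLinearMap ∘ₗ TensorProduct.map ξ (dualDistrib k V V γ)

lemma pair12_leg12 (T : V ⊗[k] V →ₗ[k] V ⊗[k] V) (β : Module.Dual k V ⊗[k] Module.Dual k V)
    (η : Module.Dual k V) (x : V ⊗[k] (V ⊗[k] V)) :
    pair12 β η (leg12 T x) = pair12 (adjointOp T β) η x := by
  obtain ⟨x, rfl⟩ := (TensorProduct.assoc k V V V).surjective x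
  simp only [pair12, leg12, LinearMap.comp_apply, LinearEquiv.coe_coe,
    LinearEquiv.symm_apply_apply]
  induction x using tensor_ind with
  | add a b ha hb => simp only [map_add, ha, hb]
  | tmul u w => simp [dualDistrib_adjointOp]

lemma pair23_leg23 (T : V ⊗[k] V →ₗ[k] V ⊗[k] V) (ξ : Module.Dual k V)
    (γ : Module.Dual k V ⊗[k] Module.Dual k V) (x : V ⊗[k] (V ⊗[k] V)) :
    pair23 ξ γ (leg23 T x) = pair23 ξ (adjointOp T γ) x := by
  induction x using tensor_ind with
  | add a b ha hb => simp only [map_add, ha, hb]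
  | tmul u w => simp [pair23, leg23, dualDistrib_adjointOp]

/-- The map `V^* ⊗ V → End V^*` that sends `ξ ⊗ v` to `η ↦ (w ↦ ⟨ξ ⊗ η, S (w ⊗ v)⟩)`. -/
def matGen (S : V ⊗[k] V →ₗ[k] V ⊗[k] V) :
    Module.Dual k V ⊗[k] V →ₗ[k] Module.End k (Module.Dual k V) :=
  TensorProduct.lift (LinearMap.mk₂ k (fun ξ v =>
    ((TensorProduct.mk k V V).flip v).dualMap ∘ₗ S.dualMap ∘ₗ dualDistrib k V V ∘ₗ
      TensorProduct.mk k _ _ ξ)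
    (fun ξ ξ' v => by ext; simp) (fun c ξ v => by ext; simp)
    (fun ξ v v' => by ext; simp [TensorProduct.tmul_add])
    (fun c ξ v => by ext; simp))

lemma matGen_apply (S : V ⊗[k] V →ₗ[k] V ⊗[k] V) (ξ η : Module.Dual k V) (v w : V) :
    matGen S (ξ ⊗ₜ v) η w = dualDistrib k V V (ξ ⊗ₜ η) (S (w ⊗ₜ v)) := rfl

lemma quad_matGen (S : V ⊗[k] V →ₗ[k] V ⊗[k] V) (β : Module.Dual k V ⊗[k] Module.Dual k V)
    (u : V ⊗[k] V) (η : Module.Dual k V) (w : V) :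
    quad (B := Module.End k (Module.Dual k V)) (matGen S) (β ⊗ₜ u) η w = pair12 β η (leg23 S (leg12 S (w ⊗ₜ u))) := by
  induction β using tensor_ind with
  | add a b ha hb =>
    simp only [TensorProduct.add_tmul, map_add, LinearMap.add_apply, ha, hb]
    simp [pair12, TensorProduct.map_add_left]
  | tmul ξ ξ' =>
    induction u using tensor_ind with
    | add a b ha hb =>
      simp only [TensorProduct.tmul_add, map_add, LinearMap.add_apply, ha, hb]
    | tmul v v' =>
      rw [quad_tmul, Module.End.mul_apply, matGen_apply]
      have e : leg12 S (w ⊗ₜ (v ⊗ₜ v')) = TensorProduct.assoc k V V V (S (w ⊗ₜ v) ⊗ₜ v') := by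
        simp [leg12]
      rw [e]
      generalize S (w ⊗ₜ[k] v) = x
      induction x using tensor_ind with
      | add a b ha hb => simp only [TensorProduct.add_tmul, map_add, ha, hb]
      | tmul x y =>
        rw [dualDistrib_apply, matGen_apply, TensorProduct.assoc_tmul, leg23,
          LinearMap.lTensor_tmul]
        generalize S (y ⊗ₜ[k] v') = z
        induction z using tensor_ind with
        | add a b ha hb => simp only [TensorProduct.tmul_add, map_add, mul_add, ha, hb]
        | tmul a b => simp [pair12, mul_assoc]

variable {R : HeckeSymmetry k q V} {S : V ⊗[k] V →ₗ[k] V ⊗[k] V}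

/-- The representation of `A(R)` in `V^*` with
`(a η)(w) = r(a, η ⊗ w)` for the bilinear form `r` determined by `S`. -/
def mat (hS : R.Compat S) : FRT R →ₐ[k] Module.End k (Module.Dual k V) :=
  QHom.lift R R (B := Module.End k (Module.Dual k V)) (matGen S) fun β u => by
    ext η w
    rw [quad_matGen, quad_matGen, ← pair12_leg12]
    exact congrArg _ (LinearMap.congr_fun hS.left (w ⊗ₜ u))

lemma mat_gen (hS : R.Compat S) (ξ η : Module.Dual k V) (v w : V) :
    mat hS (QHom.gen R R (ξ ⊗ₜ v)) η w = dualDistrib k V V (ξ ⊗ₜ η) (S (w ⊗ₜ v)) := by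
  rw [mat, QHom.lift_gen, matGen_apply]

lemma comul_gen (ξ : Module.Dual k V) (v : V) :
    comul (R := k) (QHom.gen R R (ξ ⊗ₜ v)) =
      ∑ i, QHom.gen R R (ξ ⊗ₜ Module.finBasis k V i) ⊗ₜ[k]
        QHom.gen R R ((Module.finBasis k V).coord i ⊗ₜ v) :=
  QHom.comulHom_gen R R R ξ v

lemma counit_gen (ξ : Module.Dual k V) (v : V) :
    counit (R := k) (QHom.gen R R (ξ ⊗ₜ v)) = ξ v :=
  QHom.counitHom_gen R ξ v

/-- The representation of `A(R)` in `V^* ⊗ V^*`. -/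
def mat₂ (hS : R.Compat S) :
    FRT R →ₐ[k] Module.End k (Module.Dual k V ⊗[k] Module.Dual k V) :=
  (Module.endTensorEndAlgHom (R := k) (S := k) (A := k)).comp
    ((Algebra.TensorProduct.map (mat hS) (mat hS)).comp (Bialgebra.comulAlgHom k (FRT R)))

lemma mat₂_apply (hS : R.Compat S) (a : FRT R) : mat₂ hS a =
    Module.endTensorEndAlgHom (R := k) (S := k) (A := k)
      (TensorProduct.map (mat hS).toLinearMap (mat hS).toLinearMap (comul a)) := rfl

lemma mat₂_gen (hS : R.Compat S) (ξ : Module.Dual k V) (v : V)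
    (γ : Module.Dual k V ⊗[k] Module.Dual k V) (u : V ⊗[k] V) :
    dualDistrib k V V (mat₂ hS (QHom.gen R R (ξ ⊗ₜ v)) γ) u =
      pair23 ξ γ (leg12 S (leg23 S (TensorProduct.assoc k V V V (u ⊗ₜ v)))) := by
  induction γ using tensor_ind with
  | add a b ha hb =>
    simp only [map_add, LinearMap.add_apply, ha, hb]
    simp [pair23, TensorProduct.map_add_right]
  | tmul η η' =>
    induction u using tensor_ind with
    | add a b ha hb => simp only [TensorProduct.add_tmul, map_add, ha, hb]
    | tmul w w' =>
      rw [mat₂_apply, comul_gen]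
      simp only [map_sum, TensorProduct.map_tmul, AlgHom.toLinearMap_apply,
        Module.endTensorEndAlgHom_apply, LinearMap.sum_apply,
        TensorProduct.AlgebraTensorModule.map_tmul, dualDistrib_apply, mat_gen]
      rw [TensorProduct.assoc_tmul, leg23, LinearMap.lTensor_tmul]
      generalize S (w' ⊗ₜ[k] v) = x
      induction x using tensor_ind with
      | add a b ha hb =>
        simp only [TensorProduct.tmul_add, map_add, mul_add, Finset.sum_add_distrib, ha, hb]
      | tmul x y =>
        have e : leg12 S (w ⊗ₜ (x ⊗ₜ y)) = TensorProduct.assoc k V V V (S (w ⊗ₜ x) ⊗ₜ y) := by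
          simp [leg12]
        rw [e]
        have e' : ∑ i, dualDistrib k V V (ξ ⊗ₜ η) (S (w ⊗ₜ Module.finBasis k V i)) *
            dualDistrib k V V ((Module.finBasis k V).coord i ⊗ₜ η') (x ⊗ₜ y) =
            dualDistrib k V V (ξ ⊗ₜ η) (S (w ⊗ₜ x)) * η' y := by
          conv_rhs => rw [← (Module.finBasis k V).sum_repr x]
          simp only [TensorProduct.tmul_sum, TensorProduct.tmul_smul, map_sum, map_smul,
            Finset.sum_mul, dualDistrib_apply, Module.Basis.coord_apply, smul_eq_mul]
          exact Finset.sum_congr rfl fun i _ => by ring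
        rw [e']
        generalize S (w ⊗ₜ[k] x) = z
        induction z using tensor_ind with
        | add a b ha hb => simp only [TensorProduct.add_tmul, map_add, add_mul, ha, hb]
        | tmul a b => simp [pair23, mul_assoc]

lemma mat₂_comm (hS : R.Compat S) (a : FRT R) :
    adjointOp R.op * mat₂ hS a = mat₂ hS a * adjointOp R.op := by
  induction a using QHom.induction with
  | h0 c => rw [AlgHom.commutes]; exact (Algebra.commutes c _).symm
  | h1 ξ v =>
    refine LinearMap.ext fun γ => dualDistrib_ext fun w w' => ?_
    rw [Module.End.mul_apply, Module.End.mul_apply, dualDistrib_adjointOp, mat₂_gen, mat₂_gen,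
      ← pair23_leg23]
    have h := LinearMap.congr_fun hS.right (w ⊗ₜ (w' ⊗ₜ v))
    simp only [LinearMap.comp_apply] at h
    rw [TensorProduct.assoc_tmul, ← h]
    congr 3
  | hmul a b ha hb => rw [map_mul, ← mul_assoc, ha, mul_assoc, hb, mul_assoc]
  | hadd a b ha hb => rw [map_add, mul_add, add_mul, ha, hb]

/-- The map `η ⊗ w ↦ (a ↦ (a η)(w))`. -/
def formGen (hS : R.Compat S) :
    Module.Dual k V ⊗[k] V →ₗ[k] WithConv (FRT R →ₗ[k] k) :=
  (WithConv.linearEquiv k _).symm.toLinearMap ∘ₗ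
    LinearMap.flip ((TensorProduct.lift.equiv (RingHom.id k) (Module.Dual k V) V k).toLinearMap ∘ₗ
      (mat hS).toLinearMap)

lemma formGen_apply (hS : R.Compat S) (η : Module.Dual k V) (w : V) (a : FRT R) :
    (formGen hS (η ⊗ₜ w)).ofConv a = mat hS a η w := rfl

lemma quad_formGen (hS : R.Compat S) (γ : Module.Dual k V ⊗[k] Module.Dual k V) (u : V ⊗[k] V)
    (a : FRT R) : (quad (formGen hS) (γ ⊗ₜ u)).ofConv a = dualDistrib k V V (mat₂ hS a γ) u := by
  induction γ using tensor_ind with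
  | add a b ha hb =>
    simp only [TensorProduct.add_tmul, map_add, WithConv.ofConv_add, LinearMap.add_apply, ha, hb]
  | tmul η η' =>
    induction u using tensor_ind with
    | add a b ha hb =>
      simp only [TensorProduct.tmul_add, map_add, WithConv.ofConv_add, LinearMap.add_apply, ha, hb]
    | tmul w w' =>
      rw [quad_tmul, mat₂_apply, LinearMap.convMul_apply]
      generalize (comul a : FRT R ⊗[k] FRT R) = s
      induction s using tensor_ind with
      | add a b ha hb => simp only [map_add, LinearMap.add_apply, ha, hb]
      | tmul a b =>
        simp [formGen_apply, Module.endTensorEndAlgHom_apply]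

/-- The algebra homomorphism `b ↦ r(?, b)` from `A(R)` to the convolution algebra of linear forms
on `A(R)`, for the bilinear form `r` determined by `S`. -/
def formHom (hS : R.Compat S) : FRT R →ₐ[k] WithConv (FRT R →ₗ[k] k) :=
  QHom.lift R R (formGen hS) fun β u => by
    refine WithConv.ofConv_injective (LinearMap.ext fun a => ?_)
    rw [quad_formGen, quad_formGen, ← dualDistrib_adjointOp]
    exact congrArg (fun f => dualDistrib k V V f u) (LinearMap.congr_fun (mat₂_comm hS a) β)

lemma formHom_gen (hS : R.Compat S) (η : Module.Dual k V) (w : V) (a : FRT R) :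
    (formHom hS (QHom.gen R R (η ⊗ₜ w))).ofConv a = mat hS a η w := by
  rw [formHom, QHom.lift_gen, formGen_apply]

/-- The bilinear form on `A(R)` determined by `S`; it satisfies
`r(ξ ⊗ v, η ⊗ w) = ⟨ξ ⊗ η, S (w ⊗ v)⟩`. -/
def form (hS : R.Compat S) : FRT R ⊗[k] FRT R →ₗ[k] k :=
  TensorProduct.lift
    ((WithConv.linearEquiv k _).toLinearMap ∘ₗ (formHom hS).toLinearMap).flip

lemma form_tmul (hS : R.Compat S) (a b : FRT R) :
    form hS (a ⊗ₜ b) = (formHom hS b).ofConv a := rfl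

end FRT

namespace FRT

section General

variable {k : Type u} [Field k] {A : Type u} [Ring A] [Bialgebra k A]

/-- The algebra homomorphism of convolution algebras given by the multiplication of `A`. -/
def convMulHom : WithConv (A →ₗ[k] k) →ₐ[k] WithConv (A ⊗[k] A →ₗ[k] k) :=
  AlgHom.ofLinearMap ((WithConv.linearEquiv k _).symm.toLinearMap ∘ₗ
    LinearMap.lcomp k k (LinearMap.mul' k A) ∘ₗ (WithConv.linearEquiv k _).toLinearMap)
    (WithConv.ofConv_injective (by ext a b; simp [mul_comm]))
    fun f g => WithConv.ofConv_injective
      (LinearMap.convMul_comp_coalgHom_distrib f g (mulCoalgHom k A))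

/-- The map `f ⊗ g ↦ (a ⊗ b ↦ g(a) f(b))` as a homomorphism of convolution algebras. -/
def convPairHom : WithConv (A →ₗ[k] k) ⊗[k] WithConv (A →ₗ[k] k) →ₐ[k]
    WithConv (A ⊗[k] A →ₗ[k] k) :=
  Algebra.TensorProduct.algHomOfLinearMapTensorProduct
    (TensorProduct.lift (LinearMap.mk₂ k
      (fun f g => WithConv.toConv (LinearMap.mul' k k ∘ₗ TensorProduct.map g.ofConv f.ofConv))
      (fun f f' g => WithConv.ofConv_injective (by ext; simp [mul_add]))
      (fun c f g => WithConv.ofConv_injective (by ext; simp [mul_left_comm]))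
      (fun f g g' => WithConv.ofConv_injective (by ext; simp [add_mul]))
      (fun c f g => WithConv.ofConv_injective (by ext; simp [mul_assoc]))))
    (fun f f' g g' => by
      refine WithConv.ofConv_injective ?_
      have h := LinearMap.algHom_comp_convMul_distrib (Algebra.TensorProduct.lmul' k (S := k))
        (WithConv.toConv (TensorProduct.map g.ofConv f.ofConv))
        (WithConv.toConv (TensorProduct.map g'.ofConv f'.ofConv))
      rw [TensorProduct.map_convMul_map] at h
      exact h)
    (WithConv.ofConv_injective (by ext a b; simp [mul_comm]))

lemma convPairHom_tmul (f g : WithConv (A →ₗ[k] k)) (a b : A) :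
    (convPairHom (k := k) (A := A) (f ⊗ₜ[k] g)).ofConv (a ⊗ₜ b) = g.ofConv a * f.ofConv b := rfl

/-- If `f` is multiplicative and `g` is antimultiplicative, then the elements `a` such that
`f(a₍₁₎) g(a₍₂₎) = ε(a)` form a multiplicatively closed set. -/
lemma sandwich {E : Type u} [Ring E] [Algebra k E] (f g : A →ₗ[k] E)
    (hf : ∀ a b, f (a * b) = f a * f b) (hg : ∀ a b, g (a * b) = g b * g a) {a b : A}
    (ha : LinearMap.mul' k E (TensorProduct.map f g (comul a)) = algebraMap k E (counit a))
    (hb : LinearMap.mul' k E (TensorProduct.map f g (comul b)) = algebraMap k E (counit b)) :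
    LinearMap.mul' k E (TensorProduct.map f g (comul (a * b))) =
      algebraMap k E (counit (a * b)) := by
  have h : ∀ s t : A ⊗[k] A, LinearMap.mul' k E (TensorProduct.map f g t) =
      algebraMap k E (counit b) → LinearMap.mul' k E (TensorProduct.map f g (s * t)) =
      (counit (R := k) b) • LinearMap.mul' k E (TensorProduct.map f g s) := by
    intro s t ht
    induction s using tensor_ind with
    | add a b ha hb => simp only [add_mul, map_add, smul_add, ha, hb]
    | tmul x y =>
      have e : LinearMap.mul' k E (TensorProduct.map f g ((x ⊗ₜ[k] y) * t)) =
          f x * LinearMap.mul' k E (TensorProduct.map f g t) * g y := by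
        clear ht
        induction t using tensor_ind with
        | add a b ha hb => simp only [mul_add, add_mul, map_add, ha, hb]
        | tmul a b => simp [hf, hg, mul_assoc]
      rw [e, ht, Algebra.algebraMap_eq_smul_one]
      simp
  rw [Bialgebra.comul_mul, h _ _ hb, ha, Bialgebra.counit_mul, mul_comm, map_mul,
    Algebra.smul_def]

/-- If `f` is multiplicative and `g` is antimultiplicative, then the elements `a` such that
`g(a₍₂₎) f(a₍₁₎) = ε(a)` form a multiplicatively closed set. -/
lemma sandwich' {E : Type u} [Ring E] [Algebra k E] (f g : A →ₗ[k] E)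
    (hf : ∀ a b, f (a * b) = f a * f b) (hg : ∀ a b, g (a * b) = g b * g a) {a b : A}
    (ha : LinearMap.mul' k E (TensorProduct.comm k E E (TensorProduct.map f g (comul a))) =
      algebraMap k E (counit a))
    (hb : LinearMap.mul' k E (TensorProduct.comm k E E (TensorProduct.map f g (comul b))) =
      algebraMap k E (counit b)) :
    LinearMap.mul' k E (TensorProduct.comm k E E (TensorProduct.map f g (comul (a * b)))) =
      algebraMap k E (counit (a * b)) := by
  have h : ∀ s t : A ⊗[k] A,
      LinearMap.mul' k E (TensorProduct.comm k E E (TensorProduct.map f g s)) =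
        algebraMap k E (counit a) →
      LinearMap.mul' k E (TensorProduct.comm k E E (TensorProduct.map f g (s * t))) =
      (counit (R := k) a) •
        LinearMap.mul' k E (TensorProduct.comm k E E (TensorProduct.map f g t)) := by
    intro s t hs
    induction t using tensor_ind with
    | add a b ha hb => simp only [mul_add, map_add, smul_add, ha, hb]
    | tmul x y =>
      have e : LinearMap.mul' k E (TensorProduct.comm k E E
          (TensorProduct.map f g (s * (x ⊗ₜ[k] y)))) =
          g y * LinearMap.mul' k E (TensorProduct.comm k E E (TensorProduct.map f g s)) * f x := by
        clear hs
        induction s using tensor_ind with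
        | add a b ha hb => simp only [mul_add, add_mul, map_add, ha, hb]
        | tmul a b => simp [hf, hg, mul_assoc]
      rw [e, hs, Algebra.algebraMap_eq_smul_one]
      simp
  rw [Bialgebra.comul_mul, h _ _ ha, hb, Bialgebra.counit_mul, map_mul, Algebra.smul_def]

end General

variable {k : Type u} [Field k] {q : k} {V : Type u} [AddCommGroup V] [Module k V]
  [Module.Finite k V] {R : HeckeSymmetry k q V} {S S' : V ⊗[k] V →ₗ[k] V ⊗[k] V}

lemma form_mul_right (hS : R.Compat S) (b c : FRT R) :
    WithConv.toConv (form hS ∘ₗ (TensorProduct.mk k _ _).flip (b * c)) =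
      WithConv.toConv (form hS ∘ₗ (TensorProduct.mk k _ _).flip b) *
        WithConv.toConv (form hS ∘ₗ (TensorProduct.mk k _ _).flip c) :=
  map_mul (formHom hS) b c

lemma form_mul_apply (hS : R.Compat S) (a b c : FRT R) :
    (formHom hS c).ofConv (a * b) = LinearMap.mul' k k (TensorProduct.map
      (form hS ∘ₗ TensorProduct.mk k _ _ b) (form hS ∘ₗ TensorProduct.mk k _ _ a) (comul c)) := by
  have h : convMulHom.comp (formHom hS) = convPairHom.comp
      ((Algebra.TensorProduct.map (formHom hS) (formHom hS)).comp
        (Bialgebra.comulAlgHom k (FRT R))) := by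
    refine QHom.algHom_ext fun η w => WithConv.ofConv_injective (TensorProduct.ext' fun a b => ?_)
    change (formHom hS (QHom.gen R R (η ⊗ₜ w))).ofConv (a * b) = (convPairHom (k := k) (A := FRT R)
      (TensorProduct.map (formHom hS).toLinearMap (formHom hS).toLinearMap
        (comul (R := k) (QHom.gen R R (η ⊗ₜ w))))).ofConv (a ⊗ₜ b)
    rw [comul_gen, map_sum, map_sum, WithConv.ofConv_sum, LinearMap.sum_apply, formHom_gen,
      map_mul, Module.End.mul_apply]
    conv_lhs => rw [← (Module.finBasis k V).sum_dual_apply_smul_coord (mat hS b η)]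
    simp only [map_sum, map_smul, LinearMap.sum_apply, LinearMap.smul_apply,
      TensorProduct.map_tmul, AlgHom.toLinearMap_apply, convPairHom_tmul, formHom_gen, smul_eq_mul]
    exact Finset.sum_congr rfl fun i _ => mul_comm _ _
  have h' := LinearMap.congr_fun (congrArg WithConv.ofConv (AlgHom.congr_fun h c)) (a ⊗ₜ b)
  refine h'.trans ?_
  change (convPairHom (k := k) (A := FRT R) (TensorProduct.map (formHom hS).toLinearMap (formHom hS).toLinearMap
        (comul (R := k) c))).ofConv (a ⊗ₜ b) = _
  generalize (comul c : FRT R ⊗[k] FRT R) = s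
  induction s using tensor_ind with
  | add x y hx hy => simp only [map_add, WithConv.ofConv_add, LinearMap.add_apply, hx, hy]
  | tmul x y => simp [convPairHom_tmul, form_tmul, mul_comm]

lemma form_mul_left (hS : R.Compat S) (a b : FRT R) :
    WithConv.toConv (form hS ∘ₗ TensorProduct.mk k _ _ (a * b)) =
      WithConv.toConv (form hS ∘ₗ TensorProduct.mk k _ _ b) *
        WithConv.toConv (form hS ∘ₗ TensorProduct.mk k _ _ a) :=
  WithConv.ofConv_injective (LinearMap.ext fun c => form_mul_apply hS a b c)

end FRT

namespace FRT

section Comm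

variable {k : Type u} [Field k] {A : Type u} [Ring A] [Bialgebra k A]

/-- The map `f ⊗ b ↦ (a ↦ f(a) b)`, as a homomorphism of convolution algebras. -/
def convSmulHom : WithConv (A →ₗ[k] k) ⊗[k] A →ₐ[k] WithConv (A →ₗ[k] A) :=
  Algebra.TensorProduct.algHomOfLinearMapTensorProduct
    (TensorProduct.lift (LinearMap.mk₂ k
      (fun f b => WithConv.toConv (f.ofConv.smulRight b))
      (fun f f' b => WithConv.ofConv_injective (by ext; simp [add_smul]))
      (fun c f b => WithConv.ofConv_injective (by ext; simp [mul_smul]))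
      (fun f b b' => WithConv.ofConv_injective (by ext; simp))
      (fun c f b => WithConv.ofConv_injective (by ext; simp [smul_comm c]))))
    (fun f f' b b' => by
      refine WithConv.ofConv_injective (LinearMap.ext fun a => ?_)
      change (f * f').ofConv a • (b * b') = (WithConv.toConv (f.ofConv.smulRight b) *
        WithConv.toConv (f'.ofConv.smulRight b')).ofConv a
      rw [LinearMap.convMul_apply, LinearMap.convMul_apply]
      generalize (comul a : A ⊗[k] A) = s
      induction s using tensor_ind with
      | add x y hx hy => simp only [map_add, add_smul, hx, hy]
      | tmul x y => simp [mul_smul, smul_comm (f'.ofConv y)])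
    (WithConv.ofConv_injective (by ext a; simp [Algebra.algebraMap_eq_smul_one]))

lemma convSmulHom_tmul (f : WithConv (A →ₗ[k] k)) (a b : A) :
    (convSmulHom (k := k) (A := A) (f ⊗ₜ[k] b)).ofConv a = f.ofConv a • b := rfl

end Comm

variable {k : Type u} [Field k] {q : k} {V : Type u} [AddCommGroup V] [Module k V]
  [Module.Finite k V] {R : HeckeSymmetry k q V} {S S' : V ⊗[k] V →ₗ[k] V ⊗[k] V}

/-- The operator `x ⊗ η ↦ ∑ᵢ t(η, eᵢ) x ⊗ eⁱ` on `A(R) ⊗ V^*`. -/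
def opT (R : HeckeSymmetry k q V) : Module.End k (FRT R ⊗[k] Module.Dual k V) :=
  TensorProduct.lift (LinearMap.mk₂ k (fun x η => ∑ i,
    (QHom.gen R R (η ⊗ₜ Module.finBasis k V i) * x) ⊗ₜ[k] (Module.finBasis k V).coord i)
    (fun x y η => by simp only [mul_add, TensorProduct.add_tmul, Finset.sum_add_distrib])
    (fun c x η => by
      simp only [mul_smul_comm, ← TensorProduct.smul_tmul', ← Finset.smul_sum])
    (fun x η ζ => by
      simp only [TensorProduct.add_tmul, map_add, add_mul, Finset.sum_add_distrib])
    (fun c x η => by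
      simp only [← TensorProduct.smul_tmul', map_smul, smul_mul_assoc, ← Finset.smul_sum]))

lemma opT_tmul (x : FRT R) (η : Module.Dual k V) : opT R (x ⊗ₜ η) = ∑ i,
    (QHom.gen R R (η ⊗ₜ Module.finBasis k V i) * x) ⊗ₜ[k] (Module.finBasis k V).coord i := rfl

/-- The representation of `A(R) ⊗ A(R)` on `A(R) ⊗ V^*`. -/
def rep (hS : R.Compat S) :
    FRT R ⊗[k] FRT R →ₐ[k] Module.End k (FRT R ⊗[k] Module.Dual k V) :=
  (Module.endTensorEndAlgHom (R := k) (S := k) (A := k)).comp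
    (Algebra.TensorProduct.map (Algebra.lmul k (FRT R)) (mat hS))

lemma rep_tmul (hS : R.Compat S) (a b x : FRT R) (η : Module.Dual k V) :
    rep hS (a ⊗ₜ b) (x ⊗ₜ η) = (a * x) ⊗ₜ mat hS b η := rfl

lemma sum_quad_gen (ξ η : Module.Dual k V) (u : V ⊗[k] V) :
    ∑ i, ∑ j, dualDistrib k V V ((Module.finBasis k V).coord i ⊗ₜ (Module.finBasis k V).coord j) u •
      (QHom.gen R R (ξ ⊗ₜ Module.finBasis k V i) * QHom.gen R R (η ⊗ₜ Module.finBasis k V j)) =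
    quad (QHom.gen R R) ((ξ ⊗ₜ η) ⊗ₜ u) := by
  conv_rhs => rw [← sum_expand u]
  simp only [TensorProduct.tmul_sum, TensorProduct.tmul_smul, map_sum, map_smul, quad_tmul]

lemma sum_gen_quad (β : Module.Dual k V ⊗[k] Module.Dual k V) (v w : V) :
    ∑ i, ∑ j, dualDistrib k V V β (Module.finBasis k V i ⊗ₜ Module.finBasis k V j) •
      (QHom.gen R R ((Module.finBasis k V).coord i ⊗ₜ v) *
        QHom.gen R R ((Module.finBasis k V).coord j ⊗ₜ w)) =
    quad (QHom.gen R R) (β ⊗ₜ (v ⊗ₜ w)) := by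
  conv_rhs => rw [← sum_dual_expand β]
  simp only [TensorProduct.sum_tmul, ← TensorProduct.smul_tmul', map_sum, map_smul, quad_tmul]

lemma sum_apply_smul_gen (ζ : Module.Dual k V) (w : V) :
    ∑ i, ζ (Module.finBasis k V i) • QHom.gen R R ((Module.finBasis k V).coord i ⊗ₜ w) =
      QHom.gen R R (ζ ⊗ₜ w) := by
  conv_rhs => rw [← (Module.finBasis k V).sum_dual_apply_smul_coord ζ]
  simp only [TensorProduct.sum_tmul, ← TensorProduct.smul_tmul', map_sum, map_smul]

lemma sum_repr_smul_gen (ζ : Module.Dual k V) (w : V) :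
    ∑ i, (Module.finBasis k V).repr w i • QHom.gen R R (ζ ⊗ₜ Module.finBasis k V i) =
      QHom.gen R R (ζ ⊗ₜ w) := by
  conv_rhs => rw [← (Module.finBasis k V).sum_repr w]
  simp only [TensorProduct.tmul_sum, TensorProduct.tmul_smul, map_sum, map_smul]

lemma opT_rep (hR : R.Compat R.op) (a : FRT R) :
    opT R * rep hR (TensorProduct.comm k _ _ (comul a)) = rep hR (comul a) * opT R := by
  induction a using QHom.induction with
  | h0 c =>
    rw [Bialgebra.comul_algebraMap, Algebra.TensorProduct.algebraMap_apply,
      TensorProduct.comm_tmul, ← Algebra.TensorProduct.algebraMap_apply',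
      ← Algebra.TensorProduct.algebraMap_apply, AlgHom.commutes]
    exact (Algebra.commutes c _).symm
  | hadd a b ha hb => simp only [map_add, mul_add, add_mul, ha, hb]
  | hmul a b ha hb =>
    have e : TensorProduct.comm k _ _ ((comul a : FRT R ⊗[k] FRT R) * comul b) =
        TensorProduct.comm k _ _ (comul (R := k) a) * TensorProduct.comm k _ _ (comul (R := k) b) :=
      map_mul (Algebra.TensorProduct.comm k (FRT R) (FRT R)) _ _
    rw [Bialgebra.comul_mul, e, map_mul, map_mul, ← mul_assoc, ha, mul_assoc, hb, mul_assoc]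
  | h1 ξ v =>
    refine TensorProduct.ext' fun x η => ?_
    rw [comul_gen]
    simp only [Module.End.mul_apply, map_sum, TensorProduct.comm_tmul, LinearMap.sum_apply,
      rep_tmul, opT_tmul]
    have e1 : ∀ i, ∑ l, QHom.gen R R (mat hR (QHom.gen R R (ξ ⊗ₜ Module.finBasis k V l)) η ⊗ₜ
        Module.finBasis k V i) * QHom.gen R R ((Module.finBasis k V).coord l ⊗ₜ v) =
        quad (QHom.gen R R) (adjointOp R.op (ξ ⊗ₜ η) ⊗ₜ (Module.finBasis k V i ⊗ₜ v)) := by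
      intro i
      rw [← sum_gen_quad, Finset.sum_comm]
      refine Finset.sum_congr rfl fun l _ => ?_
      conv_lhs => rw [← (Module.finBasis k V).sum_dual_apply_smul_coord
        (mat hR (QHom.gen R R (ξ ⊗ₜ Module.finBasis k V l)) η)]
      simp only [TensorProduct.sum_tmul, ← TensorProduct.smul_tmul', map_sum, map_smul,
        Finset.sum_mul, smul_mul_assoc, mat_gen, dualDistrib_adjointOp]
    have e2 : ∀ m, ∑ l, ∑ i, mat hR (QHom.gen R R ((Module.finBasis k V).coord l ⊗ₜ v))
        ((Module.finBasis k V).coord i) (Module.finBasis k V m) •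
        (QHom.gen R R (ξ ⊗ₜ Module.finBasis k V l) * QHom.gen R R (η ⊗ₜ Module.finBasis k V i)) =
        quad (QHom.gen R R) ((ξ ⊗ₜ η) ⊗ₜ R.op (Module.finBasis k V m ⊗ₜ v)) := by
      intro m
      rw [← sum_quad_gen]
      simp only [mat_gen]
    calc _ = ∑ i, (∑ l, QHom.gen R R (mat hR (QHom.gen R R (ξ ⊗ₜ Module.finBasis k V l)) η ⊗ₜ
        Module.finBasis k V i) * QHom.gen R R ((Module.finBasis k V).coord l ⊗ₜ v) * x) ⊗ₜ[k]
          (Module.finBasis k V).coord i := by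
          rw [Finset.sum_comm]
          simp only [TensorProduct.sum_tmul, mul_assoc]
      _ = ∑ m, ((∑ l, ∑ i, mat hR (QHom.gen R R ((Module.finBasis k V).coord l ⊗ₜ v))
        ((Module.finBasis k V).coord i) (Module.finBasis k V m) •
        (QHom.gen R R (ξ ⊗ₜ Module.finBasis k V l) *
          QHom.gen R R (η ⊗ₜ Module.finBasis k V i))) * x) ⊗ₜ[k] (Module.finBasis k V).coord m := by
          refine Finset.sum_congr rfl fun i _ => ?_
          rw [← Finset.sum_mul, e1, e2, QHom.quad_gen_rel]
      _ = _ := by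
          have e3 : ∀ l i, (QHom.gen R R (ξ ⊗ₜ Module.finBasis k V l) *
              (QHom.gen R R (η ⊗ₜ Module.finBasis k V i) * x)) ⊗ₜ[k]
              mat hR (QHom.gen R R ((Module.finBasis k V).coord l ⊗ₜ v))
                ((Module.finBasis k V).coord i) =
              ∑ m, (mat hR (QHom.gen R R ((Module.finBasis k V).coord l ⊗ₜ v))
                ((Module.finBasis k V).coord i) (Module.finBasis k V m) •
                (QHom.gen R R (ξ ⊗ₜ Module.finBasis k V l) *
                (QHom.gen R R (η ⊗ₜ Module.finBasis k V i) * x))) ⊗ₜ[k]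
                (Module.finBasis k V).coord m := by
            intro l i
            conv_lhs => rw [← (Module.finBasis k V).sum_dual_apply_smul_coord
              (mat hR (QHom.gen R R ((Module.finBasis k V).coord l ⊗ₜ v))
                ((Module.finBasis k V).coord i))]
            simp only [TensorProduct.tmul_sum, TensorProduct.tmul_smul,
              ← TensorProduct.smul_tmul']
          simp only [e3, Finset.sum_mul, smul_mul_assoc, mul_assoc, TensorProduct.sum_tmul]
          conv_lhs => enter [2, m]; rw [Finset.sum_comm]
          rw [Finset.sum_comm]
          refine Finset.sum_congr rfl fun i _ => ?_
          rw [Finset.sum_comm]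

/-- Auxiliary algebra homomorphism `b ↦ (a ↦ r(a, b₍₁₎) b₍₂₎)`. -/
def commL (hS : R.Compat S) : FRT R →ₐ[k] WithConv (FRT R →ₗ[k] FRT R) :=
  (convSmulHom.comp (Algebra.TensorProduct.map (formHom hS) (AlgHom.id k (FRT R)))).comp
    (Bialgebra.comulAlgHom k (FRT R))

/-- Auxiliary algebra homomorphism `b ↦ (a ↦ r(a, b₍₂₎) b₍₁₎)`. -/
def commR (hS : R.Compat S) : FRT R →ₐ[k] WithConv (FRT R →ₗ[k] FRT R) :=
  (convSmulHom.comp (Algebra.TensorProduct.map (formHom hS) (AlgHom.id k (FRT R)))).comp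
    ((Algebra.TensorProduct.comm k (FRT R) (FRT R)).toAlgHom.comp
      (Bialgebra.comulAlgHom k (FRT R)))

lemma commL_apply (hS : R.Compat S) (a b : FRT R) : (commL hS b).ofConv a =
    TensorProduct.lid k _ (((form hS ∘ₗ TensorProduct.mk k _ _ a)).rTensor _ (comul b)) := by
  change (convSmulHom (k := k) (A := FRT R) (TensorProduct.map (formHom hS).toLinearMap
    LinearMap.id (comul b))).ofConv a = _
  generalize (comul b : FRT R ⊗[k] FRT R) = s
  induction s using tensor_ind with
  | add x y hx hy => simp only [map_add, WithConv.ofConv_add, LinearMap.add_apply, hx, hy]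
  | tmul x y => simp [convSmulHom_tmul, form_tmul]

lemma commR_apply (hS : R.Compat S) (a b : FRT R) : (commR hS b).ofConv a =
    TensorProduct.rid k _ (((form hS ∘ₗ TensorProduct.mk k _ _ a)).lTensor _ (comul b)) := by
  change (convSmulHom (k := k) (A := FRT R) (TensorProduct.map (formHom hS).toLinearMap
    LinearMap.id (TensorProduct.comm k _ _ (comul b)))).ofConv a = _
  generalize (comul b : FRT R ⊗[k] FRT R) = s
  induction s using tensor_ind with
  | add x y hx hy => simp only [map_add, WithConv.ofConv_add, LinearMap.add_apply, hx, hy]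
  | tmul x y => simp [convSmulHom_tmul, form_tmul]

lemma commL_mul (hR : R.Compat R.op) (b : FRT R) :
    commL hR b * WithConv.toConv LinearMap.id = WithConv.toConv LinearMap.id * commR hR b := by
  induction b using QHom.induction with
  | h0 c => rw [AlgHom.commutes, AlgHom.commutes]; exact Algebra.commutes c _
  | hadd a b ha hb => rw [map_add, map_add, mul_add, add_mul, ha, hb]
  | hmul a b ha hb => rw [map_mul, map_mul, mul_assoc, hb, ← mul_assoc, ha, mul_assoc]
  | h1 η w =>
    refine WithConv.ofConv_injective (LinearMap.ext fun a => ?_)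
    have h := congrArg (fun f => TensorProduct.rid k (FRT R)
      ((Module.Dual.eval k V w).lTensor (FRT R) (f (1 ⊗ₜ η)))) (opT_rep hR a)
    simp only [Module.End.mul_apply] at h
    rw [LinearMap.convMul_apply, LinearMap.convMul_apply]
    have e1 : ∀ s : FRT R ⊗[k] FRT R, LinearMap.mul' k (FRT R) (TensorProduct.map
        (commL hR (QHom.gen R R (η ⊗ₜ w))).ofConv LinearMap.id s) =
        TensorProduct.rid k (FRT R) ((Module.Dual.eval k V w).lTensor (FRT R)
          (opT R (rep hR (TensorProduct.comm k _ _ s) (1 ⊗ₜ η)))) := by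
      intro s
      induction s using tensor_ind with
      | add x y hx hy => simp only [map_add, LinearMap.add_apply, hx, hy]
      | tmul x y =>
        simp only [TensorProduct.map_tmul, commL_apply, comul_gen, TensorProduct.comm_tmul,
          rep_tmul, opT_tmul, map_sum, LinearMap.rTensor_tmul, LinearMap.lTensor_tmul,
          TensorProduct.lid_tmul, TensorProduct.rid_tmul, LinearMap.comp_apply,
          TensorProduct.mk_apply, form_tmul, formHom_gen, LinearMap.mul'_apply, LinearMap.id_apply,
          mul_one, Module.Dual.eval_apply, Module.Basis.coord_apply]
        rw [sum_apply_smul_gen, ← sum_repr_smul_gen _ w, Finset.sum_mul]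
        simp only [smul_mul_assoc]
    have e2 : ∀ s : FRT R ⊗[k] FRT R, LinearMap.mul' k (FRT R) (TensorProduct.map LinearMap.id
        (commR hR (QHom.gen R R (η ⊗ₜ w))).ofConv s) =
        TensorProduct.rid k (FRT R) ((Module.Dual.eval k V w).lTensor (FRT R)
          (rep hR s (opT R (1 ⊗ₜ η)))) := by
      intro s
      induction s using tensor_ind with
      | add x y hx hy => simp only [map_add, LinearMap.add_apply, hx, hy]
      | tmul x y =>
        simp only [TensorProduct.map_tmul, commR_apply, comul_gen,
          rep_tmul, opT_tmul, map_sum, LinearMap.lTensor_tmul,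
          TensorProduct.rid_tmul, LinearMap.comp_apply,
          TensorProduct.mk_apply, form_tmul, formHom_gen, LinearMap.mul'_apply, LinearMap.id_apply,
          mul_one, Module.Dual.eval_apply]
        rw [Finset.mul_sum]
        simp only [mul_smul_comm]
    exact (e1 _).trans (h.trans (e2 _).symm)

lemma form_comm (hR : R.Compat R.op) :
    WithConv.toConv (Algebra.linearMap k (FRT R) ∘ₗ form hR) *
      WithConv.toConv (LinearMap.mul' k (FRT R) ∘ₗ (TensorProduct.comm k _ _).toLinearMap) =
    WithConv.toConv (LinearMap.mul' k (FRT R)) *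
      WithConv.toConv (Algebra.linearMap k (FRT R) ∘ₗ form hR) := by
  refine WithConv.ofConv_injective (TensorProduct.ext' fun a b => ?_)
  have h := LinearMap.congr_fun (congrArg WithConv.ofConv (commL_mul hR b)) a
  rw [LinearMap.convMul_apply, LinearMap.convMul_apply] at h ⊢
  rw [TensorProduct.comul_tmul]
  have e1 : ∀ s : FRT R ⊗[k] FRT R, LinearMap.mul' k (FRT R) (TensorProduct.map
      (Algebra.linearMap k (FRT R) ∘ₗ form hR)
      (LinearMap.mul' k (FRT R) ∘ₗ (TensorProduct.comm k _ _).toLinearMap)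
      (AlgebraTensorModule.tensorTensorTensorComm k k k k (FRT R) (FRT R) (FRT R) (FRT R)
        (s ⊗ₜ comul b))) = LinearMap.mul' k (FRT R) (TensorProduct.map
        (commL hR b).ofConv LinearMap.id s) := by
    intro s
    induction s using tensor_ind with
    | add x y hx hy => simp only [TensorProduct.add_tmul, map_add, hx, hy]
    | tmul x y =>
      rw [TensorProduct.map_tmul, commL_apply]
      generalize (comul b : FRT R ⊗[k] FRT R) = t
      induction t using tensor_ind with
      | add a b ha hb =>
        simp only [TensorProduct.tmul_add, TensorProduct.add_tmul, map_add, ha, hb]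
      | tmul c d => simp [Algebra.algebraMap_eq_smul_one]
  have e2 : ∀ s : FRT R ⊗[k] FRT R, LinearMap.mul' k (FRT R) (TensorProduct.map
      (LinearMap.mul' k (FRT R)) (Algebra.linearMap k (FRT R) ∘ₗ form hR)
      (AlgebraTensorModule.tensorTensorTensorComm k k k k (FRT R) (FRT R) (FRT R) (FRT R)
        (s ⊗ₜ comul b))) = LinearMap.mul' k (FRT R) (TensorProduct.map
        LinearMap.id (commR hR b).ofConv s) := by
    intro s
    induction s using tensor_ind with
    | add x y hx hy => simp only [TensorProduct.add_tmul, map_add, hx, hy]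
    | tmul x y =>
      rw [TensorProduct.map_tmul, commR_apply]
      generalize (comul b : FRT R ⊗[k] FRT R) = t
      induction t using tensor_ind with
      | add a b ha hb => simp only [TensorProduct.tmul_add, map_add, ha, hb]
      | tmul c d => simp [Algebra.algebraMap_eq_smul_one]
  exact (e1 _).trans (h.trans (e2 _).symm)

end FRT

namespace FRT

variable {k : Type u} [Field k] {q : k} {V : Type u} [AddCommGroup V] [Module k V]
  [Module.Finite k V] {R : HeckeSymmetry k q V} {S S' : V ⊗[k] V →ₗ[k] V ⊗[k] V}

/-- The antirepresentation of `A(R)` in `V^*` with `(a ξ)(w) = r(ξ ⊗ w, a)`. -/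
def antiMat (hS : R.Compat S) : FRT R →ₗ[k] Module.End k (Module.Dual k V) :=
  LinearMap.mk₂ k (fun a ξ => (formHom hS a).ofConv ∘ₗ QHom.gen R R ∘ₗ TensorProduct.mk k _ _ ξ)
    (fun a b ξ => by ext; simp) (fun c a ξ => by ext; simp)
    (fun a ξ ξ' => by ext; simp [TensorProduct.add_tmul])
    (fun c a ξ => by ext; simp [← TensorProduct.smul_tmul'])

lemma antiMat_apply (hS : R.Compat S) (a : FRT R) (ξ : Module.Dual k V) (w : V) :
    antiMat hS a ξ w = (formHom hS a).ofConv (QHom.gen R R (ξ ⊗ₜ w)) := rfl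

lemma antiMat_mul (hS : R.Compat S) (a b : FRT R) :
    antiMat hS (a * b) = antiMat hS b * antiMat hS a := by
  ext ξ w
  rw [Module.End.mul_apply, antiMat_apply, map_mul, LinearMap.convMul_apply, comul_gen]
  conv_rhs => rw [← (Module.finBasis k V).sum_dual_apply_smul_coord (antiMat hS a ξ)]
  simp only [map_sum, map_smul, LinearMap.sum_apply, LinearMap.smul_apply, antiMat_apply,
    TensorProduct.map_tmul, LinearMap.mul'_apply, smul_eq_mul]

lemma formHom_one_right (hS : R.Compat S) (b : FRT R) :
    (formHom hS b).ofConv 1 = counit (R := k) b := by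
  induction b using QHom.induction with
  | h0 c => rw [AlgHom.commutes]; simp [LinearMap.convAlgebraMap_apply]
  | h1 η w => rw [formHom_gen, map_one, Module.End.one_apply, counit_gen]
  | hadd a b ha hb => rw [map_add, map_add, WithConv.ofConv_add, LinearMap.add_apply, ha, hb]
  | hmul a b ha hb =>
    rw [map_mul, LinearMap.convMul_apply, Bialgebra.comul_one, Algebra.TensorProduct.one_def,
      TensorProduct.map_tmul, LinearMap.mul'_apply, ha, hb, Bialgebra.counit_mul]

lemma antiMat_one (hS : R.Compat S) : antiMat hS 1 = 1 := by
  ext ξ w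
  rw [antiMat_apply, map_one]
  exact (LinearMap.convOne_apply _).trans (counit_gen ξ w)

lemma inverse_aux (hS : R.Compat S) (hS' : R.Compat S') (h : S ∘ₗ S' = LinearMap.id)
    (a : FRT R) :
    LinearMap.mul' k (Module.End k (Module.Dual k V)) (TensorProduct.comm k _ _
      (TensorProduct.map (mat hS).toLinearMap (antiMat hS') (comul a))) =
      algebraMap k _ (counit (R := k) a) := by
  induction a using QHom.induction with
  | h0 c =>
    rw [Algebra.algebraMap_eq_smul_one]
    simp [Algebra.TensorProduct.one_def, antiMat_one, Algebra.algebraMap_eq_smul_one]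
  | hadd a b ha hb => simp only [map_add, ha, hb]
  | hmul a b ha hb =>
    exact sandwich' _ _ (map_mul (mat hS)) (antiMat_mul hS') ha hb
  | h1 ξ v =>
    ext η w
    rw [comul_gen, counit_gen]
    simp only [map_sum, TensorProduct.map_tmul, LinearMap.mul'_apply, TensorProduct.comm_tmul,
      LinearMap.sum_apply, Module.End.mul_apply,
      antiMat_apply, formHom_gen, mat_gen, AlgHom.toLinearMap_apply]
    have e : ∀ x : V ⊗[k] V, ∑ i, dualDistrib k V V
        (mat hS (QHom.gen R R (ξ ⊗ₜ Module.finBasis k V i)) η ⊗ₜ (Module.finBasis k V).coord i) x =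
        dualDistrib k V V (ξ ⊗ₜ η) (S x) := by
      intro x
      induction x using tensor_ind with
      | add a b ha hb => simp only [map_add, Finset.sum_add_distrib, ha, hb]
      | tmul x y =>
        conv_rhs => rw [← (Module.finBasis k V).sum_repr y]
        simp only [dualDistrib_apply, mat_gen, TensorProduct.tmul_sum, TensorProduct.tmul_smul,
          map_sum, map_smul, Module.Basis.coord_apply, smul_eq_mul]
        exact Finset.sum_congr rfl fun i _ => mul_comm _ _
    have h' : S (S' (v ⊗ₜ w)) = v ⊗ₜ w := LinearMap.congr_fun h _
    rw [e, h', Algebra.algebraMap_eq_smul_one]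
    simp

/-- The map `b ↦ r(b, ?)`. -/
def formLeft (hS : R.Compat S) : FRT R →ₗ[k] WithConv (FRT R →ₗ[k] k) :=
  (WithConv.linearEquiv k _).symm.toLinearMap ∘ₗ TensorProduct.curry (form hS)

lemma inverse_aux' (hS : R.Compat S) (hS' : R.Compat S') (h : S ∘ₗ S' = LinearMap.id)
    (b : FRT R) :
    LinearMap.mul' k (WithConv (FRT R →ₗ[k] k)) (TensorProduct.map
      (formHom hS).toLinearMap (formLeft hS') (comul b)) =
      algebraMap k _ (counit (R := k) b) := by
  have h1 : formLeft hS' 1 = 1 :=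
    WithConv.ofConv_injective (LinearMap.ext fun c => formHom_one_right hS' c)
  induction b using QHom.induction with
  | h0 c =>
    rw [Algebra.algebraMap_eq_smul_one]
    simp [Algebra.TensorProduct.one_def, h1, Algebra.algebraMap_eq_smul_one]
  | hadd a b ha hb => simp only [map_add, ha, hb]
  | hmul a b ha hb =>
    exact sandwich _ _ (fun a b => by simp) (fun a b => form_mul_left hS' a b) ha hb
  | h1 η w =>
    refine WithConv.ofConv_injective (LinearMap.ext fun a => ?_)
    have e := congrArg (fun f => f η w) (inverse_aux hS hS' h a)
    rw [comul_gen, counit_gen]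
    simp only [map_sum, TensorProduct.map_tmul, LinearMap.mul'_apply, WithConv.ofConv_sum,
      LinearMap.sum_apply, AlgHom.toLinearMap_apply, LinearMap.convMul_apply]
    have e1 : ∀ s : FRT R ⊗[k] FRT R, ∑ i, LinearMap.mul' k k (TensorProduct.map
        (formHom hS (QHom.gen R R (η ⊗ₜ Module.finBasis k V i))).ofConv
        (formLeft hS' (QHom.gen R R ((Module.finBasis k V).coord i ⊗ₜ w))).ofConv s) =
        LinearMap.mul' k (Module.End k (Module.Dual k V)) (TensorProduct.comm k _ _
          (TensorProduct.map (mat hS).toLinearMap (antiMat hS') s)) η w := by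
      intro s
      induction s using tensor_ind with
      | add x y hx hy =>
        simp only [map_add, Finset.sum_add_distrib, hx, hy, LinearMap.add_apply]
      | tmul x y =>
        simp only [TensorProduct.map_tmul, LinearMap.mul'_apply, TensorProduct.comm_tmul,
          Module.End.mul_apply, AlgHom.toLinearMap_apply, antiMat_apply,
          formHom_gen]
        rw [← sum_apply_smul_gen, map_sum]
        simp only [map_smul, smul_eq_mul]
        rfl
    rw [e1, e]
    simp [Algebra.algebraMap_eq_smul_one, LinearMap.convAlgebraMap_apply, mul_comm]

lemma form_inverse (hS : R.Compat S) (hS' : R.Compat S') (h : S ∘ₗ S' = LinearMap.id) :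
    WithConv.toConv (form hS) *
      WithConv.toConv (form hS' ∘ₗ (TensorProduct.comm k _ _).toLinearMap) = 1 := by
  refine WithConv.ofConv_injective (TensorProduct.ext' fun a b => ?_)
  have e := LinearMap.congr_fun (congrArg WithConv.ofConv (inverse_aux' hS hS' h b)) a
  rw [LinearMap.convMul_apply, TensorProduct.comul_tmul]
  have e1 : ∀ t : FRT R ⊗[k] FRT R, LinearMap.mul' k k (TensorProduct.map (form hS)
      (form hS' ∘ₗ (TensorProduct.comm k _ _).toLinearMap)
      (AlgebraTensorModule.tensorTensorTensorComm k k k k (FRT R) (FRT R) (FRT R) (FRT R)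
        (comul a ⊗ₜ t))) = (LinearMap.mul' k (WithConv (FRT R →ₗ[k] k)) (TensorProduct.map
      (formHom hS).toLinearMap (formLeft hS') t)).ofConv a := by
    intro t
    induction t using tensor_ind with
    | add x y hx hy =>
      simp only [TensorProduct.tmul_add, map_add, WithConv.ofConv_add, LinearMap.add_apply, hx, hy]
    | tmul x y =>
      rw [TensorProduct.map_tmul, LinearMap.mul'_apply, LinearMap.convMul_apply]
      generalize (comul a : FRT R ⊗[k] FRT R) = s
      induction s using tensor_ind with
      | add a b ha hb => simp only [TensorProduct.add_tmul, map_add, ha, hb]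
      | tmul c d => simp [form_tmul, formLeft]
  refine (e1 _).trans (e.trans ?_)
  simp [Algebra.algebraMap_eq_smul_one, mul_comm]

end FRT

section Inverse

variable {k : Type u} [Field k] {q : k} {V : Type u} [AddCommGroup V] [Module k V]

/-- The inverse operator `R⁻¹ = q⁻¹ (R + (1 - q) id)`. -/
def HeckeSymmetry.opInv (R : HeckeSymmetry k q V) : V ⊗[k] V →ₗ[k] V ⊗[k] V :=
  q⁻¹ • (R.op + (1 - q) • LinearMap.id)

lemma HeckeSymmetry.op_comp_opInv (R : HeckeSymmetry k q V) :
    R.op ∘ₗ R.opInv = LinearMap.id := by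
  refine LinearMap.ext fun x => ?_
  have h := LinearMap.congr_fun R.hecke x
  have h' : R.op (R.op x) + (1 - q) • R.op x = q • x := by
    simp only [LinearMap.comp_apply, LinearMap.add_apply, LinearMap.sub_apply, LinearMap.smul_apply,
      LinearMap.id_apply, map_sub, map_smul, LinearMap.zero_apply] at h
    rw [← sub_eq_zero, ← h]
    module
  simp only [opInv, LinearMap.comp_apply, LinearMap.add_apply, LinearMap.smul_apply,
    LinearMap.id_apply, map_smul, map_add, h', smul_smul, inv_mul_cancel₀ R.q_ne_zero, one_smul]

lemma HeckeSymmetry.opInv_comp_op (R : HeckeSymmetry k q V) :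
    R.opInv ∘ₗ R.op = LinearMap.id := by
  rw [← R.op_comp_opInv, opInv]
  simp only [LinearMap.smul_comp, LinearMap.comp_smul, LinearMap.add_comp, LinearMap.comp_add,
    LinearMap.id_comp, LinearMap.comp_id]

lemma leg12_comp (S T : V ⊗[k] V →ₗ[k] V ⊗[k] V) : leg12 (S ∘ₗ T) = leg12 S ∘ₗ leg12 T := by
  refine LinearMap.ext fun x => ?_
  simp [leg12, LinearMap.rTensor_comp]

lemma leg23_comp (S T : V ⊗[k] V →ₗ[k] V ⊗[k] V) : leg23 (S ∘ₗ T) = leg23 S ∘ₗ leg23 T :=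
  LinearMap.lTensor_comp _ _ _

lemma leg12_id : leg12 (LinearMap.id : V ⊗[k] V →ₗ[k] V ⊗[k] V) = LinearMap.id := by
  refine LinearMap.ext fun x => ?_
  simp [leg12]

lemma leg23_id : leg23 (LinearMap.id : V ⊗[k] V →ₗ[k] V ⊗[k] V) = LinearMap.id :=
  LinearMap.lTensor_id _ _

lemma HeckeSymmetry.compat_op (R : HeckeSymmetry k q V) : R.Compat R.op :=
  ⟨R.braid.symm, R.braid⟩

lemma HeckeSymmetry.compat_opInv (R : HeckeSymmetry k q V) : R.Compat R.opInv := by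
  have a1 : leg12 R.op * leg12 R.opInv = 1 :=
    (leg12_comp _ _).symm.trans ((congrArg leg12 R.op_comp_opInv).trans leg12_id)
  have a2 : leg12 R.opInv * leg12 R.op = 1 :=
    (leg12_comp _ _).symm.trans ((congrArg leg12 R.opInv_comp_op).trans leg12_id)
  have b1 : leg23 R.op * leg23 R.opInv = 1 :=
    (leg23_comp _ _).symm.trans ((congrArg leg23 R.op_comp_opInv).trans leg23_id)
  have b2 : leg23 R.opInv * leg23 R.op = 1 :=
    (leg23_comp _ _).symm.trans ((congrArg leg23 R.opInv_comp_op).trans leg23_id)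
  have c : leg12 R.op * (leg23 R.op * leg12 R.op) = leg23 R.op * (leg12 R.op * leg23 R.op) :=
    R.braid
  have key : ∀ {x y x' y' : Module.End k (V ⊗[k] (V ⊗[k] V))}, x * x' = 1 → x' * x = 1 →
      y * y' = 1 → y' * y = 1 → x * (y * x) = y * (x * y) → y' * (x' * y) = x * (y' * x') := by
    intro x y x' y' h1 h2 h3 h4 h
    calc y' * (x' * y) = y' * (x' * (y * (x * y) * y' * x')) := by
          simp only [mul_assoc]
          rw [← mul_assoc y y' x', h3, one_mul, h1, mul_one]
      _ = x * (y' * x') := by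
          rw [← h]
          simp only [← mul_assoc, h2, h4, one_mul]
  exact ⟨key a1 a2 b1 b2 c, key b1 b2 a1 a2 c.symm⟩

end Inverse

/-- The coquasitriangular structure of the FRT bialgebra `A(R)`, given on generators by
`r(ξ ⊗ v, η ⊗ w) = ⟨ξ ⊗ η, R (w ⊗ v)⟩`. -/
instance {k : Type u} [Field k] {q : k} {V : Type u} [AddCommGroup V] [Module k V]
    [Module.Finite k V] (R : HeckeSymmetry k q V) : Coquasitriangular k (FRT R) where
  r := FRT.form R.compat_op
  rInv := FRT.form R.compat_opInv ∘ₗ (TensorProduct.comm k _ _).toLinearMap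
  r_mul_rInv := FRT.form_inverse _ _ R.op_comp_opInv
  rInv_mul_r := by
    refine WithConv.ofConv_injective (TensorProduct.ext' fun a b => ?_)
    have h := LinearMap.congr_fun (congrArg WithConv.ofConv
      (FRT.form_inverse R.compat_opInv R.compat_op R.opInv_comp_op)) (b ⊗ₜ a)
    have e : (1 : WithConv (FRT R ⊗[k] FRT R →ₗ[k] k)).ofConv (b ⊗ₜ a) =
        (1 : WithConv (FRT R ⊗[k] FRT R →ₗ[k] k)).ofConv (a ⊗ₜ b) := by simp [mul_comm]
    rw [← e, ← h, LinearMap.convMul_apply, LinearMap.convMul_apply, TensorProduct.comul_tmul,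
      TensorProduct.comul_tmul]
    generalize (comul a : FRT R ⊗[k] FRT R) = s
    generalize (comul b : FRT R ⊗[k] FRT R) = t
    induction s using tensor_ind with
    | add x y hx hy => simp only [TensorProduct.add_tmul, TensorProduct.tmul_add, map_add, hx, hy]
    | tmul x y =>
      induction t using tensor_ind with
      | add a b ha hb =>
        simp only [TensorProduct.add_tmul, TensorProduct.tmul_add, map_add, ha, hb]
      | tmul c d => simp
  r_mul_right := FRT.form_mul_right _
  r_mul_left := FRT.form_mul_left _
  r_comm := FRT.form_comm _

section Standard

variable {k : Type u} [Field k] {q : k} {V : Type u} [AddCommGroup V] [Module k V]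
  [Module.Finite k V]

/-- The dual space `V^*` as a left `A(R)`-comodule, with coaction `ξ ↦ ∑ᵢ t(ξ, eᵢ) ⊗ eⁱ`. -/
abbrev FRT.dualComod (R : HeckeSymmetry k q V) : LeftComod k (FRT R) where
  carrier := Module.Dual k V
  coact := ∑ i, (TensorProduct.mk k _ _).flip ((Module.finBasis k V).coord i) ∘ₗ
    QHom.gen R R ∘ₗ (TensorProduct.mk k _ _).flip (Module.finBasis k V i)
  coassoc := by
    refine LinearMap.ext fun ξ => ?_
    simp only [LinearMap.comp_apply, LinearMap.sum_apply, map_sum, LinearMap.flip_apply,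
      TensorProduct.mk_apply, LinearMap.rTensor_tmul, LinearMap.lTensor_tmul, FRT.comul_gen,
      TensorProduct.sum_tmul, TensorProduct.tmul_sum, LinearEquiv.coe_coe,
      TensorProduct.assoc_tmul]
    exact Finset.sum_comm
  counit_coact := by
    refine LinearMap.ext fun ξ => ?_
    simp only [LinearMap.comp_apply, LinearMap.sum_apply, map_sum, LinearMap.flip_apply,
      TensorProduct.mk_apply, LinearMap.rTensor_tmul, FRT.counit_gen, LinearEquiv.coe_coe,
      TensorProduct.lid_tmul]
    exact (Module.finBasis k V).sum_dual_apply_smul_coord ξ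

/-- The space `V` as a right `A(R)`-comodule, with coaction `v ↦ ∑ᵢ eᵢ ⊗ t(eⁱ, v)`. -/
abbrev FRT.stdComod (R : HeckeSymmetry k q V) : RightComod k (FRT R) where
  carrier := V
  coact := ∑ i, TensorProduct.mk k _ _ (Module.finBasis k V i) ∘ₗ
    QHom.gen R R ∘ₗ TensorProduct.mk k _ _ ((Module.finBasis k V).coord i)
  coassoc := by
    refine LinearMap.ext fun v => ?_
    simp only [LinearMap.comp_apply, LinearMap.sum_apply, map_sum,
      TensorProduct.mk_apply, LinearMap.rTensor_tmul, LinearMap.lTensor_tmul, FRT.comul_gen,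
      TensorProduct.sum_tmul, TensorProduct.tmul_sum, LinearEquiv.coe_coe,
      TensorProduct.assoc_tmul]
    exact Finset.sum_comm
  counit_coact := by
    refine LinearMap.ext fun v => ?_
    simp only [LinearMap.comp_apply, LinearMap.sum_apply, map_sum,
      TensorProduct.mk_apply, LinearMap.lTensor_tmul, FRT.counit_gen, LinearEquiv.coe_coe,
      TensorProduct.rid_tmul]
    exact (Module.finBasis k V).sum_repr v

/-- The braiding on the left comodule `V^* ⊗ V^*` is the operator adjoint to `R`. -/
lemma FRT.braiding_dualComod (R : HeckeSymmetry k q V) :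
    (β_ (FRT.dualComod R) (FRT.dualComod R)).hom.lin = adjointOp R.op := by
  refine TensorProduct.ext' fun (ξ η : Module.Dual k V) => ?_
  refine Eq.trans ?_ (sum_dual_expand (adjointOp R.op (ξ ⊗ₜ[k] η)))
  simp only [dualDistrib_adjointOp]
  change LeftComod.braidAux (FRT.dualComod R) (FRT.dualComod R)
    ((FRT.dualComod R).coact ξ ⊗ₜ (FRT.dualComod R).coact η) = _
  simp only [LinearMap.comp_apply, LinearMap.sum_apply, LinearMap.flip_apply,
    TensorProduct.mk_apply, TensorProduct.sum_tmul, TensorProduct.tmul_sum, map_sum]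
  refine Finset.sum_congr rfl fun i _ => Finset.sum_congr rfl fun j _ => ?_
  refine (LeftComod.braidAux_tmul _ _ _ _ _ _).trans (congrArg (· • _) ?_)
  exact (FRT.formHom_gen _ _ _ _).trans (FRT.mat_gen _ _ _ _ _)

/-- The braiding on the right comodule `V ⊗ V` is the operator `R`. -/
lemma FRT.braiding_stdComod (R : HeckeSymmetry k q V) :
    (β_ (FRT.stdComod R) (FRT.stdComod R)).hom.lin = R.op := by
  refine TensorProduct.ext' fun (v w : V) => ?_
  refine Eq.trans ?_ (sum_expand (R.op (v ⊗ₜ[k] w)))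
  change RightComod.braidAux (FRT.stdComod R) (FRT.stdComod R)
    ((FRT.stdComod R).coact v ⊗ₜ (FRT.stdComod R).coact w) = _
  simp only [LinearMap.comp_apply, LinearMap.sum_apply,
    TensorProduct.mk_apply, TensorProduct.sum_tmul, TensorProduct.tmul_sum, map_sum]
  refine Finset.sum_congr rfl fun i _ => Finset.sum_congr rfl fun j _ => ?_
  refine (RightComod.braidAux_tmul _ _ _ _ _ _).trans (congrArg (· • _) ?_)
  exact (FRT.formHom_gen _ _ _ _).trans (FRT.mat_gen _ _ _ _ _)

end Standard

/-- The defining relations of the Hecke algebra of type `A_{n-1}` with parameter `q`. The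
generators `T_1, …, T_{n-1}` are indexed by `Fin (n - 1)`. -/
inductive HeckeAlg.Rel (k : Type u) [Field k] (q : k) (n : ℕ) :
    FreeAlgebra k (Fin (n - 1)) → FreeAlgebra k (Fin (n - 1)) → Prop
  | quadratic (i : Fin (n - 1)) : HeckeAlg.Rel k q n
      ((FreeAlgebra.ι k i + 1) * (FreeAlgebra.ι k i - algebraMap k _ q)) 0
  | braid (i j : Fin (n - 1)) (h : i.val + 1 = j.val) : HeckeAlg.Rel k q n
      (FreeAlgebra.ι k i * FreeAlgebra.ι k j * FreeAlgebra.ι k i)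
      (FreeAlgebra.ι k j * FreeAlgebra.ι k i * FreeAlgebra.ι k j)
  | comm (i j : Fin (n - 1)) (h : i.val + 1 < j.val) : HeckeAlg.Rel k q n
      (FreeAlgebra.ι k i * FreeAlgebra.ι k j) (FreeAlgebra.ι k j * FreeAlgebra.ι k i)

/-- The Hecke algebra `H_n = H_n(q)` of type `A_{n-1}`. -/
abbrev HeckeAlg (k : Type u) [Field k] (q : k) (n : ℕ) : Type u := RingQuot (HeckeAlg.Rel k q n)

section TensorPowers

variable {k : Type u} [Field k] {q : k} {V : Type u} [AddCommGroup V] [Module k V]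

/-- The tensor powers `V^{⊗ n}`, with `V^{⊗ (n + 1)} = V ⊗ V^{⊗ n}`. -/
def tpow (k : Type u) [Field k] (V : Type u) [AddCommGroup V] [Module k V] : ℕ → ModuleCat.{u} k
  | 0 => ModuleCat.of k k
  | n + 1 => ModuleCat.of k (V ⊗[k] tpow k V n)

/-- The operator on `V ⊗ V ⊗ W` that acts by `S` on `V ⊗ V`, as an algebra homomorphism
in `S`. -/
def onFirst (W : Type u) [AddCommGroup W] [Module k W] :
    Module.End k (V ⊗[k] V) →ₐ[k] Module.End k (V ⊗[k] (V ⊗[k] W)) :=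
  ((TensorProduct.assoc k V V W).conjAlgEquiv k).toAlgHom.comp
    (Module.End.rTensorAlgHom k (V ⊗[k] V) W)

/-- The operator on `V^{⊗ n}` that acts by `S` on the tensor factors `i` and `i + 1`, where the
factors are numbered starting from zero. -/
def placeOp (S : Module.End k (V ⊗[k] V)) : (n i : ℕ) → Module.End k (tpow k V n)
  | 0, _ => 1
  | 1, _ => 1
  | n + 2, 0 => onFirst (tpow k V n) S
  | n + 2, i + 1 => (placeOp S (n + 1) i).lTensor V

lemma onFirst_leg (S : Module.End k (V ⊗[k] V)) (W : Type u) [AddCommGroup W] [Module k W] :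
    ∃ φ : Module.End k (V ⊗[k] (V ⊗[k] V)) →ₐ[k] Module.End k (V ⊗[k] (V ⊗[k] (V ⊗[k] W))),
      φ (leg12 S) = onFirst (V ⊗[k] W) S ∧ φ (leg23 S) = (onFirst W S).lTensor V := by
  let e : (V ⊗[k] (V ⊗[k] V)) ⊗[k] W ≃ₗ[k] V ⊗[k] (V ⊗[k] (V ⊗[k] W)) :=
    TensorProduct.assoc k V (V ⊗[k] V) W ≪≫ₗ
      (TensorProduct.assoc k V V W).lTensor V
  have he : ∀ (f : Module.End k (V ⊗[k] (V ⊗[k] V)))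
      (g : Module.End k (V ⊗[k] (V ⊗[k] (V ⊗[k] W)))),
      (∀ a b c w, e (f (a ⊗ₜ (b ⊗ₜ c)) ⊗ₜ w) = g (a ⊗ₜ (b ⊗ₜ (c ⊗ₜ w)))) →
      e.toLinearMap ∘ₗ f.rTensor W ∘ₗ e.symm.toLinearMap = g := by
    intro f g h
    refine TensorProduct.ext' fun a x => ?_
    induction x using tensor_ind with
    | add x y hx hy => simp only [TensorProduct.tmul_add, map_add, hx, hy]
    | tmul b x =>
      induction x using tensor_ind with
      | add x y hx hy => simp only [TensorProduct.tmul_add, map_add, hx, hy]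
      | tmul c w =>
        rw [← h]
        have h' : e.symm (a ⊗ₜ (b ⊗ₜ (c ⊗ₜ w))) = (a ⊗ₜ (b ⊗ₜ c)) ⊗ₜ w :=
          e.symm_apply_eq.2 rfl
        simp only [LinearMap.comp_apply, LinearEquiv.coe_coe, h', LinearMap.rTensor_tmul]
  refine ⟨(e.conjAlgEquiv k).toAlgHom.comp (Module.End.rTensorAlgHom k _ W), he _ _ ?_, he _ _ ?_⟩
  · intro a b c w
    have h1 : leg12 S (a ⊗ₜ (b ⊗ₜ c)) = TensorProduct.assoc k V V V (S (a ⊗ₜ b) ⊗ₜ c) := by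
      simp [leg12]
    have h2 : onFirst (V ⊗[k] W) S (a ⊗ₜ (b ⊗ₜ (c ⊗ₜ w))) =
        TensorProduct.assoc k V V (V ⊗[k] W) (S (a ⊗ₜ b) ⊗ₜ (c ⊗ₜ w)) := rfl
    rw [h1, h2]
    generalize S (a ⊗ₜ[k] b) = y
    induction y using tensor_ind with
    | add x y hx hy => simp only [TensorProduct.add_tmul, map_add, hx, hy]
    | tmul x y => rfl
  · intro a b c w
    have h2 : (onFirst W S).lTensor V (a ⊗ₜ (b ⊗ₜ (c ⊗ₜ w))) =
        a ⊗ₜ TensorProduct.assoc k V V W (S (b ⊗ₜ c) ⊗ₜ w) := rfl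
    rw [h2, leg23, LinearMap.lTensor_tmul]
    rfl

lemma onFirst_lTensor (S : Module.End k (V ⊗[k] V)) {W : Type u} [AddCommGroup W] [Module k W]
    (f : Module.End k W) : onFirst W S * (f.lTensor V).lTensor V =
      (f.lTensor V).lTensor V * onFirst W S := by
  refine TensorProduct.ext' fun a x => ?_
  induction x using tensor_ind with
  | add x y hx hy => simp only [TensorProduct.tmul_add, map_add, hx, hy]
  | tmul b w =>
    change TensorProduct.assoc k V V W (S (a ⊗ₜ b) ⊗ₜ f w) =
      (f.lTensor V).lTensor V (TensorProduct.assoc k V V W (S (a ⊗ₜ b) ⊗ₜ w))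
    generalize S (a ⊗ₜ[k] b) = y
    induction y using tensor_ind with
    | add x y hx hy => simp only [TensorProduct.add_tmul, map_add, hx, hy]
    | tmul x y => rfl

lemma placeOp_quadratic (R : HeckeSymmetry k q V) (n i : ℕ) (h : i + 1 < n) :
    (placeOp R.op n i + 1) * (placeOp R.op n i - algebraMap k _ q) = 0 := by
  induction n, i using placeOp.induct with
  | case1 => omega
  | case2 => omega
  | case3 n =>
    have e : (R.op + 1) * (R.op - algebraMap k (Module.End k (V ⊗[k] V)) q) = 0 := R.hecke
    have e' := congrArg (onFirst (V := V) (tpow k V n)) e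
    rw [map_mul, map_add, map_sub, map_one, map_zero, AlgHom.commutes] at e'
    exact e'
  | case4 n i ih =>
    have e' := congrArg (Module.End.lTensorAlgHom k (tpow k V (n + 1)) V) (ih (by omega))
    rw [map_mul, map_add, map_sub, map_one, map_zero, AlgHom.commutes] at e'
    exact e'

lemma placeOp_braid (R : HeckeSymmetry k q V) (n i : ℕ) (h : i + 2 < n) :
    placeOp R.op n i * placeOp R.op n (i + 1) * placeOp R.op n i =
      placeOp R.op n (i + 1) * placeOp R.op n i * placeOp R.op n (i + 1) := by
  induction n, i using placeOp.induct with
  | case1 => omega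
  | case2 => omega
  | case3 n =>
    obtain ⟨m, rfl⟩ : ∃ m, n = m + 1 := ⟨n - 1, by omega⟩
    obtain ⟨φ, h1, h2⟩ := onFirst_leg R.op (tpow k V m)
    have e := congrArg φ (show leg12 R.op * leg23 R.op * leg12 R.op =
      leg23 R.op * leg12 R.op * leg23 R.op from R.braid)
    rw [map_mul, map_mul, map_mul, map_mul, h1, h2] at e
    exact e
  | case4 n i ih =>
    have e' := congrArg (Module.End.lTensorAlgHom k (tpow k V (n + 1)) V) (ih (by omega))
    rw [map_mul, map_mul, map_mul, map_mul] at e'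
    exact e'

lemma placeOp_comm (S : Module.End k (V ⊗[k] V)) (n i j : ℕ) (h : i + 1 < j) (hj : j + 1 < n) :
    placeOp S n i * placeOp S n j = placeOp S n j * placeOp S n i := by
  induction n, i using placeOp.induct generalizing j with
  | case1 => omega
  | case2 => omega
  | case3 n =>
    obtain ⟨m, rfl⟩ : ∃ m, n = m + 2 := ⟨n - 2, by omega⟩
    obtain ⟨l, rfl⟩ : ∃ l, j = l + 2 := ⟨j - 2, by omega⟩
    exact onFirst_lTensor S (placeOp S (m + 2) l)
  | case4 n i ih =>
    obtain ⟨l, rfl⟩ : ∃ l, j = l + 1 := ⟨j - 1, by omega⟩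
    have e' := congrArg (Module.End.lTensorAlgHom k (tpow k V (n + 1)) V)
      (ih l (by omega) (by omega))
    rw [map_mul, map_mul] at e'
    exact e'

/-- The representation of `H_n` in `V^{⊗ n}` in which `T_i` acts by `R` on the tensor factors
`i` and `i + 1`. -/
def HeckeSymmetry.heckeRep (R : HeckeSymmetry k q V) (n : ℕ) :
    HeckeAlg k q n →ₐ[k] Module.End k (tpow k V n) :=
  RingQuot.liftAlgHom k ⟨FreeAlgebra.lift k fun i : Fin (n - 1) => placeOp R.op n i, by
    rintro _ _ (i | ⟨i, j, h⟩ | ⟨i, j, h⟩)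
    · simpa using placeOp_quadratic R n i (by omega)
    · simpa [h] using placeOp_braid R n i (by omega)
    · simpa using placeOp_comm R.op n i j h (by omega)⟩

/-- The vector space `T_n(V) = V^{⊗ n}` regarded as an `H_n`-module. -/
def HeckeSymmetry.T (_R : HeckeSymmetry k q V) (n : ℕ) : Type u := tpow k V n

instance (R : HeckeSymmetry k q V) (n : ℕ) : AddCommGroup (R.T n) :=
  inferInstanceAs (AddCommGroup (tpow k V n))

instance (R : HeckeSymmetry k q V) (n : ℕ) : Module (HeckeAlg k q n) (R.T n) :=
  letI : Module (HeckeAlg k q n) (tpow k V n) :=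
    Module.compHom (tpow k V n) (R.heckeRep n).toRingHom
  inferInstanceAs (Module (HeckeAlg k q n) (tpow k V n))

end TensorPowers

/-- A module is indecomposable if it is nonzero and is not a direct sum of two nonzero
submodules. -/
def IsIndecomposable (H M : Type u) [Ring H] [AddCommGroup M] [Module H M] : Prop :=
  Nontrivial M ∧ ∀ p q : Submodule H M, IsCompl p q → p = ⊥ ∨ q = ⊥

/-- `M` is isomorphic to a direct summand of `N`. -/
def IsDirectSummandOf (H M N : Type u) [Ring H] [AddCommGroup M] [Module H M] [AddCommGroup N]
    [Module H N] : Prop :=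
  ∃ p q : Submodule H N, IsCompl p q ∧ Nonempty (M ≃ₗ[H] p)

section Inclusions

variable {k : Type u} [Field k] {q : k} {V V' : Type u} [AddCommGroup V] [Module k V]
  [Module.Finite k V] [AddCommGroup V'] [Module k V'] [Module.Finite k V']

/-- The functor `A(R', R) □_{A(R)} ?` from left `A(R)`-comodules to left `A(R')`-comodules. -/
def QHom.cotensorLeft (R' : HeckeSymmetry k q V') (R : HeckeSymmetry k q V) :
    LeftComod k (FRT R) ⥤ LeftComod k (FRT R') :=
  (QHom.bicomod R' R).cotensorFunctor

/-- The functor `? □_{A(R)} A(R, R')` from right `A(R)`-comodules to right `A(R')`-comodules. -/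
def QHom.cotensorRight (R : HeckeSymmetry k q V) (R' : HeckeSymmetry k q V') :
    RightComod k (FRT R) ⥤ RightComod k (FRT R') :=
  (QHom.bicomod R R').cotensorFunctorRight

/-- The inclusion of `A(R', R) □_{A(R)} X` in `A(R', R) ⊗ X`. -/
def QHom.inclLeft (R' : HeckeSymmetry k q V') (R : HeckeSymmetry k q V) (X : LeftComod k (FRT R)) :
    (QHom.cotensorLeft R' R).obj X →ₗ[k] QHom R' R ⊗[k] X :=
  (cotensor (QHom.bicomod R' R).right X).subtype

/-- The inclusion of `X □_{A(R)} A(R, R')` in `X ⊗ A(R, R')`. -/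
def QHom.inclRight (R : HeckeSymmetry k q V) (R' : HeckeSymmetry k q V')
    (X : RightComod k (FRT R)) :
    (QHom.cotensorRight R R').obj X →ₗ[k] X ⊗[k] QHom R R' :=
  (cotensor X (QHom.bicomod R R').left).subtype

end Inclusions

end

/-!
Write `F = A(R', R) □ ?` and `G = A(R, R') □ ?` for the two cotensor product functors between left
comodules. The comultiplication `A(R) → A(R, R') ⊗ A(R', R)` induces a natural map `X → G (F X)`
(`QHom.unitL`), and everything rests on its bijectivity; by symmetry `F` and `G` are then inverse to
each other. For bijectivity it is enough to have a linear form `θ` on `A(R, R') ⊗ A(R', R)` with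
`θ ∘ Δ = ε` on `A(R)` (`QHom.exists_form`, `QHom.unitL_bijective`): `θ` then yields an explicit
inverse. Over a field, `θ` exists if and only if `ε` vanishes on the kernel of `Δ`.

This is where the modules over the Hecke algebras enter. An element of `V'^* ⊗ V` turns an
`H_{n+1}`-linear map `V^{⊗ (n+1)} → V'^{⊗ (n+1)}` into an `H_n`-linear map `V^{⊗ n} → V'^{⊗ n}` by
contraction of the first tensor factors. The defining relations of `A(R', R)` hold for these
operations, since the maps commute with the action of `T_1`. So `A(R', R)` acts on
sequences of `H_n`-linear maps (`QHom.seqRep`), and evaluation in degree zero assigns to each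
sequence a linear form on `A(R', R)`. This action transforms composition of maps into `Δ`
(`QHom.seqActComp_comulHom`), and identity maps give the counit. Hence, if for each `n` the identity
of `V^{⊗ n}` is a sum of `H_n`-linear composites `V^{⊗ n} → V'^{⊗ n} → V^{⊗ n}`, then the counit
vanishes on `ker Δ` (`QHom.counitHom_eq_zero`). Such a decomposition of the identity is obtained for
`n > 1` by splitting the finite-dimensional module `V^{⊗ n}` into indecomposable summands, each of
which is a summand of `V'^{⊗ n}` by assumption (`proj_mem_closure`). It is trivial for `n = 0`, and
for `n = 1` one needs only that `V' = 0` implies `V = 0`, which follows from the case `n = 2`.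

Multiplication makes `F` and `G` lax monoidal, and the map `X → G (F X)` is monoidal. Therefore the
composite of the structure map of `G` and the image under `G` of that of `F` is invertible, and as
this is so in both orders, the structure maps themselves are invertible (`QHom.isIso_tensoratorL`).

The functor is braided by the relation `r'(a₍₋₁₎, b₍₋₁₎) b₍₀₎ a₍₀₎ = a₍₀₎ b₍₀₎ r(a₍₁₎, b₍₁₎)` in
`A(R', R)` (`QHom.conv_formSmul`). It is multiplicative in `a` and in `b`, and for generators it is
the defining relation of `A(R', R)`.

Right comodules are treated in the same way, with the same form `θ` and the same relation for
`A(R, R')`.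
-/

noncomputable section

/-! ### Contraction of homomorphisms of Hecke modules -/

section Functionals

variable {k : Type u} [Field k] {q : k}
  {V V' V'' : Type u} [AddCommGroup V] [Module k V]
  [AddCommGroup V'] [Module k V'] [AddCommGroup V''] [Module k V'']

/-- The pairing of `ξ ∈ V'^*` with the first factor of `V' ⊗ W`. -/
def contractFst (W' : Type u) [AddCommGroup W'] [Module k W'] :
    Module.Dual k V' →ₗ[k] V' ⊗[k] W' →ₗ[k] W' :=
  LinearMap.compRight k (TensorProduct.lid k W').toLinearMap ∘ₗ LinearMap.rTensorHom W'

@[simp] lemma contractFst_tmul {W' : Type u} [AddCommGroup W'] [Module k W']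
    (ξ : Module.Dual k V') (v : V') (w : W') : contractFst W' ξ (v ⊗ₜ w) = ξ v • w := rfl

/-- For `x = ξ ⊗ v` and `f : V ⊗ W → V' ⊗ W'`, the map `w ↦ (ξ ⊗ id) (f (v ⊗ w))`. -/
def contract (W W' : Type u) [AddCommGroup W] [Module k W] [AddCommGroup W'] [Module k W'] :
    Module.Dual k V' ⊗[k] V →ₗ[k] (V ⊗[k] W →ₗ[k] V' ⊗[k] W') →ₗ[k] (W →ₗ[k] W') :=
  TensorProduct.lift (LinearMap.mk₂ k
    (fun ξ v => LinearMap.compRight k (contractFst W' ξ) ∘ₗ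
      LinearMap.lcomp k (V' ⊗[k] W') (TensorProduct.mk k V W v))
    (fun ξ η v => by ext; simp) (fun c ξ v => by ext; simp)
    (fun ξ v w => by ext; simp) (fun c ξ v => by ext; simp))

/-- The contraction of linear maps `V^{⊗ (n + 1)} → V'^{⊗ (n + 1)}`. -/
def contractPow (n : ℕ) : Module.Dual k V' ⊗[k] V →ₗ[k]
    (tpow k V (n + 1) →ₗ[k] tpow k V' (n + 1)) →ₗ[k] (tpow k V n →ₗ[k] tpow k V' n) :=
  contract (tpow k V n) (tpow k V' n)

/-- The space of linear maps `V^{⊗ n} → V'^{⊗ n}` that commute with the operators at all places,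
i.e. of `H_n`-linear maps. -/
def intertwiners (R : HeckeSymmetry k q V) (R' : HeckeSymmetry k q V') (n : ℕ) :
    Submodule k (tpow k V n →ₗ[k] tpow k V' n) where
  carrier := {f | ∀ i, i + 1 < n → f ∘ₗ placeOp R.op n i = placeOp R'.op n i ∘ₗ f}
  add_mem' {f g} hf hg i hi := by rw [LinearMap.add_comp, LinearMap.comp_add, hf i hi, hg i hi]
  zero_mem' i hi := by rw [LinearMap.zero_comp, LinearMap.comp_zero]
  smul_mem' c f hf i hi := by rw [LinearMap.smul_comp, LinearMap.comp_smul, hf i hi]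

/-- Sequences of `H_n`-linear maps `V^{⊗ n} → V'^{⊗ n}`. -/
abbrev IntSeq (R : HeckeSymmetry k q V) (R' : HeckeSymmetry k q V') : Type u :=
  ∀ n, intertwiners R R' n

lemma contract_mem (R : HeckeSymmetry k q V) (R' : HeckeSymmetry k q V') (n : ℕ)
    (x : Module.Dual k V' ⊗[k] V) (f : tpow k V (n + 1) →ₗ[k] tpow k V' (n + 1))
    (hf : f ∈ intertwiners R R' (n + 1)) :
    contractPow n x f ∈ intertwiners R R' n := by
  induction x using tensor_ind with
  | add a b ha hb => rw [map_add, LinearMap.add_apply]; exact add_mem ha hb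
  | tmul ξ v =>
    intro i hi
    obtain ⟨m, rfl⟩ : ∃ m, n = m + 1 := ⟨n - 1, by omega⟩
    refine LinearMap.ext fun t => ?_
    have h := LinearMap.congr_fun (hf (i + 1) (by omega)) (v ⊗ₜ[k] t)
    have e : ∀ y : V' ⊗[k] tpow k V' (m + 1), contractFst (tpow k V' (m + 1)) ξ
        ((placeOp R'.op (m + 1) i).lTensor V' y) =
        placeOp R'.op (m + 1) i (contractFst (tpow k V' (m + 1)) ξ y) := by
      intro y
      induction y using tensor_ind with
      | add a b ha hb => simp only [map_add, ha, hb]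
      | tmul a b => simp
    exact (congrArg (contractFst (tpow k V' (m + 1)) ξ) h).trans (e _)

/-- The contraction by an element of `V'^* ⊗ V`, which lowers the degree of a sequence by one. -/
def contractSeq (R : HeckeSymmetry k q V) (R' : HeckeSymmetry k q V') :
    Module.Dual k V' ⊗[k] V →ₗ[k] Module.End k (IntSeq R R') :=
  LinearMap.mk₂ k
    (fun x F n => ⟨contractPow n x (F (n + 1)).1,
      contract_mem R R' n x _ (F (n + 1)).2⟩)
    (fun x y F => by
      ext n : 2
      exact congrArg (fun f => f (F (n + 1)).1) (map_add (contractPow n) x y))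
    (fun c x F => by
      ext n : 2
      exact congrArg (fun f => f (F (n + 1)).1) (map_smul (contractPow n) c x))
    (fun x F G => by ext n : 2; exact map_add (contractPow n x) _ _)
    (fun c x F => by ext n : 2; exact map_smul (contractPow n x) c _)

lemma contractSeq_apply (R : HeckeSymmetry k q V) (R' : HeckeSymmetry k q V')
    (x : Module.Dual k V' ⊗[k] V) (F : IntSeq R R') (n : ℕ) :
    (contractSeq R R' x F n).1 = contractPow n x (F (n + 1)).1 := rfl

/-- The contraction as a map into the opposite of the algebra of operators. -/
def contractSeqOp (R : HeckeSymmetry k q V) (R' : HeckeSymmetry k q V') :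
    Module.Dual k V' ⊗[k] V →ₗ[k] (Module.End k (IntSeq R R'))ᵐᵒᵖ :=
  (MulOpposite.opLinearEquiv k).toLinearMap ∘ₗ contractSeq R R'

/-- The pairing of `β ∈ V'^* ⊗ V'^*` with the first two factors of `V' ⊗ V' ⊗ W`. -/
def contractTwo (W' : Type u) [AddCommGroup W'] [Module k W']
    (β : Module.Dual k V' ⊗[k] Module.Dual k V') : V' ⊗[k] (V' ⊗[k] W') →ₗ[k] W' :=
  (TensorProduct.lid k W').toLinearMap ∘ₗ (dualDistrib k V' V' β).rTensor W' ∘ₗ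
    (TensorProduct.assoc k V' V' W').symm.toLinearMap

lemma contractTwo_add (W' : Type u) [AddCommGroup W'] [Module k W']
    (β γ : Module.Dual k V' ⊗[k] Module.Dual k V') (y : V' ⊗[k] (V' ⊗[k] W')) :
    contractTwo W' (β + γ) y = contractTwo W' β y + contractTwo W' γ y := by
  simp [contractTwo, LinearMap.rTensor_add]

lemma contractTwo_onFirst [Module.Finite k V'] (W' : Type u) [AddCommGroup W'] [Module k W']
    (S : V' ⊗[k] V' →ₗ[k] V' ⊗[k] V') (β : Module.Dual k V' ⊗[k] Module.Dual k V')
    (y : V' ⊗[k] (V' ⊗[k] W')) :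
    contractTwo W' β (onFirst W' S y) = contractTwo W' (adjointOp S β) y := by
  obtain ⟨y, rfl⟩ := (TensorProduct.assoc k V' V' W').surjective y
  induction y using tensor_ind with
  | add a b ha hb => simp only [map_add, ha, hb]
  | tmul u w =>
    have e : onFirst W' S (TensorProduct.assoc k V' V' W' (u ⊗ₜ w)) =
        TensorProduct.assoc k V' V' W' (S u ⊗ₜ w) := by
      change TensorProduct.assoc k V' V' W' (S.rTensor W' ((TensorProduct.assoc k V' V' W').symm
        (TensorProduct.assoc k V' V' W' (u ⊗ₜ w)))) = _
      rw [LinearEquiv.symm_apply_apply]; rfl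
    rw [e]
    simp [contractTwo, dualDistrib_adjointOp]

lemma quad_contractSeqOp [Module.Finite k V] [Module.Finite k V'] (R : HeckeSymmetry k q V)
    (R' : HeckeSymmetry k q V')
    (β : Module.Dual k V' ⊗[k] Module.Dual k V') (u : V ⊗[k] V) (F : IntSeq R R') (n : ℕ)
    (t : tpow k V n) :
    ((quad (B := (Module.End k (IntSeq R R'))ᵐᵒᵖ) (contractSeqOp R R') (β ⊗ₜ u)).unop F n).1 t =
      contractTwo (tpow k V' n) β ((F (n + 2)).1
        (TensorProduct.assoc k V V (tpow k V n) (u ⊗ₜ t))) := by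
  induction β using tensor_ind with
  | add a b ha hb =>
    rw [TensorProduct.add_tmul, map_add, MulOpposite.unop_add, LinearMap.add_apply, Pi.add_apply,
      Submodule.coe_add, LinearMap.add_apply, ha, hb]
    exact (contractTwo_add (tpow k V' n) a b _).symm
  | tmul ξ η =>
    induction u using tensor_ind with
    | add a b ha hb =>
      rw [TensorProduct.tmul_add, map_add, MulOpposite.unop_add, LinearMap.add_apply, Pi.add_apply,
        Submodule.coe_add, LinearMap.add_apply, ha, hb]
      rw [TensorProduct.add_tmul, map_add]
      exact (((contractTwo (tpow k V' n) (ξ ⊗ₜ η)) ∘ₗ (F (n + 2)).1).map_add _ _).symm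
    | tmul v w =>
      rw [quad_tmul]
      change contractFst (tpow k V' n) η (contractFst (V' ⊗[k] tpow k V' n) ξ
        ((F (n + 2)).1 (v ⊗ₜ (w ⊗ₜ t)))) = contractTwo (tpow k V' n) (ξ ⊗ₜ η)
        ((F (n + 2)).1 (v ⊗ₜ (w ⊗ₜ t)))
      generalize (F (n + 2)).1 (v ⊗ₜ (w ⊗ₜ t)) = y
      change V' ⊗[k] (V' ⊗[k] tpow k V' n) at y
      induction y using tensor_ind with
      | add a b ha hb => simp only [map_add, ha, hb]
      | tmul a y =>
        induction y using tensor_ind with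
        | add a b ha hb => simp only [TensorProduct.tmul_add, map_add, ha, hb]
        | tmul b y => simp [contractTwo, mul_smul]

variable [Module.Finite k V] [Module.Finite k V'] [Module.Finite k V'']

namespace QHom

/-- The algebra `A(R', R)` acts from the right on sequences of `H_n`-linear maps
`V^{⊗ n} → V'^{⊗ n}`, where the generator `ξ ⊗ v` acts by contraction. -/
def seqRep (R' : HeckeSymmetry k q V') (R : HeckeSymmetry k q V) :
    QHom R' R →ₐ[k] (Module.End k (IntSeq R R'))ᵐᵒᵖ :=
  lift R' R (B := (Module.End k (IntSeq R R'))ᵐᵒᵖ) (contractSeqOp R R') fun β u => by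
    refine MulOpposite.unop_injective (LinearMap.ext fun F => ?_)
    ext n : 2
    refine LinearMap.ext fun t => ?_
    rw [quad_contractSeqOp, quad_contractSeqOp]
    refine Eq.trans ?_ (contractTwo_onFirst (tpow k V' n) R'.op β _)
    refine congrArg (contractTwo (tpow k V' n) β) ?_
    have h := LinearMap.congr_fun ((F (n + 2)).2 0 (by omega))
      (TensorProduct.assoc k V V (tpow k V n) (u ⊗ₜ t))
    refine Eq.trans (congrArg (F (n + 2)).1 ?_) h
    change _ = TensorProduct.assoc k V V (tpow k V n) (R.op.rTensor (tpow k V n)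
      ((TensorProduct.assoc k V V (tpow k V n)).symm
        (TensorProduct.assoc k V V (tpow k V n) (u ⊗ₜ t))))
    rw [LinearEquiv.symm_apply_apply]; rfl

/-- The map `a ↦ F a` for the right action of `A(R', R)` on a sequence `F`. -/
def seqAct {R' : HeckeSymmetry k q V'} {R : HeckeSymmetry k q V} (F : IntSeq R R') :
    QHom R' R →ₗ[k] IntSeq R R' :=
  LinearMap.applyₗ F ∘ₗ (MulOpposite.opLinearEquiv k).symm.toLinearMap ∘ₗ
    (seqRep R' R).toLinearMap

variable {R : HeckeSymmetry k q V} {R' : HeckeSymmetry k q V'} {R'' : HeckeSymmetry k q V''}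

lemma seqAct_algebraMap (F : IntSeq R R') (c : k) : seqAct F (algebraMap k _ c) = c • F := by
  change ((seqRep R' R) (algebraMap k _ c)).unop F = _
  rw [AlgHom.commutes]; rfl

lemma seqAct_add_left (F G : IntSeq R R') (a : QHom R' R) :
    seqAct (F + G) a = seqAct F a + seqAct G a := map_add (seqRep R' R a).unop F G

lemma seqAct_smul_left (c : k) (F : IntSeq R R') (a : QHom R' R) :
    seqAct (c • F) a = c • seqAct F a := map_smul (seqRep R' R a).unop c F

lemma seqAct_mul (F : IntSeq R R') (a b : QHom R' R) :
    seqAct F (a * b) = seqAct (seqAct F a) b := by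
  change ((seqRep R' R) (a * b)).unop F = _
  rw [map_mul]; rfl

lemma seqAct_gen (F : IntSeq R R') (x : Module.Dual k V' ⊗[k] V) :
    seqAct F (gen R' R x) = contractSeq R R' x F := by
  change ((seqRep R' R) (gen R' R x)).unop F = _
  rw [seqRep, lift_gen]; rfl

end QHom
end Functionals

/-! ### Linear forms on `A(R', R)` given by homomorphisms of Hecke modules -/

section SeqComp

variable {k : Type u} [Field k] {q : k}
  {V V' V'' : Type u} [AddCommGroup V] [Module k V]
  [AddCommGroup V'] [Module k V'] [AddCommGroup V''] [Module k V'']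
  {R : HeckeSymmetry k q V} {R' : HeckeSymmetry k q V'} {R'' : HeckeSymmetry k q V''}

lemma intertwiners.comp_mem {n : ℕ} {f : tpow k V n →ₗ[k] tpow k V' n}
    {g : tpow k V'' n →ₗ[k] tpow k V n} (hf : f ∈ intertwiners R R' n)
    (hg : g ∈ intertwiners R'' R n) : f ∘ₗ g ∈ intertwiners R'' R' n := by
  intro i hi
  rw [LinearMap.comp_assoc, hg i hi, ← LinearMap.comp_assoc, hf i hi, LinearMap.comp_assoc]

/-- Termwise composition of sequences. -/
def IntSeq.comp : IntSeq R R' →ₗ[k] IntSeq R'' R →ₗ[k] IntSeq R'' R' :=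
  LinearMap.mk₂ k (fun F G n => ⟨(F n).1 ∘ₗ (G n).1, intertwiners.comp_mem (F n).2 (G n).2⟩)
    (fun F F' G => by ext n : 2; exact LinearMap.add_comp _ _ _)
    (fun c F G => by ext n : 2; exact LinearMap.smul_comp _ _ _)
    (fun F G G' => by ext n : 2; exact LinearMap.comp_add _ _ _)
    (fun c F G => by ext n : 2; exact LinearMap.comp_smul _ _ _)

lemma IntSeq.comp_apply (F : IntSeq R R') (G : IntSeq R'' R) (n : ℕ) :
    (IntSeq.comp F G n).1 = (F n).1 ∘ₗ (G n).1 := rfl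

variable (R) in
/-- The sequence of identity maps. -/
def IntSeq.one : IntSeq R R := fun _ => ⟨LinearMap.id, fun _ _ => rfl⟩

/-- The sequence with `f` in degree `n` and zero in all other degrees. -/
def IntSeq.single (n : ℕ) : intertwiners R R' n →ₗ[k] IntSeq R R' :=
  LinearMap.single k (fun n => intertwiners R R' n) n

lemma IntSeq.single_comp (n : ℕ) (f : intertwiners R R' n) (g : intertwiners R'' R n) :
    IntSeq.single n ⟨f.1 ∘ₗ g.1, intertwiners.comp_mem f.2 g.2⟩ =
      IntSeq.comp (IntSeq.single n f) (IntSeq.single n g) := by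
  ext m : 2
  rw [IntSeq.comp_apply]
  by_cases h : m = n
  · subst h; simp [IntSeq.single]
  · simp [IntSeq.single, h]

/-- Evaluation of the degree zero component, an operator on `k`. -/
def IntSeq.eval : IntSeq R R' →ₗ[k] k where
  toFun F := (F 0).1 (1 : k)
  map_add' _ _ := rfl
  map_smul' _ _ := rfl

variable [Module.Finite k V]

namespace QHom

lemma contractSeq_comp (F : IntSeq R R') (G : IntSeq R'' R) (ξ : Module.Dual k V') (w : V'') :
    ∑ i, IntSeq.comp (contractSeq R R' (ξ ⊗ₜ Module.finBasis k V i) F)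
      (contractSeq R'' R ((Module.finBasis k V).coord i ⊗ₜ w) G) =
    contractSeq R'' R' (ξ ⊗ₜ w) (IntSeq.comp F G) := by
  ext n : 2
  rw [Finset.sum_apply, AddSubmonoidClass.coe_finsetSum]
  refine LinearMap.ext fun t => ?_
  rw [LinearMap.sum_apply]
  change ∑ i, contractFst (tpow k V' n) ξ ((F (n + 1)).1 (Module.finBasis k V i ⊗ₜ
    contractFst (tpow k V n) ((Module.finBasis k V).coord i) ((G (n + 1)).1 (w ⊗ₜ t)))) =
    contractFst (tpow k V' n) ξ ((F (n + 1)).1 ((G (n + 1)).1 (w ⊗ₜ t)))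
  have e : ∀ y : V ⊗[k] tpow k V n, ∑ i, Module.finBasis k V i ⊗ₜ[k]
      contractFst (tpow k V n) ((Module.finBasis k V).coord i) y = y := by
    intro y
    induction y using tensor_ind with
    | add a b ha hb => simp only [map_add, TensorProduct.tmul_add, Finset.sum_add_distrib, ha, hb]
    | tmul v y =>
      conv_rhs => rw [← (Module.finBasis k V).sum_repr v]
      rw [TensorProduct.sum_tmul]
      exact Finset.sum_congr rfl fun i _ => (TensorProduct.smul_tmul _ _ _).symm
  conv_rhs => rw [← e ((G (n + 1)).1 (w ⊗ₜ t))]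
  exact (map_sum (contractFst (tpow k V' n) ξ ∘ₗ (F (n + 1)).1) _ _).symm

variable [Module.Finite k V'] [Module.Finite k V'']

/-- The map `a ⊗ b ↦ (F a) ∘ (G b)`. -/
def seqActComp (F : IntSeq R R') (G : IntSeq R'' R) :
    QHom R' R ⊗[k] QHom R R'' →ₗ[k] IntSeq R'' R' :=
  TensorProduct.lift (IntSeq.comp.compl₁₂ (seqAct F) (seqAct G))

lemma seqActComp_tmul (F : IntSeq R R') (G : IntSeq R'' R) (a : QHom R' R) (b : QHom R R'') :
    seqActComp F G (a ⊗ₜ b) = IntSeq.comp (seqAct F a) (seqAct G b) := rfl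

lemma seqActComp_mul (F : IntSeq R R') (G : IntSeq R'' R) (a : QHom R' R) (b : QHom R R'')
    (t : QHom R' R ⊗[k] QHom R R'') :
    seqActComp F G (a ⊗ₜ b * t) = seqActComp (seqAct F a) (seqAct G b) t := by
  induction t using tensor_ind with
  | add x y hx hy => simp only [mul_add, map_add, hx, hy]
  | tmul x y => rw [Algebra.TensorProduct.tmul_mul_tmul, seqActComp_tmul, seqActComp_tmul,
      seqAct_mul, seqAct_mul]

/-- The right action on composite sequences is given by the comultiplication. -/
lemma seqActComp_comulHom (a : QHom R' R'') (F : IntSeq R R') (G : IntSeq R'' R) :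
    seqActComp F G (comulHom R' R R'' a) = seqAct (IntSeq.comp F G) a := by
  induction a using QHom.induction generalizing F G with
  | h0 c =>
    rw [AlgHom.commutes, seqAct_algebraMap, Algebra.TensorProduct.algebraMap_apply,
      seqActComp_tmul, seqAct_algebraMap, map_smul, LinearMap.smul_apply,
      ← map_one (algebraMap k _),
      seqAct_algebraMap, one_smul]
  | h1 ξ w =>
    rw [comulHom_gen, map_sum, seqAct_gen, ← contractSeq_comp]
    simp only [seqActComp_tmul, seqAct_gen]
  | hmul a b ha hb =>
    rw [map_mul, seqAct_mul, ← ha]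
    generalize comulHom R' R R'' a = s
    induction s using tensor_ind with
    | add x y hx hy => simp only [add_mul, map_add, hx, hy, seqAct_add_left]
    | tmul x y => rw [seqActComp_mul, hb, seqActComp_tmul]
  | hadd a b ha hb => rw [map_add, map_add, map_add, ha, hb]

/-- The linear form on `A(R', R)` determined by a sequence of `H_n`-linear maps
`V^{⊗ n} → V'^{⊗ n}`. -/
def seqForm (F : IntSeq R R') : QHom R' R →ₗ[k] k := IntSeq.eval ∘ₗ seqAct F

lemma seqForm_add (F G : IntSeq R R') (a : QHom R' R) :
    seqForm (F + G) a = seqForm F a + seqForm G a := by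
  rw [seqForm, LinearMap.comp_apply, seqAct_add_left, map_add]; rfl

lemma seqForm_smul (c : k) (F : IntSeq R R') (a : QHom R' R) :
    seqForm (c • F) a = c * seqForm F a := by
  rw [seqForm, LinearMap.comp_apply, seqAct_smul_left, map_smul]; rfl

lemma seqForm_zero (a : QHom R' R) : seqForm (0 : IntSeq R R') a = 0 := by
  rw [← zero_smul k (0 : IntSeq R R'), seqForm_smul, zero_mul]

/-- If `Δ(a) = 0`, then the forms determined by composite sequences vanish on `a`. -/
lemma seqForm_comp_eq_zero {a : QHom R' R''} (h : comulHom R' R R'' a = 0) (F : IntSeq R R')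
    (G : IntSeq R'' R) : seqForm (IntSeq.comp F G) a = 0 := by
  rw [seqForm, LinearMap.comp_apply, ← seqActComp_comulHom, h, map_zero, map_zero]

/-- The form determined by the sequence of identity maps is the counit. -/
lemma seqForm_one (a : FRT R) : seqForm (IntSeq.one R) a = counitHom R a := by
  have h : seqAct (IntSeq.one R) a = counitHom R a • IntSeq.one R := by
    induction a using QHom.induction with
    | h0 c => rw [seqAct_algebraMap, AlgHom.commutes]; rfl
    | h1 ξ v =>
      rw [seqAct_gen, counitHom_gen]
      ext n : 2
      exact LinearMap.ext fun t => contractFst_tmul ξ v t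
    | hmul a b ha hb =>
      rw [seqAct_mul, ha, map_mul, mul_comm, mul_smul, seqAct_smul_left, hb, smul_comm]
    | hadd a b ha hb => rw [map_add, map_add, ha, hb, add_smul]
  rw [seqForm, LinearMap.comp_apply, h, map_smul]
  exact mul_one _

/-- An element of `A(R', R)` has a finite degree: the form determined by `F` depends on finitely
many terms of `F` only. -/
lemma exists_seqForm_eq_zero (a : QHom R' R) :
    ∃ N, ∀ F : IntSeq R R', (∀ n < N, F n = 0) → seqForm F a = 0 := by
  have h : ∃ N, ∀ (F : IntSeq R R') (m : ℕ), (∀ n < N + m, F n = 0) →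
      ∀ n < m, seqAct F a n = 0 := by
    induction a using QHom.induction with
    | h0 c =>
      refine ⟨0, fun F m hF n hn => ?_⟩
      rw [seqAct_algebraMap, Pi.smul_apply, hF n (by omega), smul_zero]
    | h1 ξ v =>
      refine ⟨1, fun F m hF n hn => ?_⟩
      rw [seqAct_gen]
      ext1
      rw [contractSeq_apply, hF (n + 1) (by omega)]
      exact map_zero (contractPow n (ξ ⊗ₜ v))
    | hmul a b ha hb =>
      obtain ⟨N, hN⟩ := ha
      obtain ⟨M, hM⟩ := hb
      refine ⟨N + M, fun F m hF n hn => ?_⟩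
      rw [seqAct_mul]
      exact hM _ m (hN F (M + m) fun i hi => hF i (by omega)) n hn
    | hadd a b ha hb =>
      obtain ⟨N, hN⟩ := ha
      obtain ⟨M, hM⟩ := hb
      refine ⟨N + M, fun F m hF n hn => ?_⟩
      rw [map_add, Pi.add_apply, hN F m (fun i hi => hF i (by omega)) n hn,
        hM F m (fun i hi => hF i (by omega)) n hn, add_zero]
  obtain ⟨N, hN⟩ := h
  refine ⟨N + 1, fun F hF => ?_⟩
  change (seqAct F a 0).1 (1 : k) = 0
  rw [hN F 1 hF 0 (by omega)]; rfl

/-- `IsGeneratedBy R R'` says that for each `n` the identity of `V^{⊗ n}` is a sum of composites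
`V^{⊗ n} → V'^{⊗ n} → V^{⊗ n}` of `H_n`-linear maps; equivalently, the `H_n`-module `V^{⊗ n}` is a
direct summand of a direct sum of finitely many copies of `V'^{⊗ n}`. -/
def IsGeneratedBy (R : HeckeSymmetry k q V) (R' : HeckeSymmetry k q V') : Prop :=
  ∀ n, LinearMap.id ∈ AddSubgroup.closure
    {e : tpow k V n →ₗ[k] tpow k V n | ∃ f ∈ intertwiners R' R n, ∃ g ∈ intertwiners R R' n,
      f ∘ₗ g = e}

/-- The counit of `A(R)` vanishes on the kernel of `A(R) → A(R, R') ⊗ A(R', R)`. -/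
lemma counitHom_eq_zero (h : IsGeneratedBy R R') {a : FRT R} (ha : comulHom R R' R a = 0) :
    counitHom R a = 0 := by
  have h1 : ∀ n, seqForm (IntSeq.single n (IntSeq.one R n)) a = 0 := by
    intro n
    have h2 : ∀ e ∈ AddSubgroup.closure {e : tpow k V n →ₗ[k] tpow k V n |
        ∃ f ∈ intertwiners R' R n, ∃ g ∈ intertwiners R R' n, f ∘ₗ g = e},
        ∃ he : e ∈ intertwiners R R n, seqForm (IntSeq.single n ⟨e, he⟩) a = 0 := by
      intro e he
      induction he using AddSubgroup.closure_induction with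
      | mem e he =>
        obtain ⟨f, hf, g, hg, rfl⟩ := he
        refine ⟨intertwiners.comp_mem hf hg, ?_⟩
        exact (congrArg (fun F => seqForm F a) (IntSeq.single_comp n ⟨f, hf⟩ ⟨g, hg⟩)).trans
          (seqForm_comp_eq_zero ha _ _)
      | zero =>
        refine ⟨zero_mem _, ?_⟩
        change seqForm (IntSeq.single n 0) a = 0
        rw [map_zero, seqForm_zero]
      | add e e' _ _ he he' =>
        obtain ⟨he, h⟩ := he
        obtain ⟨he', h'⟩ := he'
        refine ⟨add_mem he he', ?_⟩
        rw [← AddMemClass.mk_add_mk _ e e' he he', map_add, seqForm_add, h, h', add_zero]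
      | neg e _ he =>
        obtain ⟨he, h⟩ := he
        refine ⟨neg_mem he, ?_⟩
        have e2 : (⟨-e, neg_mem he⟩ : intertwiners R R n) = -⟨e, he⟩ := rfl
        rw [e2, map_neg, ← neg_one_smul k, seqForm_smul, h, mul_zero]
    exact (h2 _ (h n)).2
  obtain ⟨N, hN⟩ := exists_seqForm_eq_zero (R' := R) (R := R) a
  have h3 : ∀ s : Finset ℕ,
      seqForm (∑ n ∈ s, IntSeq.single n (IntSeq.one R n)) a = 0 := by
    intro s
    induction s using Finset.induction_on with
    | empty => rw [Finset.sum_empty, seqForm_zero]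
    | insert n s hn ih => rw [Finset.sum_insert hn, seqForm_add, h1, ih, add_zero]
  have h4 := hN (IntSeq.one R - ∑ n ∈ Finset.range N, IntSeq.single n (IntSeq.one R n)) (by
    intro n hn
    rw [Pi.sub_apply, Finset.sum_apply, Finset.sum_eq_single n]
    · simp [IntSeq.single]
    · intro m _ hm
      simp [IntSeq.single, hm.symm]
    · intro h; exact absurd (Finset.mem_range.2 hn) h)
  have h5 := seqForm_add (IntSeq.one R - ∑ n ∈ Finset.range N, IntSeq.single n (IntSeq.one R n))
    (∑ n ∈ Finset.range N, IntSeq.single n (IntSeq.one R n)) a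
  rw [sub_add_cancel, h4, h3, seqForm_one, add_zero] at h5
  exact h5

/-- There is a bilinear form on `A(R, R') ⊗ A(R', R)` whose composite with `Δ` is the counit. -/
lemma exists_form (h : IsGeneratedBy R R') : ∃ θ : QHom R R' ⊗[k] QHom R' R →ₗ[k] k,
    ∀ a : FRT R, θ (comulHom R R' R a) = counitHom R a := by
  have hε : (counitHom R).toLinearMap ∈ LinearMap.range (comulHom R R' R).toLinearMap.dualMap := by
    rw [LinearMap.range_dualMap_eq_dualAnnihilator_ker, Submodule.mem_dualAnnihilator]
    exact fun a ha => counitHom_eq_zero h ha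
  obtain ⟨θ, hθ⟩ := hε
  exact ⟨θ, LinearMap.congr_fun hθ⟩

end QHom
end SeqComp

/-! ### Splitting tensor powers into indecomposable Hecke modules -/

section Summands

variable {H M M' : Type u} [Ring H] [AddCommGroup M] [Module H M] [AddCommGroup M'] [Module H M']

lemma isDirectSummandOf_of_comp_eq_id {N : Type u} [AddCommGroup N] [Module H N] (i : N →ₗ[H] M')
    (p : M' →ₗ[H] N) (h : p ∘ₗ i = LinearMap.id) : IsDirectSummandOf H N M' := by
  have hi : Function.LeftInverse p i := LinearMap.congr_fun h
  refine ⟨LinearMap.range i, _, LinearMap.isCompl_of_proj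
    (f := (LinearEquiv.ofInjective i hi.injective).toLinearMap ∘ₗ p) ?_,
    ⟨LinearEquiv.ofInjective i hi.injective⟩⟩
  rintro ⟨_, x, rfl⟩
  ext
  simp [hi x]

variable (H M) in
/-- If each indecomposable direct summand of an Artinian module `M'` is isomorphic to a direct
summand of `M`, then the projection of `M'` onto any direct summand is a sum of endomorphisms that
factor through `M`: split the summand until its components are indecomposable. -/
lemma proj_mem_closure [IsArtinian H M']
    (h : ∀ (N : Type u) [AddCommGroup N] [Module H N], IsIndecomposable H N →
      IsDirectSummandOf H N M' → IsDirectSummandOf H N M)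
    (P : Submodule H M') (N : Type u) [AddCommGroup N] [Module H N] (i : N →ₗ[H] M')
    (p : M' →ₗ[H] N) (hp : p ∘ₗ i = LinearMap.id) (hP : LinearMap.range i = P) :
    i ∘ₗ p ∈ AddSubgroup.closure
      {e : M' →ₗ[H] M' | ∃ (f : M →ₗ[H] M') (g : M' →ₗ[H] M), f ∘ₗ g = e} := by
  induction P using WellFoundedLT.induction generalizing N with
  | ind P ih =>
    have hi : Function.Injective i := Function.LeftInverse.injective (LinearMap.congr_fun hp)
    by_cases hN : Nontrivial N
    · by_cases hind : IsIndecomposable H N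
      · obtain ⟨a, b, hab, ⟨φ⟩⟩ := h N hind (isDirectSummandOf_of_comp_eq_id i p hp)
        refine AddSubgroup.subset_closure ⟨i ∘ₗ φ.symm.toLinearMap ∘ₗ a.projectionOnto b hab,
          a.subtype ∘ₗ φ.toLinearMap ∘ₗ p, ?_⟩
        ext x
        simp
      · rw [IsIndecomposable] at hind
        push Not at hind
        obtain ⟨a, b, hab, ha, hb⟩ := hind hN
        have key : ∀ a b : Submodule H N, ∀ hab : IsCompl a b, b ≠ ⊥ →
            (i ∘ₗ a.subtype) ∘ₗ (a.projectionOnto b hab ∘ₗ p) ∈ AddSubgroup.closure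
              {e : M' →ₗ[H] M' | ∃ (f : M →ₗ[H] M') (g : M' →ₗ[H] M), f ∘ₗ g = e} := by
          intro a b hab hb
          refine ih (LinearMap.range (i ∘ₗ a.subtype)) ?_ a _ _ ?_ rfl
          · rw [LinearMap.range_comp, Submodule.range_subtype, ← hP, LinearMap.range_eq_map]
            refine Submodule.map_strictMono_of_injective hi (lt_top_iff_ne_top.2 fun e => hb ?_)
            have := hab.disjoint
            rwa [e, top_disjoint] at this
          · ext x
            have e := LinearMap.congr_fun hp (x : N)
            simp only [LinearMap.comp_apply, LinearMap.id_apply] at e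
            simp [e]
        have e := add_mem (key a b hab hb) (key b a hab.symm ha)
        convert e using 1
        ext x
        have := Submodule.projection_add_projection_eq_self hab (p x)
        simp only [LinearMap.comp_apply, LinearMap.add_apply, ← map_add]
        exact congrArg i this.symm
    · rw [not_nontrivial_iff_subsingleton] at hN
      have e : i ∘ₗ p = 0 := LinearMap.ext fun x => by
        rw [LinearMap.comp_apply, Subsingleton.elim (p x) 0, map_zero]; rfl
      rw [e]; exact zero_mem _

end Summands

section Generated

variable {k : Type u} [Field k] {q : k} {V V' : Type u} [AddCommGroup V] [Module k V]
  [AddCommGroup V'] [Module k V']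

lemma HeckeSymmetry.algebraMap_smul_T (R : HeckeSymmetry k q V) (n : ℕ) (c : k) (t : tpow k V n) :
    (algebraMap k (HeckeAlg k q n) c • (show R.T n from t) : R.T n) = c • t := by
  change R.heckeRep n (algebraMap k _ c) t = c • t
  rw [AlgHom.commutes]; rfl

lemma HeckeSymmetry.gen_smul_T (R : HeckeSymmetry k q V) (n : ℕ) (i : Fin (n - 1))
    (t : tpow k V n) :
    (RingQuot.mkAlgHom k (HeckeAlg.Rel k q n) (FreeAlgebra.ι k i) • (show R.T n from t) : R.T n) =
      placeOp R.op n i t := by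
  change R.heckeRep n (RingQuot.mkAlgHom k _ (FreeAlgebra.ι k i)) t = _
  rw [HeckeSymmetry.heckeRep, RingQuot.liftAlgHom_mkAlgHom_apply, FreeAlgebra.lift_ι_apply]

/-- A homomorphism of `H_n`-modules as an element of the space of intertwiners. -/
def HeckeSymmetry.toIntertwiner {R : HeckeSymmetry k q V} {R' : HeckeSymmetry k q V'} {n : ℕ}
    (f : R.T n →ₗ[HeckeAlg k q n] R'.T n) : intertwiners R R' n :=
  ⟨{ toFun := f
     map_add' := f.map_add
     map_smul' := fun c t => by
      have h := f.map_smul (algebraMap k (HeckeAlg k q n) c) t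
      exact ((congrArg f (R.algebraMap_smul_T n c t)).symm.trans h).trans
        (R'.algebraMap_smul_T n c (f t)) }, fun i hi => by
    refine LinearMap.ext fun t => ?_
    have h := f.map_smul (RingQuot.mkAlgHom k (HeckeAlg.Rel k q n)
      (FreeAlgebra.ι k (⟨i, by omega⟩ : Fin (n - 1)))) t
    exact ((congrArg f (R.gen_smul_T n ⟨i, by omega⟩ t)).symm.trans h).trans
      (R'.gen_smul_T n ⟨i, by omega⟩ (f t))⟩

lemma tpow_finite [Module.Finite k V] (n : ℕ) : Module.Finite k (tpow k V n) := by
  induction n with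
  | zero => exact inferInstanceAs (Module.Finite k k)
  | succ n ih => exact inferInstanceAs (Module.Finite k (V ⊗[k] tpow k V n))

lemma HeckeSymmetry.isArtinian_T [Module.Finite k V] (R : HeckeSymmetry k q V) (n : ℕ) :
    IsArtinian (HeckeAlg k q n) (R.T n) := by
  have := tpow_finite (k := k) (V := V) n
  let _ : Module k (R.T n) := inferInstanceAs (Module k (tpow k V n))
  have : Module.Finite k (R.T n) := tpow_finite (k := k) (V := V) n
  have : IsScalarTower k (HeckeAlg k q n) (R.T n) := ⟨fun c x t => by
    rw [Algebra.smul_def, mul_smul]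
    exact R.algebraMap_smul_T n c (x • t)⟩
  exact isArtinian_of_tower k inferInstance

lemma id_mem_closure {W W' : Type u} [AddCommGroup W] [Module k W] [Module.Finite k W]
    [AddCommGroup W'] [Module k W'] [Nontrivial W'] : LinearMap.id ∈ AddSubgroup.closure
      {e : W →ₗ[k] W | ∃ (f : W' →ₗ[k] W) (g : W →ₗ[k] W'), f ∘ₗ g = e} := by
  obtain ⟨w, hw⟩ := exists_ne (0 : W')
  obtain ⟨l, hl⟩ := Module.Projective.exists_dual_ne_zero k hw
  have e : (LinearMap.id : W →ₗ[k] W) = ∑ i,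
      LinearMap.toSpanSingleton k W (Module.finBasis k W i) ∘ₗ (Module.finBasis k W).coord i := by
    refine LinearMap.ext fun x => ?_
    rw [LinearMap.sum_apply]
    exact ((Module.finBasis k W).sum_repr x).symm
  rw [e]
  refine sum_mem fun i _ => AddSubgroup.subset_closure
    ⟨LinearMap.toSpanSingleton k W (Module.finBasis k W i) ∘ₗ ((l w)⁻¹ • l),
      LinearMap.toSpanSingleton k W' w ∘ₗ (Module.finBasis k W).coord i, ?_⟩
  refine LinearMap.ext fun x => ?_
  simp [mul_comm, hl]

/-- If for each `n > 1` the indecomposable direct summands of the `H_n`-module `V^{⊗ n}` occur in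
`V'^{⊗ n}`, then the identity of `V^{⊗ n}` is a sum of maps that factor through `V'^{⊗ n}`, for all
`n`. -/
lemma QHom.isGeneratedBy_of_summands [Module.Finite k V] [Module.Finite k V']
    (R : HeckeSymmetry k q V) (R' : HeckeSymmetry k q V')
    (h : ∀ n : ℕ, 1 < n → ∀ (M : Type u) [AddCommGroup M] [Module (HeckeAlg k q n) M],
      IsIndecomposable (HeckeAlg k q n) M →
        IsDirectSummandOf (HeckeAlg k q n) M (R.T n) →
          IsDirectSummandOf (HeckeAlg k q n) M (R'.T n)) : IsGeneratedBy R R' := by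
  have h2 : ∀ n, 1 < n → LinearMap.id ∈ AddSubgroup.closure
      {e : tpow k V n →ₗ[k] tpow k V n | ∃ f ∈ intertwiners R' R n, ∃ g ∈ intertwiners R R' n,
        f ∘ₗ g = e} := by
    intro n hn
    have := R.isArtinian_T n
    have h3 : ∀ e ∈ AddSubgroup.closure {e : R.T n →ₗ[HeckeAlg k q n] R.T n |
        ∃ (f : R'.T n →ₗ[HeckeAlg k q n] R.T n) (g : R.T n →ₗ[HeckeAlg k q n] R'.T n),
          f ∘ₗ g = e},
        (HeckeSymmetry.toIntertwiner e).1 ∈ AddSubgroup.closure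
          {e : tpow k V n →ₗ[k] tpow k V n | ∃ f ∈ intertwiners R' R n, ∃ g ∈ intertwiners R R' n,
            f ∘ₗ g = e} := by
      intro e he
      induction he using AddSubgroup.closure_induction with
      | mem e he =>
        obtain ⟨f, g, rfl⟩ := he
        exact AddSubgroup.subset_closure ⟨_, (HeckeSymmetry.toIntertwiner f).2, _,
          (HeckeSymmetry.toIntertwiner g).2, rfl⟩
      | zero => exact zero_mem _
      | add e e' _ _ he he' => exact add_mem he he'
      | neg e _ he => exact neg_mem he
    exact h3 _ (proj_mem_closure (HeckeAlg k q n) (R'.T n) (h n hn) _ (R.T n) LinearMap.id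
      LinearMap.id rfl rfl)
  intro n
  match n with
  | 0 => exact AddSubgroup.subset_closure ⟨LinearMap.id (M := k), fun i hi => absurd hi (by omega),
      LinearMap.id (M := k), fun i hi => absurd hi (by omega), rfl⟩
  | n + 2 => exact h2 _ (by omega)
  | 1 =>
    have := tpow_finite (k := k) (V := V) 1
    rcases subsingleton_or_nontrivial (tpow k V' 1) with hs | hs
    · -- If `V' = 0`, then `V ⊗ V = 0` by the case `n = 2`, and so `V = 0`.
      have hs2 : Subsingleton (tpow k V' 2) := by
        refine subsingleton_of_forall_eq 0 fun y => ?_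
        change V' ⊗[k] tpow k V' 1 at y
        induction y using tensor_ind with
        | add a b ha hb => rw [ha, hb]; exact add_zero _
        | tmul v w => rw [Subsingleton.elim w 0, TensorProduct.tmul_zero]; rfl
      have e : ∀ e ∈ AddSubgroup.closure
          {e : tpow k V 2 →ₗ[k] tpow k V 2 | ∃ f ∈ intertwiners R' R 2, ∃ g ∈ intertwiners R R' 2,
            f ∘ₗ g = e}, e = 0 := by
        intro e he
        induction he using AddSubgroup.closure_induction with
        | mem e he =>
          obtain ⟨f, hf, g, hg, rfl⟩ := he
          refine LinearMap.ext fun x => ?_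
          rw [LinearMap.comp_apply, Subsingleton.elim (g x) 0, map_zero]; rfl
        | zero => rfl
        | add e e' _ _ he he' => rw [he, he', add_zero]
        | neg e _ he => rw [he, neg_zero]
      have e2 := e _ (h2 2 (by omega))
      have hV : Subsingleton V := by
        refine subsingleton_of_forall_eq 0 fun v => ?_
        by_contra hv
        obtain ⟨l, hl⟩ := Module.Projective.exists_dual_ne_zero k hv
        have e3 : v ⊗ₜ[k] (v ⊗ₜ[k] (1 : k)) = (0 : V ⊗[k] (V ⊗[k] k)) :=
          LinearMap.congr_fun e2 (v ⊗ₜ[k] (v ⊗ₜ[k] (1 : k)) : V ⊗[k] (V ⊗[k] k))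
        have e4 := congrArg (dualDistrib k V (V ⊗[k] k) (l ⊗ₜ dualDistrib k V k
          (l ⊗ₜ LinearMap.id))) e3
        simp [hl] at e4
      have hs1 : Subsingleton (tpow k V 1) := by
        refine subsingleton_of_forall_eq 0 fun y => ?_
        change V ⊗[k] k at y
        induction y using tensor_ind with
        | add a b ha hb => rw [ha, hb]; exact add_zero _
        | tmul v w => rw [Subsingleton.elim v 0, TensorProduct.zero_tmul]; rfl
      have e3 : (LinearMap.id : tpow k V 1 →ₗ[k] tpow k V 1) = 0 :=
        LinearMap.ext fun y => Subsingleton.elim _ _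
      rw [e3]; exact zero_mem _
    · refine AddSubgroup.closure_mono ?_ (id_mem_closure (k := k) (W := tpow k V 1)
        (W' := tpow k V' 1))
      rintro _ ⟨f, g, rfl⟩
      exact ⟨f, fun i hi => absurd hi (by omega), g, fun i hi => absurd hi (by omega), rfl⟩

end Generated

/-! ### The equivalence of categories of left comodules -/

section Lift

variable {k : Type u} [Field k] {A B C : Type u} [AddCommGroup A] [Module k A]
  [AddCommGroup B] [Module k B] [AddCommGroup C] [Module k C]

/-- The factorization of a linear map through an injective one. -/
def liftInj (i : A →ₗ[k] B) (hi : Function.Injective i) (f : C →ₗ[k] B)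
    (h : ∀ c, f c ∈ LinearMap.range i) : C →ₗ[k] A :=
  (LinearEquiv.ofInjective i hi).symm.toLinearMap ∘ₗ f.codRestrict _ h

lemma liftInj_spec (i : A →ₗ[k] B) (hi : Function.Injective i) (f : C →ₗ[k] B)
    (h : ∀ c, f c ∈ LinearMap.range i) (c : C) : i (liftInj i hi f h c) = f c :=
  congrArg Subtype.val ((LinearEquiv.ofInjective i hi).apply_symm_apply (f.codRestrict _ h c))

lemma lTensor_injective (D : Type u) [AddCommGroup D] [Module k D] {i : A →ₗ[k] B}
    (hi : Function.Injective i) : Function.Injective (i.lTensor D) :=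
  Module.Flat.lTensor_preserves_injective_linearMap _ hi

lemma rTensor_injective (D : Type u) [AddCommGroup D] [Module k D] {i : A →ₗ[k] B}
    (hi : Function.Injective i) : Function.Injective (i.rTensor D) :=
  Module.Flat.rTensor_preserves_injective_linearMap _ hi

end Lift

namespace QHom

variable {k : Type u} [Field k] {q : k} {V₀ V₁ V₂ V₃ V V' : Type u}
  [AddCommGroup V₀] [Module k V₀] [Module.Finite k V₀]
  [AddCommGroup V₁] [Module k V₁] [Module.Finite k V₁]
  [AddCommGroup V₂] [Module k V₂] [Module.Finite k V₂]
  [AddCommGroup V₃] [Module k V₃] [Module.Finite k V₃]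
  [AddCommGroup V] [Module k V] [Module.Finite k V]
  [AddCommGroup V'] [Module k V'] [Module.Finite k V']

lemma comulHom_coassoc_apply (R₀ : HeckeSymmetry k q V₀) (R₁ : HeckeSymmetry k q V₁)
    (R₂ : HeckeSymmetry k q V₂) (R₃ : HeckeSymmetry k q V₃) (a : QHom R₀ R₃) :
    TensorProduct.assoc k _ _ _ ((comulHom R₀ R₁ R₂).toLinearMap.rTensor _ (comulHom R₀ R₂ R₃ a)) =
      (comulHom R₁ R₂ R₃).toLinearMap.lTensor _ (comulHom R₀ R₁ R₃ a) :=
  AlgHom.congr_fun (comulHom_coassoc R₀ R₁ R₂ R₃) a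

section Left

/-- The map `a ⊗ x ↦ Δ(a) ⊗ x` from `A(R₀, R₂) ⊗ X` to `A(R₀, R₁) ⊗ (A(R₁, R₂) ⊗ X)`. The left
coaction on `A(R', R) ⊗ X` and the two maps whose equalizer is `A(R', R) □ X` are of this kind or
induced by the coaction on `X`. -/
def splitL (R₀ : HeckeSymmetry k q V₀) (R₁ : HeckeSymmetry k q V₁) (R₂ : HeckeSymmetry k q V₂)
    (X : Type u) [AddCommGroup X] [Module k X] :
    QHom R₀ R₂ ⊗[k] X →ₗ[k] QHom R₀ R₁ ⊗[k] (QHom R₁ R₂ ⊗[k] X) :=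
  (TensorProduct.assoc k _ _ _).toLinearMap ∘ₗ (comulHom R₀ R₁ R₂).toLinearMap.rTensor X

variable {X Y : Type u} [AddCommGroup X] [Module k X] [AddCommGroup Y] [Module k Y]

lemma splitL_tmul (R₀ : HeckeSymmetry k q V₀) (R₁ : HeckeSymmetry k q V₁)
    (R₂ : HeckeSymmetry k q V₂) (a : QHom R₀ R₂) (x : X) :
    splitL R₀ R₁ R₂ X (a ⊗ₜ x) = TensorProduct.assoc k _ _ _ (comulHom R₀ R₁ R₂ a ⊗ₜ x) := rfl

lemma splitL_natural (R₀ : HeckeSymmetry k q V₀) (R₁ : HeckeSymmetry k q V₁)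
    (R₂ : HeckeSymmetry k q V₂) (f : X →ₗ[k] Y) (s : QHom R₀ R₂ ⊗[k] X) :
    splitL R₀ R₁ R₂ Y (f.lTensor _ s) = (f.lTensor _).lTensor _ (splitL R₀ R₁ R₂ X s) := by
  induction s using tensor_ind with
  | add a b ha hb => simp only [map_add, ha, hb]
  | tmul a x =>
    rw [LinearMap.lTensor_tmul, splitL_tmul, splitL_tmul]
    generalize comulHom R₀ R₁ R₂ a = t
    induction t using tensor_ind with
    | add a b ha hb => simp only [TensorProduct.add_tmul, map_add, ha, hb]
    | tmul a b => simp

lemma splitL_splitL (R₀ : HeckeSymmetry k q V₀) (R₁ : HeckeSymmetry k q V₁)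
    (R₂ : HeckeSymmetry k q V₂) (R₃ : HeckeSymmetry k q V₃) (s : QHom R₀ R₃ ⊗[k] X) :
    splitL R₀ R₁ R₂ _ (splitL R₀ R₂ R₃ X s) =
      (splitL R₁ R₂ R₃ X).lTensor _ (splitL R₀ R₁ R₃ X s) := by
  induction s using tensor_ind with
  | add a b ha hb => simp only [map_add, ha, hb]
  | tmul a x =>
    rw [splitL_tmul, splitL_tmul]
    have h := congrArg (fun t => (TensorProduct.assoc k (QHom R₁ R₂)
      (QHom R₂ R₃) X).toLinearMap.lTensor (QHom R₀ R₁) (TensorProduct.assoc k _ _ _ (t ⊗ₜ[k] x)))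
        (comulHom_coassoc_apply R₀ R₁ R₂ R₃ a)
    refine Eq.trans ?_ (h.trans ?_)
    · generalize comulHom R₀ R₂ R₃ a = t
      induction t using tensor_ind with
      | add a b ha hb => simp only [TensorProduct.add_tmul, map_add, ha, hb]
      | tmul a b =>
        rw [TensorProduct.assoc_tmul, splitL_tmul, LinearMap.rTensor_tmul, AlgHom.toLinearMap_apply]
        generalize comulHom R₀ R₁ R₂ a = t
        induction t using tensor_ind with
        | add a b ha hb => simp only [TensorProduct.add_tmul, map_add, ha, hb]
        | tmul a b => simp
    · generalize comulHom R₀ R₁ R₃ a = t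
      induction t using tensor_ind with
      | add a b ha hb => simp only [TensorProduct.add_tmul, map_add, ha, hb]
      | tmul a b => rfl

lemma counit_splitL (R : HeckeSymmetry k q V) (R₁ : HeckeSymmetry k q V₁) (s : QHom R R₁ ⊗[k] X) :
    TensorProduct.lid k _ ((counitHom R).toLinearMap.rTensor _ (splitL R R R₁ X s)) = s := by
  induction s using tensor_ind with
  | add a b ha hb => simp only [map_add, ha, hb]
  | tmul a x =>
    have h := congrArg (fun t => t ⊗ₜ[k] x) ((bicomod R R₁).left.counit_apply a)
    refine Eq.trans ?_ h
    change _ = (TensorProduct.lid k _ ((counitHom R).toLinearMap.rTensor _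
      (comulHom R R R₁ a))) ⊗ₜ[k] x
    rw [splitL_tmul]
    generalize comulHom R R R₁ a = t
    induction t using tensor_ind with
    | add a b ha hb => simp only [TensorProduct.add_tmul, map_add, ha, hb]
    | tmul a b => simp [TensorProduct.smul_tmul']

lemma splitL_coact (R : HeckeSymmetry k q V) (X : LeftComod k (FRT R)) (x : X) :
    splitL R R R X (X.coact x) = X.coact.lTensor _ (X.coact x) := X.coassoc_apply x

variable (R : HeckeSymmetry k q V) (R' : HeckeSymmetry k q V') (X : LeftComod k (FRT R))

lemma inclLeft_injective : Function.Injective (inclLeft R' R X) := Subtype.val_injective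

lemma mem_range_inclLeft (z : QHom R' R ⊗[k] X) : z ∈ LinearMap.range (inclLeft R' R X) ↔
    splitL R' R R X z = X.coact.lTensor _ z := by
  have h : z ∈ LinearMap.range (inclLeft R' R X) ↔ z ∈ cotensor (bicomod R' R).right X := by
    rw [← Submodule.range_subtype (cotensor (bicomod R' R).right X)]; rfl
  rw [h]
  exact sub_eq_zero

lemma splitL_inclLeft (y : (cotensorLeft R' R).obj X) :
    splitL R' R R X (inclLeft R' R X y) = X.coact.lTensor _ (inclLeft R' R X y) :=
  (mem_range_inclLeft R R' X _).1 ⟨y, rfl⟩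

lemma inclLeft_coact (y : (cotensorLeft R' R).obj X) :
    (inclLeft R' R X).lTensor _ (((cotensorLeft R' R).obj X).coact y) =
      splitL R' R' R X (inclLeft R' R X y) :=
  LeftComod.sub_coact ((bicomod R' R).leftTensor X) (cotensor (bicomod R' R).right X) _ y

variable {R X} in
lemma inclLeft_map {Y : LeftComod k (FRT R)} (f : X ⟶ Y) (y : (cotensorLeft R' R).obj X) :
    inclLeft R' R Y (((cotensorLeft R' R).map f).lin y) = f.lin.lTensor _ (inclLeft R' R X y) :=
  rfl

/-- The functor `P ⊗ ?` preserves the equalizer `A(R', R) □ X`. -/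
lemma mem_range_lTensor_inclLeft (P : Type u) [AddCommGroup P] [Module k P]
    (z : P ⊗[k] (QHom R' R ⊗[k] X))
    (hz : (splitL R' R R X).lTensor P z = (X.coact.lTensor _).lTensor P z) :
    z ∈ LinearMap.range ((inclLeft R' R X).lTensor P) := by
  have hex : Function.Exact (inclLeft R' R X) (splitL R' R R X - X.coact.lTensor (QHom R' R)) := by
    intro z
    rw [LinearMap.sub_apply, sub_eq_zero]
    exact (mem_range_inclLeft R R' X z).symm
  refine (Module.Flat.lTensor_exact P hex z).1 ?_
  rw [LinearMap.lTensor_sub, LinearMap.sub_apply, sub_eq_zero, hz]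

/-- The map `x ↦ Δ(x₍₋₁₎) ⊗ x₍₀₎` into `A(R, R') ⊗ (A(R', R) ⊗ X)`. -/
def unitAuxL : X →ₗ[k] QHom R R' ⊗[k] (QHom R' R ⊗[k] X) := splitL R R' R X ∘ₗ X.coact

lemma unitAuxL_apply (x : X) : unitAuxL R R' X x = splitL R R' R X (X.coact x) := rfl

lemma unitAuxL_mem₁ (x : X) :
    unitAuxL R R' X x ∈ LinearMap.range ((inclLeft R' R X).lTensor (QHom R R')) := by
  refine mem_range_lTensor_inclLeft R R' X _ _ ?_
  rw [unitAuxL_apply, ← splitL_splitL, splitL_coact, splitL_natural]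

lemma unitAuxL_mem₂ (x : X) : unitAuxL R R' X x ∈ LinearMap.range
    ((inclLeft R' R X).lTensor (QHom R R') ∘ₗ inclLeft R R' ((cotensorLeft R' R).obj X)) := by
  obtain ⟨y, hy⟩ := unitAuxL_mem₁ R R' X x
  have h : y ∈ LinearMap.range (inclLeft R R' ((cotensorLeft R' R).obj X)) := by
    rw [mem_range_inclLeft]
    apply lTensor_injective _ (lTensor_injective _ (inclLeft_injective R R' X))
    rw [← splitL_natural, hy, unitAuxL_apply, splitL_splitL, ← unitAuxL_apply, ← hy,
      ← LinearMap.lTensor_comp_apply, ← LinearMap.lTensor_comp_apply]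
    exact congrArg (fun f => LinearMap.lTensor _ f y) (LinearMap.ext fun w =>
      (inclLeft_coact R R' X w).symm)
  obtain ⟨z, rfl⟩ := h
  exact ⟨z, hy⟩

lemma inclLeft_inclLeft_injective : Function.Injective
    ((inclLeft R' R X).lTensor (QHom R R') ∘ₗ inclLeft R R' ((cotensorLeft R' R).obj X)) :=
  (lTensor_injective _ (inclLeft_injective R R' X)).comp (inclLeft_injective R' R _)

/-- The map `X → A(R, R') □ (A(R', R) □ X)` induced by `Δ`. -/
def unitL : X →ₗ[k] (cotensorLeft R R').obj ((cotensorLeft R' R).obj X) :=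
  liftInj _ (inclLeft_inclLeft_injective R R' X) (unitAuxL R R' X) (unitAuxL_mem₂ R R' X)

lemma unitL_spec (x : X) : (inclLeft R' R X).lTensor _ (inclLeft R R' _ (unitL R R' X x)) =
    splitL R R' R X (X.coact x) :=
  liftInj_spec _ (inclLeft_inclLeft_injective R R' X) (unitAuxL R R' X) (unitAuxL_mem₂ R R' X) x

lemma unitL_colinear (x : X) :
    ((cotensorLeft R R').obj ((cotensorLeft R' R).obj X)).coact (unitL R R' X x) =
      (unitL R R' X).lTensor _ (X.coact x) := by
  apply lTensor_injective _ (inclLeft_inclLeft_injective R R' X)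
  rw [LinearMap.lTensor_comp_apply, inclLeft_coact, ← splitL_natural, unitL_spec, splitL_splitL,
    splitL_coact, ← LinearMap.lTensor_comp_apply, ← LinearMap.lTensor_comp_apply]
  exact congrArg (fun f => LinearMap.lTensor _ f (X.coact x)) (LinearMap.ext fun w =>
      (unitL_spec R R' X w).symm)

variable {R R'} in
/-- The map `A(R, R') ⊗ (A(R', R) ⊗ X) → X` given by a bilinear form on
`A(R, R') ⊗ A(R', R)`. -/
def formL (θ : QHom R R' ⊗[k] QHom R' R →ₗ[k] k) (X : Type u) [AddCommGroup X] [Module k X] :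
    QHom R R' ⊗[k] (QHom R' R ⊗[k] X) →ₗ[k] X :=
  (TensorProduct.lid k X).toLinearMap ∘ₗ θ.rTensor X ∘ₗ
    (TensorProduct.assoc k _ _ _).symm.toLinearMap

section Form

variable {R R'} {θ : QHom R R' ⊗[k] QHom R' R →ₗ[k] k} {X Y : Type u} [AddCommGroup X] [Module k X]
  [AddCommGroup Y] [Module k Y]

lemma formL_natural (f : X →ₗ[k] Y) (s : QHom R R' ⊗[k] (QHom R' R ⊗[k] X)) :
    formL θ Y ((f.lTensor _).lTensor _ s) = f (formL θ X s) := by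
  obtain ⟨s, rfl⟩ := (TensorProduct.assoc k _ _ _).surjective s
  induction s using tensor_ind with
  | add a b ha hb => simp only [map_add, ha, hb]
  | tmul s x =>
    induction s using tensor_ind with
    | add a b ha hb => simp only [TensorProduct.add_tmul, map_add, ha, hb]
    | tmul a b => simp [formL]

lemma formL_splitL (hθ : ∀ a : FRT R, θ (comulHom R R' R a) = counitHom R a)
    (s : FRT R ⊗[k] X) : formL θ X (splitL R R' R X s) =
      TensorProduct.lid k X ((counitHom R).toLinearMap.rTensor X s) := by
  induction s using tensor_ind with
  | add a b ha hb => simp only [map_add, ha, hb]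
  | tmul a x => simp [formL, splitL_tmul, hθ]

end Form

lemma splitL_coact_formL {θ : QHom R R' ⊗[k] QHom R' R →ₗ[k] k}
    (hθ : ∀ a : FRT R, θ (comulHom R R' R a) = counitHom R a)
    (z : QHom R R' ⊗[k] (QHom R' R ⊗[k] X))
    (h1 : splitL R R' R' _ z = (splitL R' R' R X).lTensor _ z)
    (h2 : (X.coact.lTensor _).lTensor _ z = (splitL R' R R X).lTensor _ z) :
    splitL R R' R X (X.coact (formL θ X z)) = z := by
  have h3 : ((splitL R R' R X).lTensor (QHom R' R)).lTensor (QHom R R')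
      ((splitL R' R R X).lTensor _ z) =
      (splitL R' R R' (QHom R' R ⊗[k] X)).lTensor _ ((splitL R' R' R X).lTensor _ z) := by
    rw [← LinearMap.lTensor_comp_apply, ← LinearMap.lTensor_comp_apply]
    exact congrArg (fun f => LinearMap.lTensor _ f z) (LinearMap.ext fun w =>
      (splitL_splitL R' R R' R w).symm)
  calc splitL R R' R X (X.coact (formL θ X z))
      = splitL R R' R X (formL θ _ ((splitL R' R R X).lTensor _ z)) := by
        rw [← formL_natural X.coact, h2]
    _ = formL θ _ ((splitL R' R R' (QHom R' R ⊗[k] X)).lTensor _ (splitL R R' R' _ z)) := by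
        rw [← formL_natural (splitL R R' R X), h3, h1]
    _ = z := by rw [← splitL_splitL, formL_splitL hθ, counit_splitL]

lemma unitL_bijective (h : IsGeneratedBy R R') : Function.Bijective (unitL R R' X) := by
  obtain ⟨θ, hθ⟩ := exists_form h
  constructor
  · refine Function.LeftInverse.injective (g := fun y => formL θ X
      ((inclLeft R' R X).lTensor _ (inclLeft R R' _ y))) fun x => ?_
    simp only
    rw [unitL_spec, formL_splitL hθ]
    exact X.counit_apply x
  · intro y
    have h1 : splitL R R' R' _ ((inclLeft R' R X).lTensor _ (inclLeft R R' _ y)) =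
        (splitL R' R' R X).lTensor _ ((inclLeft R' R X).lTensor _ (inclLeft R R' _ y)) := by
      rw [splitL_natural, splitL_inclLeft, ← LinearMap.lTensor_comp_apply,
        ← LinearMap.lTensor_comp_apply]
      exact congrArg (fun f => LinearMap.lTensor _ f (inclLeft R R' _ y)) (LinearMap.ext fun w =>
        inclLeft_coact R R' X w)
    have h2 : (X.coact.lTensor _).lTensor _ ((inclLeft R' R X).lTensor _ (inclLeft R R' _ y)) =
        (splitL R' R R X).lTensor _ ((inclLeft R' R X).lTensor _ (inclLeft R R' _ y)) := by
      rw [← LinearMap.lTensor_comp_apply, ← LinearMap.lTensor_comp_apply]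
      exact congrArg (fun f => LinearMap.lTensor _ f (inclLeft R R' _ y)) (LinearMap.ext fun w =>
        (splitL_inclLeft R R' X w).symm)
    exact ⟨_, inclLeft_inclLeft_injective R R' X ((unitL_spec R R' X _).trans
      (splitL_coact_formL R R' X hθ _ h1 h2))⟩

lemma unitL_natural {X Y : LeftComod k (FRT R)} (f : X ⟶ Y) (x : X) :
    unitL R R' Y (f.lin x) =
      ((cotensorLeft R R').map ((cotensorLeft R' R).map f)).lin (unitL R R' X x) := by
  apply inclLeft_inclLeft_injective R R' Y
  change (inclLeft R' R Y).lTensor _ (inclLeft R R' _ (unitL R R' Y _)) =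
    (inclLeft R' R Y).lTensor _ (inclLeft R R' _ _)
  rw [unitL_spec, inclLeft_map, LeftComod.comm_apply, splitL_natural, ← unitL_spec,
    ← LinearMap.lTensor_comp_apply, ← LinearMap.lTensor_comp_apply]
  exact congrArg (fun g => LinearMap.lTensor _ g (inclLeft R R' _ (unitL R R' X x)))
    (LinearMap.ext fun w => (inclLeft_map R' f w).symm)

/-- The natural isomorphism `X ≅ A(R, R') □ (A(R', R) □ X)`. -/
def unitIsoL (h : IsGeneratedBy R R') :
    𝟭 (LeftComod k (FRT R)) ≅ cotensorLeft R' R ⋙ cotensorLeft R R' :=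
  NatIso.ofComponents (fun X => LeftComod.isoMk (X := X)
      (Y := (cotensorLeft R R').obj ((cotensorLeft R' R).obj X))
      (LinearEquiv.ofBijective (unitL R R' X) (unitL_bijective R R' X h))
      (LinearMap.ext (unitL_colinear R R' X))) fun {X Y} f => by
    ext1
    exact LinearMap.ext (unitL_natural R R' f)

lemma isEquivalence_cotensorLeft (h : IsGeneratedBy R R') (h' : IsGeneratedBy R' R) :
    (cotensorLeft R' R).IsEquivalence :=
  (CategoryTheory.Equivalence.mk (cotensorLeft R' R) (cotensorLeft R R') (unitIsoL R R' h)
    (unitIsoL R' R h').symm).isEquivalence_functor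

end Left
end QHom

/-! ### The monoidal structure of the functor on left comodules -/

namespace QHom

variable {k : Type u} [Field k] {q : k} {V₀ V₁ V₂ V V' : Type u}
  [AddCommGroup V₀] [Module k V₀] [Module.Finite k V₀]
  [AddCommGroup V₁] [Module k V₁] [Module.Finite k V₁]
  [AddCommGroup V₂] [Module k V₂] [Module.Finite k V₂]
  [AddCommGroup V] [Module k V] [Module.Finite k V]
  [AddCommGroup V'] [Module k V'] [Module.Finite k V']

section Left

lemma splitL_mm (R₀ : HeckeSymmetry k q V₀) (R₁ : HeckeSymmetry k q V₁)
    (R₂ : HeckeSymmetry k q V₂) {X Y : Type u} [AddCommGroup X] [Module k X] [AddCommGroup Y]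
    [Module k Y] (s : QHom R₀ R₂ ⊗[k] X) (t : QHom R₀ R₂ ⊗[k] Y) :
    splitL R₀ R₁ R₂ (X ⊗[k] Y) (LeftComod.mm X Y (s ⊗ₜ t)) =
      (LeftComod.mm X Y).lTensor _ (LeftComod.mm _ _
        (splitL R₀ R₁ R₂ X s ⊗ₜ splitL R₀ R₁ R₂ Y t)) := by
  induction s using tensor_ind with
  | add a b ha hb => simp only [TensorProduct.add_tmul, map_add, ha, hb]
  | tmul a x =>
    induction t using tensor_ind with
    | add a b ha hb => simp only [TensorProduct.tmul_add, map_add, ha, hb]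
    | tmul b y =>
      rw [LeftComod.mm_tmul, splitL_tmul, splitL_tmul, splitL_tmul, map_mul]
      generalize comulHom R₀ R₁ R₂ a = s
      generalize comulHom R₀ R₁ R₂ b = t
      induction s using tensor_ind with
      | add a b ha hb => simp only [add_mul, TensorProduct.add_tmul, map_add, ha, hb]
      | tmul a a' =>
        induction t using tensor_ind with
        | add a b ha hb =>
          simp only [mul_add, TensorProduct.tmul_add, TensorProduct.add_tmul, map_add, ha, hb]
        | tmul b b' =>
          rw [Algebra.TensorProduct.tmul_mul_tmul, TensorProduct.assoc_tmul,
            TensorProduct.assoc_tmul, TensorProduct.assoc_tmul, LeftComod.mm_tmul,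
            LinearMap.lTensor_tmul, LeftComod.mm_tmul]

variable (R : HeckeSymmetry k q V) (R' : HeckeSymmetry k q V') (X Y : LeftComod k (FRT R))

lemma mm_inclLeft_mem (x : (cotensorLeft R' R).obj X) (y : (cotensorLeft R' R).obj Y) :
    LeftComod.mm X Y (inclLeft R' R X x ⊗ₜ inclLeft R' R Y y) ∈
      LinearMap.range (inclLeft R' R (X ⊗ Y)) := by
  rw [mem_range_inclLeft]
  refine (splitL_mm R' R R _ _).trans ?_
  rw [splitL_inclLeft, splitL_inclLeft, LeftComod.mm_natural]
  exact (LinearMap.lTensor_comp_apply _ _ _ _).symm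

/-- The multiplication of the algebra `A(R', R)` applied to tensor products of elements of two
cotensor products. -/
def mmInclL : (cotensorLeft R' R).obj X ⊗[k] (cotensorLeft R' R).obj Y →ₗ[k]
    QHom R' R ⊗[k] (X ⊗[k] Y) :=
  LeftComod.mm X Y ∘ₗ TensorProduct.map (inclLeft R' R X) (inclLeft R' R Y)

lemma mmInclL_mem (z : (cotensorLeft R' R).obj X ⊗[k] (cotensorLeft R' R).obj Y) :
    mmInclL R R' X Y z ∈ LinearMap.range (inclLeft R' R (X ⊗ Y)) := by
  induction z using tensor_ind with
  | add a b ha hb => rw [map_add]; exact add_mem ha hb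
  | tmul x y => exact mm_inclLeft_mem R R' X Y x y

/-- The monoidal structure map `(A(R', R) □ X) ⊗ (A(R', R) □ Y) → A(R', R) □ (X ⊗ Y)`. -/
def tensoratorLinL : (cotensorLeft R' R).obj X ⊗[k] (cotensorLeft R' R).obj Y →ₗ[k]
    (cotensorLeft R' R).obj (X ⊗ Y) :=
  liftInj _ (inclLeft_injective R R' (X ⊗ Y)) (mmInclL R R' X Y) (mmInclL_mem R R' X Y)

lemma inclLeft_tensoratorLinL (x : (cotensorLeft R' R).obj X) (y : (cotensorLeft R' R).obj Y) :
    inclLeft R' R (X ⊗ Y) (tensoratorLinL R R' X Y (x ⊗ₜ y)) =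
      LeftComod.mm X Y (inclLeft R' R X x ⊗ₜ inclLeft R' R Y y) :=
  liftInj_spec _ (inclLeft_injective R R' (X ⊗ Y)) (mmInclL R R' X Y) (mmInclL_mem R R' X Y) _

lemma inclLeft_comp_tensoratorLinL :
    inclLeft R' R (X ⊗ Y) ∘ₗ tensoratorLinL R R' X Y = mmInclL R R' X Y :=
  TensorProduct.ext' (inclLeft_tensoratorLinL R R' X Y)

/-- The monoidal structure map as a homomorphism of comodules. -/
def tensoratorL : (cotensorLeft R' R).obj X ⊗ (cotensorLeft R' R).obj Y ⟶
    (cotensorLeft R' R).obj (X ⊗ Y) where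
  lin := tensoratorLinL R R' X Y
  comm := by
    refine TensorProduct.ext' fun x y => ?_
    apply lTensor_injective _ (inclLeft_injective R R' (X ⊗ Y))
    rw [LinearMap.comp_apply, LinearMap.comp_apply, inclLeft_coact, inclLeft_tensoratorLinL,
      ← LinearMap.lTensor_comp_apply]
    refine (splitL_mm R' R' R _ _).trans ?_
    rw [← inclLeft_coact, ← inclLeft_coact, LeftComod.mm_natural, ← LinearMap.lTensor_comp_apply]
    exact congrArg (fun f => LinearMap.lTensor _ f _) (inclLeft_comp_tensoratorLinL R R' X Y).symm

lemma one_tmul_mem (c : k) : (TensorProduct.mk k (QHom R' R) k 1) c ∈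
    LinearMap.range (inclLeft R' R (𝟙_ (LeftComod k (FRT R)))) := by
  rw [mem_range_inclLeft]
  change splitL R' R R k (1 ⊗ₜ c) = 1 ⊗ₜ (1 ⊗ₜ c)
  rw [splitL_tmul, map_one]; rfl

/-- The linear map `k → A(R', R) □ k`, `c ↦ 1 ⊗ c`. -/
def unitorLinL : k →ₗ[k] (cotensorLeft R' R).obj (𝟙_ (LeftComod k (FRT R))) :=
  liftInj _ (inclLeft_injective R R' (𝟙_ (LeftComod k (FRT R))))
    (TensorProduct.mk k (QHom R' R) k 1) (one_tmul_mem R R')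

lemma inclLeft_unitorLinL (c : k) :
    inclLeft R' R (𝟙_ (LeftComod k (FRT R))) (unitorLinL R R' c) = 1 ⊗ₜ c :=
  liftInj_spec _ (inclLeft_injective R R' (𝟙_ (LeftComod k (FRT R))))
    (TensorProduct.mk k (QHom R' R) k 1) (one_tmul_mem R R') c

/-- The map `k → A(R', R) □ k`, `c ↦ 1 ⊗ c`, as a homomorphism of comodules. -/
def unitorL : 𝟙_ (LeftComod k (FRT R')) ⟶
    (cotensorLeft R' R).obj (𝟙_ (LeftComod k (FRT R))) where
  lin := unitorLinL R R'
  comm := by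
    refine LinearMap.ext fun c => ?_
    apply lTensor_injective _ (inclLeft_injective R R' (𝟙_ (LeftComod k (FRT R))))
    change (inclLeft R' R (𝟙_ (LeftComod k (FRT R)))).lTensor _
      (LeftComod.coact _ (unitorLinL R R' c)) = (inclLeft R' R (𝟙_ (LeftComod k (FRT R)))).lTensor _
        (1 ⊗ₜ unitorLinL R R' c)
    rw [inclLeft_coact, LinearMap.lTensor_tmul, inclLeft_unitorLinL, splitL_tmul, map_one]
    rfl

lemma hom_ext_inclLeft {Z : LeftComod k (FRT R')} {X : LeftComod k (FRT R)}
    {f g : Z ⟶ (cotensorLeft R' R).obj X}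
    (h : inclLeft R' R X ∘ₗ f.lin = inclLeft R' R X ∘ₗ g.lin) : f = g := by
  ext1
  exact LinearMap.ext fun z => inclLeft_injective R R' X (LinearMap.congr_fun h z)

variable {R X Y} in
lemma inclLeft_tensoratorLinL_map {X' Y' : LeftComod k (FRT R)} (f : X ⟶ X') (g : Y ⟶ Y')
    (x : (cotensorLeft R' R).obj X) (y : (cotensorLeft R' R).obj Y) :
    inclLeft R' R (X' ⊗ Y') (tensoratorLinL R R' X' Y'
      (((cotensorLeft R' R).map f).lin x ⊗ₜ ((cotensorLeft R' R).map g).lin y)) =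
    inclLeft R' R (X' ⊗ Y') (((cotensorLeft R' R).map (f ⊗ₘ g)).lin
      (tensoratorLinL R R' X Y (x ⊗ₜ y))) := by
  rw [inclLeft_tensoratorLinL, inclLeft_map, inclLeft_map, inclLeft_map, inclLeft_tensoratorLinL,
    LeftComod.mm_natural]
  rfl

/-- The functor `A(R', R) □ ?` as a lax monoidal functor. -/
abbrev laxMonoidalL : (cotensorLeft R' R).LaxMonoidal where
  ε := unitorL R R'
  μ X Y := tensoratorL R R' X Y
  μ_natural_left {X Y} f Z := by
    refine hom_ext_inclLeft R R' (TensorProduct.ext' fun x z => ?_)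
    rw [← MonoidalCategory.tensorHom_id]
    refine Eq.trans ?_ (inclLeft_tensoratorLinL_map R' f (𝟙 Z) x z)
    rw [CategoryTheory.Functor.map_id]; rfl
  μ_natural_right {X Y} Z f := by
    refine hom_ext_inclLeft R R' (TensorProduct.ext' fun z x => ?_)
    rw [← MonoidalCategory.id_tensorHom]
    refine Eq.trans ?_ (inclLeft_tensoratorLinL_map R' (𝟙 Z) f z x)
    rw [CategoryTheory.Functor.map_id]; rfl
  associativity X Y Z := by
    refine hom_ext_inclLeft R R' (TensorProduct.ext_threefold fun x y z => ?_)
    change inclLeft R' R _ (((cotensorLeft R' R).map (α_ X Y Z).hom).lin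
      (tensoratorLinL R R' (X ⊗ Y) Z (tensoratorLinL R R' X Y (x ⊗ₜ y) ⊗ₜ z))) =
      inclLeft R' R _ (tensoratorLinL R R' X (Y ⊗ Z) (x ⊗ₜ tensoratorLinL R R' Y Z (y ⊗ₜ z)))
    rw [inclLeft_map, inclLeft_tensoratorLinL, inclLeft_tensoratorLinL, inclLeft_tensoratorLinL,
      inclLeft_tensoratorLinL]
    exact (LeftComod.mm_assoc _ _ _).symm
  left_unitality X := by
    refine hom_ext_inclLeft R R' (TensorProduct.ext' fun (c : k) x => ?_)
    change inclLeft R' R X (c • x) = inclLeft R' R _ (((cotensorLeft R' R).map (λ_ X).hom).lin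
      (tensoratorLinL R R' (𝟙_ _) X (unitorLinL R R' c ⊗ₜ x)))
    rw [inclLeft_map, inclLeft_tensoratorLinL, inclLeft_unitorLinL, map_smul]
    exact (LeftComod.mm_one_left c _).symm
  right_unitality X := by
    refine hom_ext_inclLeft R R' (TensorProduct.ext' fun x (c : k) => ?_)
    change inclLeft R' R X (c • x) = inclLeft R' R _ (((cotensorLeft R' R).map (ρ_ X).hom).lin
      (tensoratorLinL R R' X (𝟙_ _) (x ⊗ₜ unitorLinL R R' c)))
    rw [inclLeft_map, inclLeft_tensoratorLinL, inclLeft_unitorLinL, map_smul]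
    exact (LeftComod.mm_one_right _ c).symm

/-- The natural map `X → A(R, R') □ (A(R', R) □ X)` is monoidal. -/
lemma unitL_tensor (x : X) (y : Y) : unitL R R' (X ⊗ Y) (x ⊗ₜ y) =
    ((cotensorLeft R R').map (tensoratorL R R' X Y)).lin
      (tensoratorLinL R' R _ _ (unitL R R' X x ⊗ₜ unitL R R' Y y)) := by
  apply inclLeft_inclLeft_injective R R' (X ⊗ Y)
  change (inclLeft R' R (X ⊗ Y)).lTensor _ (inclLeft R R' _ (unitL R R' (X ⊗ Y) _)) =
    (inclLeft R' R (X ⊗ Y)).lTensor _ (inclLeft R R' _ _)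
  rw [unitL_spec, inclLeft_map, inclLeft_tensoratorLinL, ← LinearMap.lTensor_comp_apply]
  refine (splitL_mm R R' R (X.coact x) (Y.coact y)).trans ?_
  rw [← unitL_spec, ← unitL_spec, LeftComod.mm_natural, ← LinearMap.lTensor_comp_apply]
  exact congrArg (fun f => LinearMap.lTensor _ f _) (inclLeft_comp_tensoratorLinL R R' X Y).symm

lemma unitL_one (c : k) : unitL R R' (𝟙_ (LeftComod k (FRT R))) c =
    ((cotensorLeft R R').map (unitorL R R')).lin (unitorLinL R' R c) := by
  apply inclLeft_inclLeft_injective R R' (𝟙_ (LeftComod k (FRT R)))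
  change (inclLeft R' R (𝟙_ (LeftComod k (FRT R)))).lTensor _
      (inclLeft R R' _ (unitL R R' (𝟙_ (LeftComod k (FRT R))) c)) =
    (inclLeft R' R (𝟙_ (LeftComod k (FRT R)))).lTensor _ (inclLeft R R' _ _)
  rw [unitL_spec, inclLeft_map, inclLeft_unitorLinL, LinearMap.lTensor_tmul, LinearMap.lTensor_tmul]
  refine (splitL_tmul R R' R 1 c).trans ?_
  rw [map_one]
  exact congrArg (fun t => (1 : QHom R R') ⊗ₜ[k] t) (inclLeft_unitorLinL R R' c).symm

lemma unitIsoL_tensor (h : IsGeneratedBy R R') :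
    (((unitIsoL R R' h).hom.app X ⊗ₘ (unitIsoL R R' h).hom.app Y) ≫ tensoratorL R' R _ _) ≫
      (cotensorLeft R R').map (tensoratorL R R' X Y) = (unitIsoL R R' h).hom.app (X ⊗ Y) := by
  ext1
  exact TensorProduct.ext' fun x y => (unitL_tensor R R' X Y x y).symm

lemma unitIsoL_one (h : IsGeneratedBy R R') :
    unitorL R' R ≫ (cotensorLeft R R').map (unitorL R R') =
      (unitIsoL R R' h).hom.app (𝟙_ (LeftComod k (FRT R))) := by
  ext1
  exact LinearMap.ext fun c => (unitL_one R R' c).symm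

lemma epi_of_isIso_comp_map {C D : Type*} [Category C] [Category D] (G : D ⥤ C) [G.Faithful]
    {A : C} {B B' : D} (a : A ⟶ G.obj B) (b : B ⟶ B') [IsIso (a ≫ G.map b)] : Epi b :=
  have : Epi (G.map b) := epi_of_epi a _
  G.epi_of_epi_map this

lemma isIso_of_isIso_comp_map {C D : Type*} [Category C] [Category D] (G : D ⥤ C)
    [G.ReflectsIsomorphisms] {A : C} {B B' : D} (a : A ⟶ G.obj B) (b : B ⟶ B') [Epi a]
    [IsIso (a ≫ G.map b)] : IsIso b := by
  have : IsSplitMono a := IsSplitMono.mk' ⟨G.map b ≫ inv (a ≫ G.map b), by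
    rw [← Category.assoc, IsIso.hom_inv_id]⟩
  have : IsIso a := isIso_of_epi_of_isSplitMono a
  have : IsIso (G.map b) := IsIso.of_isIso_comp_left a _
  exact isIso_of_reflects_iso b G

lemma epi_tensoratorL (h : IsGeneratedBy R R') (h' : IsGeneratedBy R' R) :
    Epi (tensoratorL R R' X Y) := by
  have := isEquivalence_cotensorLeft R' R h' h
  have : IsIso ((((unitIsoL R R' h).hom.app X ⊗ₘ (unitIsoL R R' h).hom.app Y) ≫
      tensoratorL R' R _ _) ≫ (cotensorLeft R R').map (tensoratorL R R' X Y)) := by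
    rw [unitIsoL_tensor]; infer_instance
  exact epi_of_isIso_comp_map (cotensorLeft R R')
    (((unitIsoL R R' h).hom.app X ⊗ₘ (unitIsoL R R' h).hom.app Y) ≫ tensoratorL R' R _ _)
    (tensoratorL R R' X Y)

/-- The monoidal structure maps are invertible, as they are epimorphisms in both directions and
their composites are the components of the natural isomorphism `unitIsoL`. -/
lemma isIso_tensoratorL (h : IsGeneratedBy R R') (h' : IsGeneratedBy R' R) :
    IsIso (tensoratorL R R' X Y) := by
  have := isEquivalence_cotensorLeft R' R h' h
  have : IsIso ((((unitIsoL R R' h).hom.app X ⊗ₘ (unitIsoL R R' h).hom.app Y) ≫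
      tensoratorL R' R _ _) ≫ (cotensorLeft R R').map (tensoratorL R R' X Y)) := by
    rw [unitIsoL_tensor]; infer_instance
  have := epi_tensoratorL R' R ((cotensorLeft R' R).obj X) ((cotensorLeft R' R).obj Y) h' h
  have : Epi (((unitIsoL R R' h).hom.app X ⊗ₘ (unitIsoL R R' h).hom.app Y) ≫
      tensoratorL R' R _ _) := epi_comp _ _
  exact isIso_of_isIso_comp_map (cotensorLeft R R')
    (((unitIsoL R R' h).hom.app X ⊗ₘ (unitIsoL R R' h).hom.app Y) ≫ tensoratorL R' R _ _)
    (tensoratorL R R' X Y)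

lemma isIso_unitorL (h : IsGeneratedBy R R') (h' : IsGeneratedBy R' R) : IsIso (unitorL R R') := by
  have := isEquivalence_cotensorLeft R' R h' h
  have := isEquivalence_cotensorLeft R R' h h'
  have : IsIso (unitorL R' R ≫ (cotensorLeft R R').map (unitorL R R')) := by
    rw [unitIsoL_one R R' h]; infer_instance
  have : IsIso (unitorL R R' ≫ (cotensorLeft R' R).map (unitorL R' R)) := by
    rw [unitIsoL_one R' R h']; infer_instance
  have : Epi (unitorL R' R) := epi_of_isIso_comp_map (cotensorLeft R' R) (unitorL R R') _
  exact isIso_of_isIso_comp_map (cotensorLeft R R') (unitorL R' R) _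

end Left
end QHom

/-! ### A commutation relation in `A(R', R)` -/

namespace QHom

section Commutation

variable {k : Type u} [Field k] {q : k} {V₀ V₁ V₂ V₃ V V' : Type u}
  [AddCommGroup V₀] [Module k V₀] [Module.Finite k V₀]
  [AddCommGroup V₁] [Module k V₁] [Module.Finite k V₁]
  [AddCommGroup V₂] [Module k V₂] [Module.Finite k V₂]
  [AddCommGroup V₃] [Module k V₃] [Module.Finite k V₃]
  [AddCommGroup V] [Module k V] [Module.Finite k V]
  [AddCommGroup V'] [Module k V'] [Module.Finite k V']
  {R₀ : HeckeSymmetry k q V₀} {R₁ : HeckeSymmetry k q V₁} {R₂ : HeckeSymmetry k q V₂}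
  {R₃ : HeckeSymmetry k q V₃} {R : HeckeSymmetry k q V} {R' : HeckeSymmetry k q V'}
  {B : Type u} [Ring B] [Algebra k B]

/-- The convolution product of linear maps `A(R₀, R₁) → B` and `A(R₁, R₂) → B`. -/
def conv (f : QHom R₀ R₁ →ₗ[k] B) (g : QHom R₁ R₂ →ₗ[k] B) : QHom R₀ R₂ →ₗ[k] B :=
  LinearMap.mul' k B ∘ₗ TensorProduct.map f g ∘ₗ (comulHom R₀ R₁ R₂).toLinearMap

lemma conv_apply (f : QHom R₀ R₁ →ₗ[k] B) (g : QHom R₁ R₂ →ₗ[k] B) (a : QHom R₀ R₂) :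
    conv f g a = LinearMap.mul' k B (TensorProduct.map f g (comulHom R₀ R₁ R₂ a)) := rfl

lemma conv_assoc (f : QHom R₀ R₁ →ₗ[k] B) (g : QHom R₁ R₂ →ₗ[k] B) (h : QHom R₂ R₃ →ₗ[k] B) :
    conv (conv f g) h = conv f (conv g h) := by
  refine LinearMap.ext fun a => ?_
  have e := congrArg (LinearMap.mul' k B ∘ₗ TensorProduct.map f (LinearMap.mul' k B ∘ₗ
    TensorProduct.map g h)) (comulHom_coassoc_apply R₀ R₁ R₂ R₃ a)
  rw [conv_apply, conv_apply]
  refine Eq.trans ?_ (e.trans ?_)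
  · generalize comulHom R₀ R₂ R₃ a = t
    induction t using tensor_ind with
    | add a b ha hb => simp only [map_add, ha, hb]
    | tmul a b =>
      rw [TensorProduct.map_tmul, conv_apply, LinearMap.rTensor_tmul, AlgHom.toLinearMap_apply]
      generalize comulHom R₀ R₁ R₂ a = t
      induction t using tensor_ind with
      | add a b ha hb => simp only [TensorProduct.add_tmul, map_add, ha, hb]
      | tmul a b => simp [mul_assoc]
  · generalize comulHom R₀ R₁ R₃ a = t
    induction t using tensor_ind with
    | add a b ha hb => simp only [map_add, ha, hb]
    | tmul a b => simp [conv_apply]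

lemma conv_add_left (f f' : QHom R₀ R₁ →ₗ[k] B) (g : QHom R₁ R₂ →ₗ[k] B) :
    conv (f + f') g = conv f g + conv f' g := by
  rw [conv, TensorProduct.map_add_left, LinearMap.add_comp, LinearMap.comp_add]; rfl

lemma conv_add_right (f : QHom R₀ R₁ →ₗ[k] B) (g g' : QHom R₁ R₂ →ₗ[k] B) :
    conv f (g + g') = conv f g + conv f g' := by
  rw [conv, TensorProduct.map_add_right, LinearMap.add_comp, LinearMap.comp_add]; rfl

/-- The map that sends `c ⊗ b ∈ B ⊗ A(R)` to `a ↦ r(a, b) c`. -/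
def formSmul (R : HeckeSymmetry k q V) (B : Type u) [Ring B] [Algebra k B] :
    B ⊗[k] FRT R →ₗ[k] FRT R →ₗ[k] B :=
  TensorProduct.lift (LinearMap.mk₂ k (fun c b =>
      LinearMap.toSpanSingleton k B c ∘ₗ (FRT.formHom R.compat_op b).ofConv)
    (fun c c' b => by ext; simp) (fun r c b => by ext; simp [smul_comm r])
    (fun c b b' => by ext; simp [add_smul]) (fun r c b => by ext; simp [mul_smul]))

lemma formSmul_tmul (c : B) (b a : FRT R) :
    formSmul R B (c ⊗ₜ b) a = (FRT.formHom R.compat_op b).ofConv a • c := rfl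

lemma formSmul_algebraMap (c : k) :
    formSmul R B (algebraMap k _ c) = LinearMap.toSpanSingleton k B (c • 1) ∘ₗ counit := by
  refine LinearMap.ext fun a => ?_
  rw [Algebra.algebraMap_eq_smul_one, map_smul, LinearMap.smul_apply,
    Algebra.TensorProduct.one_def, formSmul_tmul, map_one]
  simp [smul_comm c]

lemma formSmul_mul (s t : B ⊗[k] FRT R) :
    formSmul R B (s * t) = conv (formSmul R B s) (formSmul R B t) := by
  induction s using tensor_ind with
  | add x y hx hy => rw [add_mul, map_add, map_add, conv_add_left, hx, hy]
  | tmul c b =>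
    induction t using tensor_ind with
    | add x y hx hy => rw [mul_add, map_add, map_add, conv_add_right, hx, hy]
    | tmul c' b' =>
      refine LinearMap.ext fun a => ?_
      rw [Algebra.TensorProduct.tmul_mul_tmul, formSmul_tmul, map_mul, LinearMap.convMul_apply,
        conv_apply]
      change LinearMap.mul' k k (TensorProduct.map _ _ (comulHom R R R a)) • _ = _
      generalize comulHom R R R a = u
      induction u using tensor_ind with
      | add x y hx hy => simp only [map_add, add_smul, hx, hy]
      | tmul x y => simp [formSmul_tmul, smul_smul, mul_comm]

lemma sum_quad_gen (ξ η : Module.Dual k V') (u : V ⊗[k] V) :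
    ∑ i, ∑ j, dualDistrib k V V ((Module.finBasis k V).coord i ⊗ₜ (Module.finBasis k V).coord j) u •
      (gen R' R (ξ ⊗ₜ Module.finBasis k V i) * gen R' R (η ⊗ₜ Module.finBasis k V j)) =
    quad (gen R' R) ((ξ ⊗ₜ η) ⊗ₜ u) := by
  conv_rhs => rw [← sum_expand u]
  simp only [TensorProduct.tmul_sum, TensorProduct.tmul_smul, map_sum, map_smul, quad_tmul]

lemma sum_gen_quad (β : Module.Dual k V' ⊗[k] Module.Dual k V') (v w : V) :
    ∑ i, ∑ j, dualDistrib k V' V' β (Module.finBasis k V' i ⊗ₜ Module.finBasis k V' j) •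
      (gen R' R ((Module.finBasis k V').coord i ⊗ₜ v) *
        gen R' R ((Module.finBasis k V').coord j ⊗ₜ w)) =
    quad (gen R' R) (β ⊗ₜ (v ⊗ₜ w)) := by
  conv_rhs => rw [← sum_dual_expand β]
  simp only [TensorProduct.sum_tmul, ← TensorProduct.smul_tmul', map_sum, map_smul, quad_tmul]

lemma sum_apply_smul_gen (ζ : Module.Dual k V') (w : V) :
    ∑ i, ζ (Module.finBasis k V' i) • gen R' R ((Module.finBasis k V').coord i ⊗ₜ w) =
      gen R' R (ζ ⊗ₜ w) := by
  conv_rhs => rw [← (Module.finBasis k V').sum_dual_apply_smul_coord ζ]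
  simp only [TensorProduct.sum_tmul, ← TensorProduct.smul_tmul', map_sum, map_smul]

lemma sum_repr_smul_gen (ζ : Module.Dual k V') (w : V) :
    ∑ i, (Module.finBasis k V).repr w i • gen R' R (ζ ⊗ₜ Module.finBasis k V i) =
      gen R' R (ζ ⊗ₜ w) := by
  conv_rhs => rw [← (Module.finBasis k V).sum_repr w]
  simp only [TensorProduct.tmul_sum, TensorProduct.tmul_smul, map_sum, map_smul]

/-- The map `x ⊗ η ↦ ∑ᵢ (η ⊗ eᵢ) x ⊗ eⁱ` from `A(R', R) ⊗ V'^*` to `A(R', R) ⊗ V^*`. -/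
def opM (R' : HeckeSymmetry k q V') (R : HeckeSymmetry k q V) :
    QHom R' R ⊗[k] Module.Dual k V' →ₗ[k] QHom R' R ⊗[k] Module.Dual k V :=
  TensorProduct.lift (LinearMap.mk₂ k (fun x η => ∑ i,
    (gen R' R (η ⊗ₜ Module.finBasis k V i) * x) ⊗ₜ[k] (Module.finBasis k V).coord i)
    (fun x y η => by simp only [mul_add, TensorProduct.add_tmul, Finset.sum_add_distrib])
    (fun c x η => by
      simp only [mul_smul_comm, ← TensorProduct.smul_tmul', ← Finset.smul_sum])
    (fun x η ζ => by
      simp only [TensorProduct.add_tmul, map_add, add_mul, Finset.sum_add_distrib])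
    (fun c x η => by
      simp only [← TensorProduct.smul_tmul', map_smul, smul_mul_assoc, ← Finset.smul_sum]))

lemma opM_tmul (x : QHom R' R) (η : Module.Dual k V') : opM R' R (x ⊗ₜ η) = ∑ i,
    (gen R' R (η ⊗ₜ Module.finBasis k V i) * x) ⊗ₜ[k] (Module.finBasis k V).coord i := rfl

/-- The representation of `B ⊗ A(R)` in `B ⊗ V^*`. -/
def repM (R : HeckeSymmetry k q V) (B : Type u) [Ring B] [Algebra k B] :
    B ⊗[k] FRT R →ₐ[k] Module.End k (B ⊗[k] Module.Dual k V) :=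
  (Module.endTensorEndAlgHom (R := k) (S := k) (A := k)).comp
    (Algebra.TensorProduct.map (Algebra.lmul k B) (FRT.mat R.compat_op))

lemma repM_tmul (b x : B) (a : FRT R) (η : Module.Dual k V) :
    repM R B (b ⊗ₜ a) (x ⊗ₜ η) = (b * x) ⊗ₜ FRT.mat R.compat_op a η := rfl

/-- The left coaction of `A(R')` on `A(R', R)`, with the tensor factors interchanged. -/
def lcoactComm (R' : HeckeSymmetry k q V') (R : HeckeSymmetry k q V) :
    QHom R' R →ₐ[k] QHom R' R ⊗[k] FRT R' :=
  (Algebra.TensorProduct.comm k (FRT R') (QHom R' R)).toAlgHom.comp (comulHom R' R' R)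

lemma lcoactComm_apply (a : QHom R' R) :
    lcoactComm R' R a = TensorProduct.comm k _ _ (comulHom R' R' R a) := rfl

/-- For generators, `opM_repM` amounts to the defining relations of `A(R', R)`. -/
lemma opM_gen (ξ : Module.Dual k V') (v : V) :
    opM R' R ∘ₗ repM R' (QHom R' R) (lcoactComm R' R (gen R' R (ξ ⊗ₜ v))) =
      repM R (QHom R' R) (comulHom R' R R (gen R' R (ξ ⊗ₜ v))) ∘ₗ opM R' R := by
  refine TensorProduct.ext' fun x η => ?_
  rw [lcoactComm_apply, comulHom_gen, comulHom_gen]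
  simp only [LinearMap.comp_apply, map_sum, TensorProduct.comm_tmul, LinearMap.sum_apply,
    repM_tmul, opM_tmul]
  have e1 : ∀ i, ∑ l, gen R' R (FRT.mat R'.compat_op (gen R' R' (ξ ⊗ₜ Module.finBasis k V' l)) η ⊗ₜ
      Module.finBasis k V i) * gen R' R ((Module.finBasis k V').coord l ⊗ₜ v) =
      quad (gen R' R) (adjointOp R'.op (ξ ⊗ₜ η) ⊗ₜ (Module.finBasis k V i ⊗ₜ v)) := by
    intro i
    rw [← sum_gen_quad, Finset.sum_comm]
    refine Finset.sum_congr rfl fun l _ => ?_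
    conv_lhs => rw [← (Module.finBasis k V').sum_dual_apply_smul_coord
      (FRT.mat R'.compat_op (gen R' R' (ξ ⊗ₜ Module.finBasis k V' l)) η)]
    simp only [TensorProduct.sum_tmul, ← TensorProduct.smul_tmul', map_sum, map_smul,
      Finset.sum_mul, smul_mul_assoc, FRT.mat_gen, dualDistrib_adjointOp]
  have e2 : ∀ m, ∑ l, ∑ i, FRT.mat R.compat_op (gen R R ((Module.finBasis k V).coord l ⊗ₜ v))
      ((Module.finBasis k V).coord i) (Module.finBasis k V m) •
      (gen R' R (ξ ⊗ₜ Module.finBasis k V l) * gen R' R (η ⊗ₜ Module.finBasis k V i)) =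
      quad (gen R' R) ((ξ ⊗ₜ η) ⊗ₜ R.op (Module.finBasis k V m ⊗ₜ v)) := by
    intro m
    rw [← sum_quad_gen]
    simp only [FRT.mat_gen]
  calc _ = ∑ i, (∑ l, gen R' R (FRT.mat R'.compat_op
        (gen R' R' (ξ ⊗ₜ Module.finBasis k V' l)) η ⊗ₜ Module.finBasis k V i) *
          gen R' R ((Module.finBasis k V').coord l ⊗ₜ v) * x) ⊗ₜ[k]
            (Module.finBasis k V).coord i := by
        rw [Finset.sum_comm]
        simp only [TensorProduct.sum_tmul, mul_assoc]
    _ = ∑ m, ((∑ l, ∑ i, FRT.mat R.compat_op (gen R R ((Module.finBasis k V).coord l ⊗ₜ v))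
      ((Module.finBasis k V).coord i) (Module.finBasis k V m) •
      (gen R' R (ξ ⊗ₜ Module.finBasis k V l) *
        gen R' R (η ⊗ₜ Module.finBasis k V i))) * x) ⊗ₜ[k] (Module.finBasis k V).coord m := by
        refine Finset.sum_congr rfl fun i _ => ?_
        rw [← Finset.sum_mul, e1, e2, quad_gen_rel]
    _ = _ := by
        have e3 : ∀ l i, (gen R' R (ξ ⊗ₜ Module.finBasis k V l) *
            (gen R' R (η ⊗ₜ Module.finBasis k V i) * x)) ⊗ₜ[k]
            FRT.mat R.compat_op (gen R R ((Module.finBasis k V).coord l ⊗ₜ v))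
              ((Module.finBasis k V).coord i) =
            ∑ m, (FRT.mat R.compat_op (gen R R ((Module.finBasis k V).coord l ⊗ₜ v))
              ((Module.finBasis k V).coord i) (Module.finBasis k V m) •
              (gen R' R (ξ ⊗ₜ Module.finBasis k V l) *
              (gen R' R (η ⊗ₜ Module.finBasis k V i) * x))) ⊗ₜ[k]
              (Module.finBasis k V).coord m := by
          intro l i
          conv_lhs => rw [← (Module.finBasis k V).sum_dual_apply_smul_coord
            (FRT.mat R.compat_op (gen R R ((Module.finBasis k V).coord l ⊗ₜ v))
              ((Module.finBasis k V).coord i))]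
          simp only [TensorProduct.tmul_sum, TensorProduct.tmul_smul,
            ← TensorProduct.smul_tmul']
        simp only [e3, Finset.sum_mul, smul_mul_assoc, mul_assoc, TensorProduct.sum_tmul]
        conv_lhs => enter [2, m]; rw [Finset.sum_comm]
        rw [Finset.sum_comm]
        refine Finset.sum_congr rfl fun i _ => ?_
        rw [Finset.sum_comm]

/-- The map `opM` intertwines the actions of `A(R', R)` on `A(R', R) ⊗ V'^*` and `A(R', R) ⊗ V^*`
through its two coactions. -/
lemma opM_repM (a : QHom R' R) :
    opM R' R ∘ₗ repM R' (QHom R' R) (lcoactComm R' R a) =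
      repM R (QHom R' R) (comulHom R' R R a) ∘ₗ opM R' R := by
  induction a using QHom.induction with
  | h0 c =>
    rw [AlgHom.commutes, AlgHom.commutes, AlgHom.commutes, AlgHom.commutes]
    exact LinearMap.ext fun x => (opM R' R).map_smul c x
  | h1 ξ v => exact opM_gen ξ v
  | hmul a b ha hb =>
    rw [map_mul, map_mul, map_mul, map_mul, Module.End.mul_eq_comp, Module.End.mul_eq_comp,
      ← LinearMap.comp_assoc, ha, LinearMap.comp_assoc, hb, LinearMap.comp_assoc]
  | hadd a b ha hb =>
    rw [map_add, map_add, map_add, map_add, LinearMap.comp_add, LinearMap.add_comp, ha, hb]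

/-- The identity `r'(a₍₋₁₎, b₍₋₁₎) b₍₀₎ a₍₀₎ = a₍₀₎ b₍₀₎ r(a₍₁₎, b₍₁₎)` in `A(R', R)`, written as an
equality of linear maps in `a`. In this form it is multiplicative in `b`, so that it suffices to
check it for generators `b`; there it is equivalent to `opM_repM`. -/
lemma conv_formSmul (b : QHom R' R) :
    conv (formSmul R' (QHom R' R) (lcoactComm R' R b)) LinearMap.id =
      conv LinearMap.id (formSmul R (QHom R' R) (comulHom R' R R b)) := by
  induction b using QHom.induction with
  | h0 c =>
    rw [AlgHom.commutes, AlgHom.commutes]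
    refine LinearMap.ext fun a => ?_
    rw [conv_apply, conv_apply, formSmul_algebraMap, formSmul_algebraMap]
    have e1 := (bicomod R' R).left.counit_apply a
    have e2 := (bicomod R' R).right.counit_apply a
    trans c • a
    · conv_rhs => rw [← e1]
      change _ = c • TensorProduct.lid k _ (counit.rTensor _ (comulHom R' R' R a))
      generalize comulHom R' R' R a = s
      induction s using tensor_ind with
      | add x y hx hy => simp only [map_add, smul_add, hx, hy]
      | tmul x y => simp [smul_comm c]
    · conv_lhs => rw [← e2]
      change c • TensorProduct.rid k _ (counit.lTensor _ (comulHom R' R R a)) = _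
      generalize comulHom R' R R a = s
      induction s using tensor_ind with
      | add x y hx hy => simp only [map_add, smul_add, hx, hy]
      | tmul x y => simp [smul_smul, mul_comm]
  | hadd a b ha hb => 
    rw [map_add (lcoactComm R' R), map_add (comulHom R' R R), map_add (formSmul R' _),
      map_add (formSmul R _), conv_add_left, conv_add_right, ha, hb]
  | hmul a b ha hb =>
    rw [map_mul (lcoactComm R' R), map_mul (comulHom R' R R), formSmul_mul, formSmul_mul,
      conv_assoc, hb, ← conv_assoc, ha, conv_assoc]
  | h1 η w =>
    refine LinearMap.ext fun a => ?_
    -- For `b = η ⊗ w` both sides at `a` are obtained from the two sides of `opM_repM`, applied to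
    -- `1 ⊗ η`, by pairing the factor `V^*` with `w`.
    have h := congrArg (fun f => TensorProduct.rid k (QHom R' R)
      ((Module.Dual.eval k V w).lTensor (QHom R' R) (f (1 ⊗ₜ η)))) (opM_repM a)
    simp only [LinearMap.comp_apply] at h
    have e1 : ∀ s : FRT R' ⊗[k] QHom R' R, LinearMap.mul' k (QHom R' R) (TensorProduct.map
        (formSmul R' (QHom R' R) (lcoactComm R' R (gen R' R (η ⊗ₜ w)))) LinearMap.id s) =
        TensorProduct.rid k (QHom R' R) ((Module.Dual.eval k V w).lTensor (QHom R' R)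
          (opM R' R (repM R' (QHom R' R) (TensorProduct.comm k _ _ s) (1 ⊗ₜ η)))) := by
      intro s
      induction s using tensor_ind with
      | add x y hx hy => simp only [map_add, LinearMap.add_apply, hx, hy]
      | tmul x y =>
        simp only [TensorProduct.map_tmul, lcoactComm_apply, comulHom_gen, TensorProduct.comm_tmul,
          repM_tmul, opM_tmul, map_sum, LinearMap.sum_apply, LinearMap.lTensor_tmul,
          TensorProduct.rid_tmul, formSmul_tmul, FRT.formHom_gen, LinearMap.mul'_apply,
          LinearMap.id_apply, mul_one, Module.Dual.eval_apply, Module.Basis.coord_apply]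
        rw [sum_apply_smul_gen, ← sum_repr_smul_gen _ w, Finset.sum_mul]
        simp only [smul_mul_assoc]
    have e2 : ∀ s : QHom R' R ⊗[k] FRT R, LinearMap.mul' k (QHom R' R) (TensorProduct.map
        LinearMap.id (formSmul R (QHom R' R) (comulHom R' R R (gen R' R (η ⊗ₜ w)))) s) =
        TensorProduct.rid k (QHom R' R) ((Module.Dual.eval k V w).lTensor (QHom R' R)
          (repM R (QHom R' R) s (opM R' R (1 ⊗ₜ η)))) := by
      intro s
      induction s using tensor_ind with
      | add x y hx hy => simp only [map_add, LinearMap.add_apply, hx, hy]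
      | tmul x y =>
        simp only [TensorProduct.map_tmul, comulHom_gen,
          repM_tmul, opM_tmul, map_sum, LinearMap.sum_apply, LinearMap.lTensor_tmul,
          TensorProduct.rid_tmul, formSmul_tmul, FRT.formHom_gen, LinearMap.mul'_apply,
          LinearMap.id_apply, mul_one, Module.Dual.eval_apply]
        rw [Finset.mul_sum]
        simp only [mul_smul_comm]
    exact (e1 _).trans (h.trans (e2 _).symm)

end Commutation
end QHom

/-! ### The braiding of left comodules -/

namespace QHom

variable {k : Type u} [Field k] {q : k} {V V' : Type u}
  [AddCommGroup V] [Module k V] [Module.Finite k V]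
  [AddCommGroup V'] [Module k V'] [Module.Finite k V']

section Swap

variable {A M N M' N' : Type u} [Ring A] [Bialgebra k A] [Coquasitriangular k A]
  [AddCommGroup M] [Module k M] [AddCommGroup N] [Module k N]
  [AddCommGroup M'] [Module k M'] [AddCommGroup N'] [Module k N']

/-- The map `(a ⊗ x) ⊗ (b ⊗ y) ↦ r(a, b) y ⊗ x` from which the braiding of left comodules is
obtained. In contrast to `LeftComod.braidAux`, it is defined for vector spaces. -/
def swapL (A M N : Type u) [Ring A] [Bialgebra k A] [Coquasitriangular k A]
    [AddCommGroup M] [Module k M] [AddCommGroup N] [Module k N] :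
    (A ⊗[k] M) ⊗[k] (A ⊗[k] N) →ₗ[k] N ⊗[k] M :=
  (TensorProduct.comm k M N).toLinearMap ∘ₗ (TensorProduct.lid k (M ⊗[k] N)).toLinearMap ∘ₗ
    Coquasitriangular.r.rTensor (M ⊗[k] N) ∘ₗ (tensorTensorTensorComm k A M A N).toLinearMap

lemma swapL_tmul (a b : A) (x : M) (y : N) : swapL A M N ((a ⊗ₜ[k] x) ⊗ₜ (b ⊗ₜ[k] y)) =
    Coquasitriangular.r (k := k) (a ⊗ₜ b) • (y ⊗ₜ x) := by
  simp [swapL]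

lemma map_swapL (f : M →ₗ[k] M') (g : N →ₗ[k] N') (s : A ⊗[k] M) (t : A ⊗[k] N) :
    TensorProduct.map g f (swapL A M N (s ⊗ₜ t)) =
      swapL A M' N' (f.lTensor A s ⊗ₜ g.lTensor A t) := by
  induction s using tensor_ind with
  | add a b ha hb => simp only [TensorProduct.add_tmul, map_add, ha, hb]
  | tmul c x =>
    induction t using tensor_ind with
    | add a b ha hb => simp only [TensorProduct.tmul_add, map_add, ha, hb]
    | tmul d y => simp [swapL_tmul]

end Swap

section Left

variable (R : HeckeSymmetry k q V) (R' : HeckeSymmetry k q V') {X Y : Type u}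
  [AddCommGroup X] [Module k X] [AddCommGroup Y] [Module k Y]

lemma mm_swapL (u v : FRT R' ⊗[k] QHom R' R) (x : X) (y : Y) :
    LeftComod.mm Y X (swapL (FRT R') (QHom R' R ⊗[k] X) (QHom R' R ⊗[k] Y)
      (TensorProduct.assoc k _ _ _ (u ⊗ₜ x) ⊗ₜ TensorProduct.assoc k _ _ _ (v ⊗ₜ y))) =
    LinearMap.mul' k _ (TensorProduct.map (formSmul R' (QHom R' R) (TensorProduct.comm k _ _ v))
      LinearMap.id u) ⊗ₜ (y ⊗ₜ x) := by
  induction u using tensor_ind with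
  | add a b ha hb => simp only [TensorProduct.add_tmul, map_add, ha, hb]
  | tmul c a =>
    induction v using tensor_ind with
    | add a b ha hb =>
      simp only [TensorProduct.tmul_add, TensorProduct.add_tmul, map_add, ha, hb,
        TensorProduct.map_add_left, LinearMap.add_apply]
    | tmul d b =>
      rw [TensorProduct.assoc_tmul, TensorProduct.assoc_tmul, swapL_tmul, map_smul,
        TensorProduct.map_tmul, LinearMap.mul'_apply, TensorProduct.comm_tmul, formSmul_tmul,
        smul_mul_assoc, ← TensorProduct.smul_tmul']
      exact congrArg (_ • ·) (LeftComod.mm_tmul _ _ _ _)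

lemma lTensor_swapL_mm (u v : QHom R' R ⊗[k] FRT R) (x : X) (y : Y) :
    (swapL (FRT R) X Y).lTensor (QHom R' R) (LeftComod.mm _ _
      (TensorProduct.assoc k _ _ _ (u ⊗ₜ x) ⊗ₜ TensorProduct.assoc k _ _ _ (v ⊗ₜ y))) =
    LinearMap.mul' k _ (TensorProduct.map LinearMap.id (formSmul R (QHom R' R) v) u) ⊗ₜ
      (y ⊗ₜ x) := by
  induction u using tensor_ind with
  | add a b ha hb => simp only [TensorProduct.add_tmul, map_add, ha, hb]
  | tmul a c =>
    induction v using tensor_ind with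
    | add a b ha hb =>
      simp only [TensorProduct.tmul_add, TensorProduct.add_tmul, map_add, ha, hb,
        TensorProduct.map_add_right, LinearMap.add_apply]
    | tmul b d =>
      rw [TensorProduct.assoc_tmul, TensorProduct.assoc_tmul, LeftComod.mm_tmul,
        LinearMap.lTensor_tmul, swapL_tmul, TensorProduct.map_tmul,
        LinearMap.mul'_apply, formSmul_tmul, mul_smul_comm, TensorProduct.tmul_smul,
        ← TensorProduct.smul_tmul']
      rfl

/-- The commutation relation `conv_formSmul`, with coefficients in vector spaces. -/
lemma mm_swapL_splitL (s : QHom R' R ⊗[k] X) (t : QHom R' R ⊗[k] Y) :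
    LeftComod.mm Y X (swapL (FRT R') (QHom R' R ⊗[k] X) (QHom R' R ⊗[k] Y)
      (splitL R' R' R X s ⊗ₜ splitL R' R' R Y t)) =
    (swapL (FRT R) X Y).lTensor (QHom R' R) (LeftComod.mm _ _
      (splitL R' R R X s ⊗ₜ splitL R' R R Y t)) := by
  induction s using tensor_ind with
  | add a b ha hb => simp only [TensorProduct.add_tmul, map_add, ha, hb]
  | tmul a x =>
    induction t using tensor_ind with
    | add a b ha hb => simp only [TensorProduct.tmul_add, map_add, ha, hb]
    | tmul b y =>
      refine (mm_swapL R R' _ _ x y).trans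
        (Eq.trans ?_ (lTensor_swapL_mm R R' _ _ x y).symm)
      exact congrArg (· ⊗ₜ[k] (y ⊗ₜ[k] x)) (LinearMap.congr_fun (conv_formSmul b) a)

variable (X Y : LeftComod k (FRT R))

lemma tensoratorL_braiding : tensoratorL R R' X Y ≫ (cotensorLeft R' R).map (β_ X Y).hom =
    (β_ ((cotensorLeft R' R).obj X) ((cotensorLeft R' R).obj Y)).hom ≫ tensoratorL R R' Y X := by
  refine hom_ext_inclLeft R R' (TensorProduct.ext' fun x y => ?_)
  change inclLeft R' R (Y ⊗ X) (((cotensorLeft R' R).map (β_ X Y).hom).lin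
    (tensoratorLinL R R' X Y (x ⊗ₜ y))) =
    inclLeft R' R (Y ⊗ X) (tensoratorLinL R R' Y X (swapL (FRT R') _ _
      (((cotensorLeft R' R).obj X).coact x ⊗ₜ ((cotensorLeft R' R).obj Y).coact y)))
  rw [inclLeft_map, inclLeft_tensoratorLinL]
  refine Eq.trans ?_ (LinearMap.congr_fun (inclLeft_comp_tensoratorLinL R R' Y X) _).symm
  rw [mmInclL, LinearMap.comp_apply]
  refine Eq.trans ?_ (congrArg (LeftComod.mm Y X) (map_swapL (inclLeft R' R X)
    (inclLeft R' R Y) _ _)).symm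
  rw [inclLeft_coact, inclLeft_coact, mm_swapL_splitL, splitL_inclLeft, splitL_inclLeft,
    LeftComod.mm_natural, ← LinearMap.lTensor_comp_apply]
  exact congrArg (fun f => LinearMap.lTensor (QHom R' R) f _)
    (TensorProduct.ext' fun x y => LeftComod.braidLin_tmul X Y x y)

/-- The functor `A(R', R) □ ?` as a braided monoidal functor. -/
abbrev braidedL (h : IsGeneratedBy R R') (h' : IsGeneratedBy R' R) :
    (cotensorLeft R' R).Braided :=
  letI := laxMonoidalL R R'
  haveI : IsIso (Functor.LaxMonoidal.ε (cotensorLeft R' R)) := isIso_unitorL R R' h h'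
  haveI : ∀ X Y, IsIso (Functor.LaxMonoidal.μ (cotensorLeft R' R) X Y) :=
    fun X Y => isIso_tensoratorL R R' X Y h h'
  { Functor.Monoidal.ofLaxMonoidal (cotensorLeft R' R) with
    braided := fun X Y => tensoratorL_braiding R R' X Y }

end Left
end QHom

/-! ### The equivalence of categories of right comodules -/

namespace QHom

variable {k : Type u} [Field k] {q : k} {V₀ V₁ V₂ V₃ V V' : Type u}
  [AddCommGroup V₀] [Module k V₀] [Module.Finite k V₀]
  [AddCommGroup V₁] [Module k V₁] [Module.Finite k V₁]
  [AddCommGroup V₂] [Module k V₂] [Module.Finite k V₂]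
  [AddCommGroup V₃] [Module k V₃] [Module.Finite k V₃]
  [AddCommGroup V] [Module k V] [Module.Finite k V]
  [AddCommGroup V'] [Module k V'] [Module.Finite k V']

section Right

/-- The map `x ⊗ a ↦ x ⊗ Δ(a)` from `X ⊗ A(R₀, R₂)` to `(X ⊗ A(R₀, R₁)) ⊗ A(R₁, R₂)`; the
counterpart of `splitL` for right comodules. -/
def splitR (R₀ : HeckeSymmetry k q V₀) (R₁ : HeckeSymmetry k q V₁) (R₂ : HeckeSymmetry k q V₂)
    (X : Type u) [AddCommGroup X] [Module k X] :
    X ⊗[k] QHom R₀ R₂ →ₗ[k] (X ⊗[k] QHom R₀ R₁) ⊗[k] QHom R₁ R₂ :=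
  (TensorProduct.assoc k _ _ _).symm.toLinearMap ∘ₗ (comulHom R₀ R₁ R₂).toLinearMap.lTensor X

variable {X Y : Type u} [AddCommGroup X] [Module k X] [AddCommGroup Y] [Module k Y]

lemma splitR_tmul (R₀ : HeckeSymmetry k q V₀) (R₁ : HeckeSymmetry k q V₁)
    (R₂ : HeckeSymmetry k q V₂) (a : QHom R₀ R₂) (x : X) :
    splitR R₀ R₁ R₂ X (x ⊗ₜ a) = (TensorProduct.assoc k _ _ _).symm (x ⊗ₜ comulHom R₀ R₁ R₂ a) :=
  rfl

lemma splitR_natural (R₀ : HeckeSymmetry k q V₀) (R₁ : HeckeSymmetry k q V₁)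
    (R₂ : HeckeSymmetry k q V₂) (f : X →ₗ[k] Y) (s : X ⊗[k] QHom R₀ R₂) :
    splitR R₀ R₁ R₂ Y (f.rTensor _ s) = (f.rTensor _).rTensor _ (splitR R₀ R₁ R₂ X s) := by
  induction s using tensor_ind with
  | add a b ha hb => simp only [map_add, ha, hb]
  | tmul x a =>
    rw [LinearMap.rTensor_tmul, splitR_tmul, splitR_tmul]
    generalize comulHom R₀ R₁ R₂ a = t
    induction t using tensor_ind with
    | add a b ha hb => simp only [TensorProduct.tmul_add, map_add, ha, hb]
    | tmul a b => simp

lemma splitR_splitR (R₀ : HeckeSymmetry k q V₀) (R₁ : HeckeSymmetry k q V₁)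
    (R₂ : HeckeSymmetry k q V₂) (R₃ : HeckeSymmetry k q V₃) (s : X ⊗[k] QHom R₀ R₃) :
    splitR R₁ R₂ R₃ _ (splitR R₀ R₁ R₃ X s) =
      (splitR R₀ R₁ R₂ X).rTensor _ (splitR R₀ R₂ R₃ X s) := by
  induction s using tensor_ind with
  | add a b ha hb => simp only [map_add, ha, hb]
  | tmul x a =>
    rw [splitR_tmul, splitR_tmul]
    have h := congrArg (fun t => (TensorProduct.assoc k (X ⊗[k] QHom R₀ R₁) (QHom R₁ R₂)
      (QHom R₂ R₃)).symm ((TensorProduct.assoc k X (QHom R₀ R₁) (QHom R₁ R₂ ⊗[k] QHom R₂ R₃)).symm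
        (x ⊗ₜ[k] t))) (comulHom_coassoc_apply R₀ R₁ R₂ R₃ a)
    refine Eq.trans ?_ (h.symm.trans ?_)
    · generalize comulHom R₀ R₁ R₃ a = t
      induction t using tensor_ind with
      | add a b ha hb => simp only [TensorProduct.tmul_add, map_add, ha, hb]
      | tmul a b => rfl
    · generalize comulHom R₀ R₂ R₃ a = t
      induction t using tensor_ind with
      | add a b ha hb => simp only [TensorProduct.tmul_add, map_add, ha, hb]
      | tmul a b =>
        rw [TensorProduct.assoc_symm_tmul, LinearMap.rTensor_tmul, LinearMap.rTensor_tmul,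
          splitR_tmul, AlgHom.toLinearMap_apply]
        generalize comulHom R₀ R₁ R₂ a = t
        induction t using tensor_ind with
        | add a b ha hb =>
          simp only [TensorProduct.add_tmul, TensorProduct.tmul_add, map_add, ha, hb]
        | tmul a b => simp

lemma counit_splitR (R : HeckeSymmetry k q V) (R₁ : HeckeSymmetry k q V₁) (s : X ⊗[k] QHom R₁ R) :
    TensorProduct.rid k _ ((counitHom R).toLinearMap.lTensor _ (splitR R₁ R R X s)) = s := by
  induction s using tensor_ind with
  | add a b ha hb => simp only [map_add, ha, hb]
  | tmul x a =>
    have h := congrArg (fun t => x ⊗ₜ[k] t) ((bicomod R₁ R).right.counit_apply a)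
    refine Eq.trans ?_ h
    change _ = x ⊗ₜ[k] (TensorProduct.rid k _ ((counitHom R).toLinearMap.lTensor _
      (comulHom R₁ R R a)))
    rw [splitR_tmul]
    generalize comulHom R₁ R R a = t
    induction t using tensor_ind with
    | add a b ha hb => simp only [TensorProduct.tmul_add, map_add, ha, hb]
    | tmul a b => simp

lemma splitR_coact (R : HeckeSymmetry k q V) (X : RightComod k (FRT R)) (x : X) :
    splitR R R R X (X.coact x) = X.coact.rTensor _ (X.coact x) :=
  (TensorProduct.assoc k _ _ _).symm_apply_eq.2 (X.coassoc_apply x).symm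

variable (R : HeckeSymmetry k q V) (R' : HeckeSymmetry k q V') (X : RightComod k (FRT R))

lemma inclRight_injective : Function.Injective (inclRight R R' X) := Subtype.val_injective

lemma mem_range_inclRight (z : X ⊗[k] QHom R R') : z ∈ LinearMap.range (inclRight R R' X) ↔
    splitR R R R' X z = X.coact.rTensor _ z := by
  have h : z ∈ LinearMap.range (inclRight R R' X) ↔ z ∈ cotensor X (bicomod R R').left := by
    rw [← Submodule.range_subtype (cotensor X (bicomod R R').left)]; rfl
  rw [h]
  rw [eq_comm]
  exact sub_eq_zero.trans (TensorProduct.assoc k X (FRT R) (QHom R R')).eq_symm_apply.symm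

lemma splitR_inclRight (y : (cotensorRight R R').obj X) :
    splitR R R R' X (inclRight R R' X y) = X.coact.rTensor _ (inclRight R R' X y) :=
  (mem_range_inclRight R R' X _).1 ⟨y, rfl⟩

lemma inclRight_coact (y : (cotensorRight R R').obj X) :
    (inclRight R R' X).rTensor _ (((cotensorRight R R').obj X).coact y) =
      splitR R R' R' X (inclRight R R' X y) :=
  RightComod.sub_coact ((bicomod R R').rightTensor X) (cotensor X (bicomod R R').left) _ y

variable {R X} in
lemma inclRight_map {Y : RightComod k (FRT R)} (f : X ⟶ Y) (y : (cotensorRight R R').obj X) :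
    inclRight R R' Y (((cotensorRight R R').map f).lin y) = f.lin.rTensor _ (inclRight R R' X y) :=
  rfl

/-- The functor `? ⊗ P` preserves the equalizer `X □ A(R, R')`. -/
lemma mem_range_rTensor_inclRight (P : Type u) [AddCommGroup P] [Module k P]
    (z : (X ⊗[k] QHom R R') ⊗[k] P)
    (hz : (splitR R R R' X).rTensor P z = (X.coact.rTensor _).rTensor P z) :
    z ∈ LinearMap.range ((inclRight R R' X).rTensor P) := by
  have hex : Function.Exact (inclRight R R' X) (splitR R R R' X - X.coact.rTensor (QHom R R')) := by
    intro z
    rw [LinearMap.sub_apply, sub_eq_zero]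
    exact (mem_range_inclRight R R' X z).symm
  refine (Module.Flat.rTensor_exact P hex z).1 ?_
  rw [LinearMap.rTensor_sub]
  exact sub_eq_zero.2 hz

/-- The map `x ↦ x₍₀₎ ⊗ Δ(x₍₁₎)` into `(X ⊗ A(R, R')) ⊗ A(R', R)`. -/
def unitAuxR : X →ₗ[k] (X ⊗[k] QHom R R') ⊗[k] QHom R' R := splitR R R' R X ∘ₗ X.coact

lemma unitAuxR_apply (x : X) : unitAuxR R R' X x = splitR R R' R X (X.coact x) := rfl

lemma unitAuxR_mem₁ (x : X) :
    unitAuxR R R' X x ∈ LinearMap.range ((inclRight R R' X).rTensor (QHom R' R)) := by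
  refine mem_range_rTensor_inclRight R R' X _ _ ?_
  rw [unitAuxR_apply, ← splitR_splitR, splitR_coact, splitR_natural]

lemma unitAuxR_mem₂ (x : X) : unitAuxR R R' X x ∈ LinearMap.range
    ((inclRight R R' X).rTensor (QHom R' R) ∘ₗ inclRight R' R ((cotensorRight R R').obj X)) := by
  obtain ⟨y, hy⟩ := unitAuxR_mem₁ R R' X x
  have h : y ∈ LinearMap.range (inclRight R' R ((cotensorRight R R').obj X)) := by
    rw [mem_range_inclRight]
    apply rTensor_injective _ (rTensor_injective _ (inclRight_injective R R' X))
    rw [← splitR_natural, hy, unitAuxR_apply, splitR_splitR, ← unitAuxR_apply, ← hy,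
      ← LinearMap.rTensor_comp_apply, ← LinearMap.rTensor_comp_apply]
    exact congrArg (fun f => LinearMap.rTensor _ f y) (LinearMap.ext fun w =>
      (inclRight_coact R R' X w).symm)
  obtain ⟨z, rfl⟩ := h
  exact ⟨z, hy⟩

lemma inclRight_inclRight_injective : Function.Injective
    ((inclRight R R' X).rTensor (QHom R' R) ∘ₗ inclRight R' R ((cotensorRight R R').obj X)) :=
  (rTensor_injective _ (inclRight_injective R R' X)).comp (inclRight_injective R' R _)

/-- The map `X → (X □ A(R, R')) □ A(R', R)` induced by `Δ`. -/
def unitR : X →ₗ[k] (cotensorRight R' R).obj ((cotensorRight R R').obj X) :=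
  liftInj _ (inclRight_inclRight_injective R R' X) (unitAuxR R R' X) (unitAuxR_mem₂ R R' X)

lemma unitR_spec (x : X) : (inclRight R R' X).rTensor _ (inclRight R' R _ (unitR R R' X x)) =
    splitR R R' R X (X.coact x) :=
  liftInj_spec _ (inclRight_inclRight_injective R R' X) (unitAuxR R R' X) (unitAuxR_mem₂ R R' X) x

lemma unitR_colinear (x : X) :
    ((cotensorRight R' R).obj ((cotensorRight R R').obj X)).coact (unitR R R' X x) =
      (unitR R R' X).rTensor _ (X.coact x) := by
  apply rTensor_injective _ (inclRight_inclRight_injective R R' X)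
  rw [LinearMap.rTensor_comp_apply, inclRight_coact, ← splitR_natural, unitR_spec, splitR_splitR,
    splitR_coact, ← LinearMap.rTensor_comp_apply, ← LinearMap.rTensor_comp_apply]
  exact congrArg (fun f => LinearMap.rTensor _ f (X.coact x)) (LinearMap.ext fun w =>
      (unitR_spec R R' X w).symm)

variable {R R'} in
/-- The map `(X ⊗ A(R, R')) ⊗ A(R', R) → X` given by a bilinear form on
`A(R, R') ⊗ A(R', R)`. -/
def formR (θ : QHom R R' ⊗[k] QHom R' R →ₗ[k] k) (X : Type u) [AddCommGroup X] [Module k X] :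
    (X ⊗[k] QHom R R') ⊗[k] QHom R' R →ₗ[k] X :=
  (TensorProduct.rid k X).toLinearMap ∘ₗ θ.lTensor X ∘ₗ
    (TensorProduct.assoc k _ _ _).toLinearMap

section Form

variable {R R'} {θ : QHom R R' ⊗[k] QHom R' R →ₗ[k] k} {X Y : Type u} [AddCommGroup X] [Module k X]
  [AddCommGroup Y] [Module k Y]

lemma formR_natural (f : X →ₗ[k] Y) (s : (X ⊗[k] QHom R R') ⊗[k] QHom R' R) :
    formR θ Y ((f.rTensor _).rTensor _ s) = f (formR θ X s) := by
  induction s using tensor_ind with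
  | add a b ha hb => simp only [map_add, ha, hb]
  | tmul s b =>
    induction s using tensor_ind with
    | add a b ha hb => simp only [TensorProduct.add_tmul, map_add, ha, hb]
    | tmul x a => simp [formR]

lemma formR_splitR (hθ : ∀ a : FRT R, θ (comulHom R R' R a) = counitHom R a)
    (s : X ⊗[k] FRT R) : formR θ X (splitR R R' R X s) =
      TensorProduct.rid k X ((counitHom R).toLinearMap.lTensor X s) := by
  induction s using tensor_ind with
  | add a b ha hb => simp only [map_add, ha, hb]
  | tmul a x => simp [formR, splitR_tmul, hθ]

end Form

lemma splitR_coact_formR {θ : QHom R R' ⊗[k] QHom R' R →ₗ[k] k}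
    (hθ : ∀ a : FRT R, θ (comulHom R R' R a) = counitHom R a)
    (z : (X ⊗[k] QHom R R') ⊗[k] QHom R' R)
    (h1 : splitR R' R' R _ z = (splitR R R' R' X).rTensor _ z)
    (h2 : (X.coact.rTensor _).rTensor _ z = (splitR R R R' X).rTensor _ z) :
    splitR R R' R X (X.coact (formR θ X z)) = z := by
  have h3 : ((splitR R R' R X).rTensor (QHom R R')).rTensor (QHom R' R)
      ((splitR R R R' X).rTensor _ z) =
      (splitR R' R R' (X ⊗[k] QHom R R')).rTensor _ ((splitR R R' R' X).rTensor _ z) := by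
    rw [← LinearMap.rTensor_comp_apply, ← LinearMap.rTensor_comp_apply]
    exact congrArg (fun f => LinearMap.rTensor _ f z) (LinearMap.ext fun w =>
      (splitR_splitR R R' R R' w).symm)
  calc splitR R R' R X (X.coact (formR θ X z))
      = splitR R R' R X (formR θ _ ((splitR R R R' X).rTensor _ z)) := by
        rw [← formR_natural X.coact, h2]
    _ = formR θ _ ((splitR R' R R' (X ⊗[k] QHom R R')).rTensor _ (splitR R' R' R _ z)) := by
        rw [← formR_natural (splitR R R' R X), h3, h1]
    _ = z := by rw [← splitR_splitR, formR_splitR hθ, counit_splitR]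

lemma unitR_bijective (h : IsGeneratedBy R R') : Function.Bijective (unitR R R' X) := by
  obtain ⟨θ, hθ⟩ := exists_form h
  constructor
  · refine Function.LeftInverse.injective (g := fun y => formR θ X
      ((inclRight R R' X).rTensor _ (inclRight R' R _ y))) fun x => ?_
    simp only
    rw [unitR_spec, formR_splitR hθ]
    exact X.counit_apply x
  · intro y
    have h1 : splitR R' R' R _ ((inclRight R R' X).rTensor _ (inclRight R' R _ y)) =
        (splitR R R' R' X).rTensor _ ((inclRight R R' X).rTensor _ (inclRight R' R _ y)) := by
      rw [splitR_natural, splitR_inclRight, ← LinearMap.rTensor_comp_apply,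
        ← LinearMap.rTensor_comp_apply]
      exact congrArg (fun f => LinearMap.rTensor _ f (inclRight R' R _ y)) (LinearMap.ext fun w =>
        inclRight_coact R R' X w)
    have h2 : (X.coact.rTensor _).rTensor _ ((inclRight R R' X).rTensor _ (inclRight R' R _ y)) =
        (splitR R R R' X).rTensor _ ((inclRight R R' X).rTensor _ (inclRight R' R _ y)) := by
      rw [← LinearMap.rTensor_comp_apply, ← LinearMap.rTensor_comp_apply]
      exact congrArg (fun f => LinearMap.rTensor _ f (inclRight R' R _ y)) (LinearMap.ext fun w =>
        (splitR_inclRight R R' X w).symm)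
    exact ⟨_, inclRight_inclRight_injective R R' X ((unitR_spec R R' X _).trans
      (splitR_coact_formR R R' X hθ _ h1 h2))⟩

lemma unitR_natural {X Y : RightComod k (FRT R)} (f : X ⟶ Y) (x : X) :
    unitR R R' Y (f.lin x) =
      ((cotensorRight R' R).map ((cotensorRight R R').map f)).lin (unitR R R' X x) := by
  apply inclRight_inclRight_injective R R' Y
  change (inclRight R R' Y).rTensor _ (inclRight R' R _ (unitR R R' Y _)) =
    (inclRight R R' Y).rTensor _ (inclRight R' R _ _)
  rw [unitR_spec, inclRight_map, RightComod.comm_apply, splitR_natural, ← unitR_spec,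
    ← LinearMap.rTensor_comp_apply, ← LinearMap.rTensor_comp_apply]
  exact congrArg (fun g => LinearMap.rTensor _ g (inclRight R' R _ (unitR R R' X x)))
    (LinearMap.ext fun w => (inclRight_map R' f w).symm)

/-- The natural isomorphism `X ≅ (X □ A(R, R')) □ A(R', R)`. -/
def unitIsoR (h : IsGeneratedBy R R') :
    𝟭 (RightComod k (FRT R)) ≅ cotensorRight R R' ⋙ cotensorRight R' R :=
  NatIso.ofComponents (fun X => RightComod.isoMk (X := X)
      (Y := (cotensorRight R' R).obj ((cotensorRight R R').obj X))
      (LinearEquiv.ofBijective (unitR R R' X) (unitR_bijective R R' X h))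
      (LinearMap.ext (unitR_colinear R R' X))) fun {X Y} f => by
    ext1
    exact LinearMap.ext (unitR_natural R R' f)

lemma isEquivalence_cotensorRight (h : IsGeneratedBy R R') (h' : IsGeneratedBy R' R) :
    (cotensorRight R R').IsEquivalence :=
  (CategoryTheory.Equivalence.mk (cotensorRight R R') (cotensorRight R' R) (unitIsoR R R' h)
    (unitIsoR R' R h').symm).isEquivalence_functor

end Right
end QHom

/-! ### The monoidal structure of the functor on right comodules -/

namespace QHom

variable {k : Type u} [Field k] {q : k} {V₀ V₁ V₂ V V' : Type u}
  [AddCommGroup V₀] [Module k V₀] [Module.Finite k V₀]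
  [AddCommGroup V₁] [Module k V₁] [Module.Finite k V₁]
  [AddCommGroup V₂] [Module k V₂] [Module.Finite k V₂]
  [AddCommGroup V] [Module k V] [Module.Finite k V]
  [AddCommGroup V'] [Module k V'] [Module.Finite k V']

section Right

lemma splitR_mm (R₀ : HeckeSymmetry k q V₀) (R₁ : HeckeSymmetry k q V₁)
    (R₂ : HeckeSymmetry k q V₂) {X Y : Type u} [AddCommGroup X] [Module k X] [AddCommGroup Y]
    [Module k Y] (s : X ⊗[k] QHom R₀ R₂) (t : Y ⊗[k] QHom R₀ R₂) :
    splitR R₀ R₁ R₂ (X ⊗[k] Y) (RightComod.mm X Y (s ⊗ₜ t)) =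
      (RightComod.mm X Y).rTensor _ (RightComod.mm _ _
        (splitR R₀ R₁ R₂ X s ⊗ₜ splitR R₀ R₁ R₂ Y t)) := by
  induction s using tensor_ind with
  | add a b ha hb => simp only [TensorProduct.add_tmul, map_add, ha, hb]
  | tmul x a =>
    induction t using tensor_ind with
    | add a b ha hb => simp only [TensorProduct.tmul_add, map_add, ha, hb]
    | tmul y b =>
      rw [RightComod.mm_tmul, splitR_tmul, splitR_tmul, splitR_tmul, map_mul]
      generalize comulHom R₀ R₁ R₂ a = s
      generalize comulHom R₀ R₁ R₂ b = t
      induction s using tensor_ind with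
      | add a b ha hb =>
        simp only [add_mul, TensorProduct.tmul_add, TensorProduct.add_tmul, map_add, ha, hb]
      | tmul a a' =>
        induction t using tensor_ind with
        | add a b ha hb => simp only [mul_add, TensorProduct.tmul_add, map_add, ha, hb]
        | tmul b b' =>
          rw [Algebra.TensorProduct.tmul_mul_tmul, TensorProduct.assoc_symm_tmul,
            TensorProduct.assoc_symm_tmul, TensorProduct.assoc_symm_tmul, RightComod.mm_tmul,
            LinearMap.rTensor_tmul, RightComod.mm_tmul]

variable (R : HeckeSymmetry k q V) (R' : HeckeSymmetry k q V') (X Y : RightComod k (FRT R))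

lemma mm_inclRight_mem (x : (cotensorRight R R').obj X) (y : (cotensorRight R R').obj Y) :
    RightComod.mm X Y (inclRight R R' X x ⊗ₜ inclRight R R' Y y) ∈
      LinearMap.range (inclRight R R' (X ⊗ Y)) := by
  rw [mem_range_inclRight]
  refine (splitR_mm R R R' _ _).trans ?_
  rw [splitR_inclRight, splitR_inclRight, RightComod.mm_natural]
  exact (LinearMap.rTensor_comp_apply _ _ _ _).symm

/-- The multiplication of the algebra `A(R, R')` applied to tensor products of elements of two
cotensor products. -/
def mmInclR : (cotensorRight R R').obj X ⊗[k] (cotensorRight R R').obj Y →ₗ[k]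
    (X ⊗[k] Y) ⊗[k] QHom R R' :=
  RightComod.mm X Y ∘ₗ TensorProduct.map (inclRight R R' X) (inclRight R R' Y)

lemma mmInclR_mem (z : (cotensorRight R R').obj X ⊗[k] (cotensorRight R R').obj Y) :
    mmInclR R R' X Y z ∈ LinearMap.range (inclRight R R' (X ⊗ Y)) := by
  induction z using tensor_ind with
  | add a b ha hb => rw [map_add]; exact add_mem ha hb
  | tmul x y => exact mm_inclRight_mem R R' X Y x y

/-- The monoidal structure map `(X □ A(R, R')) ⊗ (Y □ A(R, R')) → (X ⊗ Y) □ A(R, R')`. -/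
def tensoratorLinR : (cotensorRight R R').obj X ⊗[k] (cotensorRight R R').obj Y →ₗ[k]
    (cotensorRight R R').obj (X ⊗ Y) :=
  liftInj _ (inclRight_injective R R' (X ⊗ Y)) (mmInclR R R' X Y) (mmInclR_mem R R' X Y)

lemma inclRight_tensoratorLinR (x : (cotensorRight R R').obj X) (y : (cotensorRight R R').obj Y) :
    inclRight R R' (X ⊗ Y) (tensoratorLinR R R' X Y (x ⊗ₜ y)) =
      RightComod.mm X Y (inclRight R R' X x ⊗ₜ inclRight R R' Y y) :=
  liftInj_spec _ (inclRight_injective R R' (X ⊗ Y)) (mmInclR R R' X Y) (mmInclR_mem R R' X Y) _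

lemma inclRight_comp_tensoratorLinR :
    inclRight R R' (X ⊗ Y) ∘ₗ tensoratorLinR R R' X Y = mmInclR R R' X Y :=
  TensorProduct.ext' (inclRight_tensoratorLinR R R' X Y)

/-- The monoidal structure map as a homomorphism of comodules. -/
def tensoratorR : (cotensorRight R R').obj X ⊗ (cotensorRight R R').obj Y ⟶
    (cotensorRight R R').obj (X ⊗ Y) where
  lin := tensoratorLinR R R' X Y
  comm := by
    refine TensorProduct.ext' fun x y => ?_
    apply rTensor_injective _ (inclRight_injective R R' (X ⊗ Y))
    rw [LinearMap.comp_apply, LinearMap.comp_apply, inclRight_coact, inclRight_tensoratorLinR,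
      ← LinearMap.rTensor_comp_apply]
    refine (splitR_mm R R' R' _ _).trans ?_
    rw [← inclRight_coact, ← inclRight_coact, RightComod.mm_natural, ← LinearMap.rTensor_comp_apply]
    exact congrArg (fun f => LinearMap.rTensor _ f _) (inclRight_comp_tensoratorLinR R R' X Y).symm

lemma tmul_one_mem (c : k) : ((TensorProduct.mk k k (QHom R R')).flip 1) c ∈
    LinearMap.range (inclRight R R' (𝟙_ (RightComod k (FRT R)))) := by
  rw [mem_range_inclRight]
  change splitR R R R' k (c ⊗ₜ 1) = (c ⊗ₜ 1) ⊗ₜ 1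
  rw [splitR_tmul, map_one]; rfl

/-- The linear map `k → k □ A(R, R')`, `c ↦ c ⊗ 1`. -/
def unitorLinR : k →ₗ[k] (cotensorRight R R').obj (𝟙_ (RightComod k (FRT R))) :=
  liftInj _ (inclRight_injective R R' (𝟙_ (RightComod k (FRT R))))
    ((TensorProduct.mk k k (QHom R R')).flip 1) (tmul_one_mem R R')

lemma inclRight_unitorLinR (c : k) :
    inclRight R R' (𝟙_ (RightComod k (FRT R))) (unitorLinR R R' c) = c ⊗ₜ 1 :=
  liftInj_spec _ (inclRight_injective R R' (𝟙_ (RightComod k (FRT R))))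
    ((TensorProduct.mk k k (QHom R R')).flip 1) (tmul_one_mem R R') c

/-- The map `k → k □ A(R, R')`, `c ↦ c ⊗ 1`, as a homomorphism of comodules. -/
def unitorR : 𝟙_ (RightComod k (FRT R')) ⟶
    (cotensorRight R R').obj (𝟙_ (RightComod k (FRT R))) where
  lin := unitorLinR R R'
  comm := by
    refine LinearMap.ext fun c => ?_
    apply rTensor_injective _ (inclRight_injective R R' (𝟙_ (RightComod k (FRT R))))
    change (inclRight R R' (𝟙_ (RightComod k (FRT R)))).rTensor _
      (RightComod.coact _ (unitorLinR R R' c)) =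
      (inclRight R R' (𝟙_ (RightComod k (FRT R)))).rTensor _ (unitorLinR R R' c ⊗ₜ 1)
    rw [inclRight_coact, LinearMap.rTensor_tmul, inclRight_unitorLinR, splitR_tmul, map_one]
    rfl

lemma hom_ext_inclRight {Z : RightComod k (FRT R')} {X : RightComod k (FRT R)}
    {f g : Z ⟶ (cotensorRight R R').obj X}
    (h : inclRight R R' X ∘ₗ f.lin = inclRight R R' X ∘ₗ g.lin) : f = g := by
  ext1
  exact LinearMap.ext fun z => inclRight_injective R R' X (LinearMap.congr_fun h z)

variable {R X Y} in
lemma inclRight_tensoratorLinR_map {X' Y' : RightComod k (FRT R)} (f : X ⟶ X') (g : Y ⟶ Y')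
    (x : (cotensorRight R R').obj X) (y : (cotensorRight R R').obj Y) :
    inclRight R R' (X' ⊗ Y') (tensoratorLinR R R' X' Y'
      (((cotensorRight R R').map f).lin x ⊗ₜ ((cotensorRight R R').map g).lin y)) =
    inclRight R R' (X' ⊗ Y') (((cotensorRight R R').map (f ⊗ₘ g)).lin
      (tensoratorLinR R R' X Y (x ⊗ₜ y))) := by
  rw [inclRight_tensoratorLinR, inclRight_map, inclRight_map, inclRight_map,
    inclRight_tensoratorLinR, RightComod.mm_natural]
  rfl

/-- The functor `? □ A(R, R')` as a lax monoidal functor. -/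
abbrev laxMonoidalR : (cotensorRight R R').LaxMonoidal where
  ε := unitorR R R'
  μ X Y := tensoratorR R R' X Y
  μ_natural_left {X Y} f Z := by
    refine hom_ext_inclRight R R' (TensorProduct.ext' fun x z => ?_)
    rw [← MonoidalCategory.tensorHom_id]
    refine Eq.trans ?_ (inclRight_tensoratorLinR_map R' f (𝟙 Z) x z)
    rw [CategoryTheory.Functor.map_id]; rfl
  μ_natural_right {X Y} Z f := by
    refine hom_ext_inclRight R R' (TensorProduct.ext' fun z x => ?_)
    rw [← MonoidalCategory.id_tensorHom]
    refine Eq.trans ?_ (inclRight_tensoratorLinR_map R' (𝟙 Z) f z x)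
    rw [CategoryTheory.Functor.map_id]; rfl
  associativity X Y Z := by
    refine hom_ext_inclRight R R' (TensorProduct.ext_threefold fun x y z => ?_)
    change inclRight R R' _ (((cotensorRight R R').map (α_ X Y Z).hom).lin
      (tensoratorLinR R R' (X ⊗ Y) Z (tensoratorLinR R R' X Y (x ⊗ₜ y) ⊗ₜ z))) =
      inclRight R R' _ (tensoratorLinR R R' X (Y ⊗ Z) (x ⊗ₜ tensoratorLinR R R' Y Z (y ⊗ₜ z)))
    rw [inclRight_map, inclRight_tensoratorLinR, inclRight_tensoratorLinR, inclRight_tensoratorLinR,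
      inclRight_tensoratorLinR]
    exact (RightComod.mm_assoc _ _ _).symm
  left_unitality X := by
    refine hom_ext_inclRight R R' (TensorProduct.ext' fun (c : k) x => ?_)
    change inclRight R R' X (c • x) = inclRight R R' _ (((cotensorRight R R').map (λ_ X).hom).lin
      (tensoratorLinR R R' (𝟙_ _) X (unitorLinR R R' c ⊗ₜ x)))
    rw [inclRight_map, inclRight_tensoratorLinR, inclRight_unitorLinR, map_smul]
    exact (RightComod.mm_one_left c _).symm
  right_unitality X := by
    refine hom_ext_inclRight R R' (TensorProduct.ext' fun x (c : k) => ?_)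
    change inclRight R R' X (c • x) = inclRight R R' _ (((cotensorRight R R').map (ρ_ X).hom).lin
      (tensoratorLinR R R' X (𝟙_ _) (x ⊗ₜ unitorLinR R R' c)))
    rw [inclRight_map, inclRight_tensoratorLinR, inclRight_unitorLinR, map_smul]
    exact (RightComod.mm_one_right _ c).symm

/-- The natural map `X → (X □ A(R, R')) □ A(R', R)` is monoidal. -/
lemma unitR_tensor (x : X) (y : Y) : unitR R R' (X ⊗ Y) (x ⊗ₜ y) =
    ((cotensorRight R' R).map (tensoratorR R R' X Y)).lin
      (tensoratorLinR R' R _ _ (unitR R R' X x ⊗ₜ unitR R R' Y y)) := by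
  apply inclRight_inclRight_injective R R' (X ⊗ Y)
  change (inclRight R R' (X ⊗ Y)).rTensor _ (inclRight R' R _ (unitR R R' (X ⊗ Y) _)) =
    (inclRight R R' (X ⊗ Y)).rTensor _ (inclRight R' R _ _)
  rw [unitR_spec, inclRight_map, inclRight_tensoratorLinR, ← LinearMap.rTensor_comp_apply]
  refine (splitR_mm R R' R (X.coact x) (Y.coact y)).trans ?_
  rw [← unitR_spec, ← unitR_spec, RightComod.mm_natural, ← LinearMap.rTensor_comp_apply]
  exact congrArg (fun f => LinearMap.rTensor _ f _) (inclRight_comp_tensoratorLinR R R' X Y).symm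

lemma unitR_one (c : k) : unitR R R' (𝟙_ (RightComod k (FRT R))) c =
    ((cotensorRight R' R).map (unitorR R R')).lin (unitorLinR R' R c) := by
  apply inclRight_inclRight_injective R R' (𝟙_ (RightComod k (FRT R)))
  change (inclRight R R' (𝟙_ (RightComod k (FRT R)))).rTensor _
      (inclRight R' R _ (unitR R R' (𝟙_ (RightComod k (FRT R))) c)) =
    (inclRight R R' (𝟙_ (RightComod k (FRT R)))).rTensor _ (inclRight R' R _ _)
  rw [unitR_spec, inclRight_map, inclRight_unitorLinR, LinearMap.rTensor_tmul,
    LinearMap.rTensor_tmul]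
  refine (splitR_tmul R R' R 1 c).trans ?_
  rw [map_one]
  exact congrArg (fun t => t ⊗ₜ[k] (1 : QHom R' R)) (inclRight_unitorLinR R R' c).symm

lemma unitIsoR_tensor (h : IsGeneratedBy R R') :
    (((unitIsoR R R' h).hom.app X ⊗ₘ (unitIsoR R R' h).hom.app Y) ≫ tensoratorR R' R _ _) ≫
      (cotensorRight R' R).map (tensoratorR R R' X Y) = (unitIsoR R R' h).hom.app (X ⊗ Y) := by
  ext1
  exact TensorProduct.ext' fun x y => (unitR_tensor R R' X Y x y).symm

lemma unitIsoR_one (h : IsGeneratedBy R R') :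
    unitorR R' R ≫ (cotensorRight R' R).map (unitorR R R') =
      (unitIsoR R R' h).hom.app (𝟙_ (RightComod k (FRT R))) := by
  ext1
  exact LinearMap.ext fun c => (unitR_one R R' c).symm

lemma epi_tensoratorR (h : IsGeneratedBy R R') (h' : IsGeneratedBy R' R) :
    Epi (tensoratorR R R' X Y) := by
  have := isEquivalence_cotensorRight R' R h' h
  have : IsIso ((((unitIsoR R R' h).hom.app X ⊗ₘ (unitIsoR R R' h).hom.app Y) ≫
      tensoratorR R' R _ _) ≫ (cotensorRight R' R).map (tensoratorR R R' X Y)) := by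
    rw [unitIsoR_tensor]; infer_instance
  exact epi_of_isIso_comp_map (cotensorRight R' R)
    (((unitIsoR R R' h).hom.app X ⊗ₘ (unitIsoR R R' h).hom.app Y) ≫ tensoratorR R' R _ _)
    (tensoratorR R R' X Y)

/-- The monoidal structure maps are invertible, as they are epimorphisms in both directions and
their composites are the components of the natural isomorphism `unitIsoR`. -/
lemma isIso_tensoratorR (h : IsGeneratedBy R R') (h' : IsGeneratedBy R' R) :
    IsIso (tensoratorR R R' X Y) := by
  have := isEquivalence_cotensorRight R' R h' h
  have : IsIso ((((unitIsoR R R' h).hom.app X ⊗ₘ (unitIsoR R R' h).hom.app Y) ≫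
      tensoratorR R' R _ _) ≫ (cotensorRight R' R).map (tensoratorR R R' X Y)) := by
    rw [unitIsoR_tensor]; infer_instance
  have := epi_tensoratorR R' R ((cotensorRight R R').obj X) ((cotensorRight R R').obj Y) h' h
  have : Epi (((unitIsoR R R' h).hom.app X ⊗ₘ (unitIsoR R R' h).hom.app Y) ≫
      tensoratorR R' R _ _) := epi_comp _ _
  exact isIso_of_isIso_comp_map (cotensorRight R' R)
    (((unitIsoR R R' h).hom.app X ⊗ₘ (unitIsoR R R' h).hom.app Y) ≫ tensoratorR R' R _ _)
    (tensoratorR R R' X Y)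

lemma isIso_unitorR (h : IsGeneratedBy R R') (h' : IsGeneratedBy R' R) : IsIso (unitorR R R') := by
  have := isEquivalence_cotensorRight R' R h' h
  have := isEquivalence_cotensorRight R R' h h'
  have : IsIso (unitorR R' R ≫ (cotensorRight R' R).map (unitorR R R')) := by
    rw [unitIsoR_one R R' h]; infer_instance
  have : IsIso (unitorR R R' ≫ (cotensorRight R R').map (unitorR R' R)) := by
    rw [unitIsoR_one R' R h']; infer_instance
  have : Epi (unitorR R' R) := epi_of_isIso_comp_map (cotensorRight R R') (unitorR R R') _
  exact isIso_of_isIso_comp_map (cotensorRight R' R) (unitorR R' R) _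

end Right
end QHom

/-! ### The braiding of right comodules -/

namespace QHom

variable {k : Type u} [Field k] {q : k} {V V' : Type u}
  [AddCommGroup V] [Module k V] [Module.Finite k V]
  [AddCommGroup V'] [Module k V'] [Module.Finite k V']

section Swap

variable {A M N M' N' : Type u} [Ring A] [Bialgebra k A] [Coquasitriangular k A]
  [AddCommGroup M] [Module k M] [AddCommGroup N] [Module k N]
  [AddCommGroup M'] [Module k M'] [AddCommGroup N'] [Module k N']

/-- The map `(x ⊗ a) ⊗ (y ⊗ b) ↦ r(b, a) y ⊗ x` from which the braiding of right comodules is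
obtained. In contrast to `RightComod.braidAux`, it is defined for vector spaces. -/
def swapR (A M N : Type u) [Ring A] [Bialgebra k A] [Coquasitriangular k A]
    [AddCommGroup M] [Module k M] [AddCommGroup N] [Module k N] :
    (M ⊗[k] A) ⊗[k] (N ⊗[k] A) →ₗ[k] N ⊗[k] M :=
  (TensorProduct.comm k M N).toLinearMap ∘ₗ (TensorProduct.rid k (M ⊗[k] N)).toLinearMap ∘ₗ
    (RightComod.rFlip k A).lTensor (M ⊗[k] N) ∘ₗ (tensorTensorTensorComm k M A N A).toLinearMap

lemma swapR_tmul (a b : A) (x : M) (y : N) : swapR A M N ((x ⊗ₜ[k] a) ⊗ₜ (y ⊗ₜ[k] b)) =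
    Coquasitriangular.r (k := k) (b ⊗ₜ a) • (y ⊗ₜ x) := by
  simp [swapR, RightComod.rFlip]

lemma map_swapR (f : M →ₗ[k] M') (g : N →ₗ[k] N') (s : M ⊗[k] A) (t : N ⊗[k] A) :
    TensorProduct.map g f (swapR A M N (s ⊗ₜ t)) =
      swapR A M' N' (f.rTensor A s ⊗ₜ g.rTensor A t) := by
  induction s using tensor_ind with
  | add a b ha hb => simp only [TensorProduct.add_tmul, map_add, ha, hb]
  | tmul x c =>
    induction t using tensor_ind with
    | add a b ha hb => simp only [TensorProduct.tmul_add, map_add, ha, hb]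
    | tmul y d => simp [swapR_tmul]

end Swap

section Right

variable (R : HeckeSymmetry k q V) (R' : HeckeSymmetry k q V') {X Y : Type u}
  [AddCommGroup X] [Module k X] [AddCommGroup Y] [Module k Y]

lemma mm_swapR (u v : QHom R R' ⊗[k] FRT R') (x : X) (y : Y) :
    RightComod.mm Y X (swapR (FRT R') (X ⊗[k] QHom R R') (Y ⊗[k] QHom R R')
      ((TensorProduct.assoc k _ _ _).symm (x ⊗ₜ u) ⊗ₜ
        (TensorProduct.assoc k _ _ _).symm (y ⊗ₜ v))) =
    (y ⊗ₜ x) ⊗ₜ LinearMap.mul' k _ (TensorProduct.map LinearMap.id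
      (formSmul R' (QHom R R') u) v) := by
  induction u using tensor_ind with
  | add a b ha hb =>
    simp only [TensorProduct.tmul_add, TensorProduct.add_tmul, map_add, ha, hb,
      TensorProduct.map_add_right, LinearMap.add_apply]
  | tmul a c =>
    induction v using tensor_ind with
    | add a b ha hb => simp only [TensorProduct.tmul_add, map_add, ha, hb]
    | tmul b d =>
      rw [TensorProduct.assoc_symm_tmul, TensorProduct.assoc_symm_tmul, swapR_tmul, map_smul,
        TensorProduct.map_tmul, LinearMap.mul'_apply, formSmul_tmul, mul_smul_comm,
        TensorProduct.tmul_smul]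
      exact congrArg (_ • ·) (RightComod.mm_tmul _ _ _ _)

lemma rTensor_swapR_mm (u v : FRT R ⊗[k] QHom R R') (x : X) (y : Y) :
    (swapR (FRT R) X Y).rTensor (QHom R R') (RightComod.mm _ _
      ((TensorProduct.assoc k _ _ _).symm (x ⊗ₜ u) ⊗ₜ
        (TensorProduct.assoc k _ _ _).symm (y ⊗ₜ v))) =
    (y ⊗ₜ x) ⊗ₜ LinearMap.mul' k _ (TensorProduct.map
      (formSmul R (QHom R R') (TensorProduct.comm k _ _ u)) LinearMap.id v) := by
  induction u using tensor_ind with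
  | add a b ha hb =>
    simp only [TensorProduct.tmul_add, TensorProduct.add_tmul, map_add, ha, hb,
      TensorProduct.map_add_left, LinearMap.add_apply]
  | tmul c a =>
    induction v using tensor_ind with
    | add a b ha hb => simp only [TensorProduct.tmul_add, map_add, ha, hb]
    | tmul d b =>
      rw [TensorProduct.assoc_symm_tmul, TensorProduct.assoc_symm_tmul, RightComod.mm_tmul,
        LinearMap.rTensor_tmul, swapR_tmul, TensorProduct.map_tmul, LinearMap.mul'_apply,
        TensorProduct.comm_tmul, formSmul_tmul, smul_mul_assoc, TensorProduct.tmul_smul,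
        ← TensorProduct.smul_tmul']
      rfl

/-- The commutation relation `conv_formSmul`, with coefficients in vector spaces. -/
lemma mm_swapR_splitR (s : X ⊗[k] QHom R R') (t : Y ⊗[k] QHom R R') :
    RightComod.mm Y X (swapR (FRT R') (X ⊗[k] QHom R R') (Y ⊗[k] QHom R R')
      (splitR R R' R' X s ⊗ₜ splitR R R' R' Y t)) =
    (swapR (FRT R) X Y).rTensor (QHom R R') (RightComod.mm _ _
      (splitR R R R' X s ⊗ₜ splitR R R R' Y t)) := by
  induction s using tensor_ind with
  | add a b ha hb => simp only [TensorProduct.add_tmul, map_add, ha, hb]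
  | tmul x a =>
    induction t using tensor_ind with
    | add a b ha hb => simp only [TensorProduct.tmul_add, map_add, ha, hb]
    | tmul y b =>
      refine (mm_swapR R R' _ _ x y).trans
        (Eq.trans ?_ (rTensor_swapR_mm R R' _ _ x y).symm)
      exact congrArg ((y ⊗ₜ[k] x) ⊗ₜ[k] ·) (LinearMap.congr_fun (conv_formSmul a) b).symm

variable (X Y : RightComod k (FRT R))

lemma tensoratorR_braiding : tensoratorR R R' X Y ≫ (cotensorRight R R').map (β_ X Y).hom =
    (β_ ((cotensorRight R R').obj X) ((cotensorRight R R').obj Y)).hom ≫ tensoratorR R R' Y X := by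
  refine hom_ext_inclRight R R' (TensorProduct.ext' fun x y => ?_)
  change inclRight R R' (Y ⊗ X) (((cotensorRight R R').map (β_ X Y).hom).lin
    (tensoratorLinR R R' X Y (x ⊗ₜ y))) =
    inclRight R R' (Y ⊗ X) (tensoratorLinR R R' Y X (swapR (FRT R') _ _
      (((cotensorRight R R').obj X).coact x ⊗ₜ ((cotensorRight R R').obj Y).coact y)))
  rw [inclRight_map, inclRight_tensoratorLinR]
  refine Eq.trans ?_ (LinearMap.congr_fun (inclRight_comp_tensoratorLinR R R' Y X) _).symm
  rw [mmInclR, LinearMap.comp_apply]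
  refine Eq.trans ?_ (congrArg (RightComod.mm Y X) (map_swapR (inclRight R R' X)
    (inclRight R R' Y) _ _)).symm
  rw [inclRight_coact, inclRight_coact, mm_swapR_splitR, splitR_inclRight, splitR_inclRight,
    RightComod.mm_natural, ← LinearMap.rTensor_comp_apply]
  exact congrArg (fun f => LinearMap.rTensor (QHom R R') f _)
    (TensorProduct.ext' fun x y => RightComod.braidLin_tmul X Y x y)

/-- The functor `? □ A(R, R')` as a braided monoidal functor. -/
abbrev braidedR (h : IsGeneratedBy R R') (h' : IsGeneratedBy R' R) :
    (cotensorRight R R').Braided :=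
  letI := laxMonoidalR R R'
  haveI : IsIso (Functor.LaxMonoidal.ε (cotensorRight R R')) := isIso_unitorR R R' h h'
  haveI : ∀ X Y, IsIso (Functor.LaxMonoidal.μ (cotensorRight R R') X Y) :=
    fun X Y => isIso_tensoratorR R R' X Y h h'
  { Functor.Monoidal.ofLaxMonoidal (cotensorRight R R') with
    braided := fun X Y => tensoratorR_braiding R R' X Y }

end Right
end QHom

end

theorem theorem7p2 {k : Type u} [Field k] {q : k}
    {V V' : Type u} [AddCommGroup V] [Module k V] [Module.Finite k V]
    [AddCommGroup V'] [Module k V'] [Module.Finite k V']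
    (R : HeckeSymmetry k q V) (R' : HeckeSymmetry k q V')
    (h : ∀ n : ℕ, 1 < n → ∀ (M : Type u) [AddCommGroup M] [Module (HeckeAlg k q n) M],
      IsIndecomposable (HeckeAlg k q n) M →
        (IsDirectSummandOf (HeckeAlg k q n) M (R'.T n) ↔
          IsDirectSummandOf (HeckeAlg k q n) M (R.T n))) :
    ((QHom.cotensorLeft R' R).IsEquivalence ∧
      ∃ _ : (QHom.cotensorLeft R' R).Braided,
        (∀ c : k, QHom.inclLeft R' R (𝟙_ (LeftComod k (FRT R)))
          ((Functor.LaxMonoidal.ε (QHom.cotensorLeft R' R)).lin c) = 1 ⊗ₜ[k] c) ∧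
        ∀ (X Y : LeftComod k (FRT R)) (x : (QHom.cotensorLeft R' R).obj X)
          (y : (QHom.cotensorLeft R' R).obj Y),
          QHom.inclLeft R' R (X ⊗ Y)
            ((Functor.LaxMonoidal.μ (QHom.cotensorLeft R' R) X Y).lin (x ⊗ₜ[k] y)) =
          LeftComod.mm X Y (QHom.inclLeft R' R X x ⊗ₜ[k] QHom.inclLeft R' R Y y)) ∧
    ((QHom.cotensorRight R R').IsEquivalence ∧
      ∃ _ : (QHom.cotensorRight R R').Braided,
        (∀ c : k, QHom.inclRight R R' (𝟙_ (RightComod k (FRT R)))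
          ((Functor.LaxMonoidal.ε (QHom.cotensorRight R R')).lin c) = c ⊗ₜ[k] 1) ∧
        ∀ (X Y : RightComod k (FRT R)) (x : (QHom.cotensorRight R R').obj X)
          (y : (QHom.cotensorRight R R').obj Y),
          QHom.inclRight R R' (X ⊗ Y)
            ((Functor.LaxMonoidal.μ (QHom.cotensorRight R R') X Y).lin (x ⊗ₜ[k] y)) =
          RightComod.mm X Y (QHom.inclRight R R' X x ⊗ₜ[k] QHom.inclRight R R' Y y)) := by
  have g : QHom.IsGeneratedBy R R' :=
    QHom.isGeneratedBy_of_summands R R' fun n hn M _ _ hi hs => (h n hn M hi).2 hs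
  have g' : QHom.IsGeneratedBy R' R :=
    QHom.isGeneratedBy_of_summands R' R fun n hn M _ _ hi hs => (h n hn M hi).1 hs
  exact ⟨⟨QHom.isEquivalence_cotensorLeft R R' g g', QHom.braidedL R R' g g',
    QHom.inclLeft_unitorLinL R R', fun X Y => QHom.inclLeft_tensoratorLinL R R' X Y⟩,
    QHom.isEquivalence_cotensorRight R R' g g', QHom.braidedR R R' g g',
    QHom.inclRight_unitorLinR R R', fun X Y => QHom.inclRight_tensoratorLinR R R' X Y⟩
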